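/- Let $\Sigma$ be a compact connected Riemann surface. **Potential.** Let $\eta=\sum_{k\ge -1}\eta_k\lambda^k$ ($0<|\lambda|<r$ for some $r>1$) be a meromorphic DPW potential on $\Sigma$, i.e. a family of meromorphic $\mathfrak{sl}(2,\mathbb C)$-valued $1$-forms, holomorphic in $\lambda$, with poles in a finite set $\{p_1,\dots,p_n\}\subset\Sigma$ and with $\eta_{-1}$ nilpotent. For a gauge transformation $g$ write $(d+\eta).g=d+g^{-1}\eta g+g^{-1}dg$. Assume: (i) (intrinsic closing condition, apparent singularities) there is a family $B=b_0+b_1\lambda+\dots$ of $\mathrm{SL}(2,\mathbb C)$-valued maps, holomorphic in $|\lambda|<r$ and smooth on $\Sigma\setminus\{p_1,\dots,p_n\}$, with $(d+\eta).B=\nabla+\lambda^{-1}\Phi-\lambda\Phi^*$ for a smooth $\mathrm{SU}(2)$-connection $\nabla$ and a smooth $\mathfrak{sl}(2,\mathbb C)$-valued $(1,0)$-form $\Phi$ on $\Sigma$; (ii) (extrinsic closing condition, period lattice of rank $2$) the connection $\nabla+\Phi-\Phi^*$ (at $\lambda=1$) has trivial monodromy, and in an $\mathrm{SU}(2)$-frame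 parallel for it the periods of the $1$-form $df=-2i(\Phi+\Phi^*)$ generate a lattice of rank $2$ in $\mathfrak{su}(2)$; (iii) with $\lambda=e^{i\tau}$, pointwise on $\Sigma\setminus\{p_1,\dots,p_n\}$, $$\eta=\tau\,\vartheta_1+\tfrac{\tau^2}{2}\,\vartheta_2+O(\tau^3)\qquad(\tau\to0)$$ with meromorphic $\mathfrak{sl}(2,\mathbb C)$-valued $1$-forms $\vartheta_1,\vartheta_2$ with poles in $\{p_1,\dots,p_n\}$ (in particular $\eta=0$ at $\lambda=1$), and $\vartheta_1$ is off-diagonal. **Curvature.** Let $g=g(\tau)$, $|\tau|<\varepsilon$, be a harmonic gauge: a smooth family of maps $\Sigma\setminus\{p_1,\dots,p_n\}\to\mathrm{SL}(2,\mathbb C)$ with $g(0)=\mathrm{Id}$ such that $D^\tau=(d+\eta|_{\lambda=e^{i\tau}}).g(\tau)$ extends to a smooth family of connections on $\Sigma$ whose derivative $D'$ at $\tau=0$ is a harmonic $1$-form. Let $D''$ be the second derivative at $\tau=0$ and $$K=\frac{i}{2\pi}\int_\Sigma\operatorname{tr}(D'\wedge D'')$$ the curvature of the family $D^\tau$. **Theorem.**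 Near each $p_j$ the form $\vartheta_1$ has an off-diagonal meromorphic primitive, and for every choice of off-diagonal meromorphic primitives $F_1^j$ of $\vartheta_1$ near $p_j$, $$K=-\sum_{j=1}^n\operatorname{tr}\bigl(\operatorname{Res}_{p_j}(F_1^j\,\vartheta_2)\bigr).$$ -/

import Mathlib

open scoped Manifold ContDiff Topology Matrix
open Set Filter Asymptotics

noncomputable section

/-- Complex `2 × 2` matrices. -/
abbrev Mat : Type := Matrix (Fin 2) (Fin 2) ℂ

section Forms

variable {X : Type*} [TopologicalSpace X] [ChartedSpace ℂ X]

/-- Complex-valued (real-linear) one-forms on a Riemann surface `X`. -/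
abbrev SForm (X : Type*) [TopologicalSpace X] [ChartedSpace ℂ X] : Type _ :=
  (x : X) → TangentSpace 𝓘(ℝ, ℂ) x →L[ℝ] ℂ

/-- Matrix-valued one-forms on `X`, given by their entries. -/
abbrev MForm (X : Type*) [TopologicalSpace X] [ChartedSpace ℂ X] : Type _ :=
  Fin 2 → Fin 2 → SForm X

/-- The value of a matrix-valued one-form on a tangent vector. -/
def MForm.at (α : MForm X) (x : X) (v : TangentSpace 𝓘(ℝ, ℂ) x) : Mat :=
  Matrix.of fun i j => α i j x v

/-- The expression `(e⁻¹)^* α` of a one-form in the chart `e`. -/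
def localForm (e : OpenPartialHomeomorph X ℂ) (α : SForm X) (z : ℂ) : ℂ →L[ℝ] ℂ :=
  (α (e.symm z)).comp (mfderiv 𝓘(ℝ, ℂ) 𝓘(ℝ, ℂ) e.symm z)

/-- The value on the vector `u` of the expression of a matrix-valued form in the chart `e`. -/
def localMat (e : OpenPartialHomeomorph X ℂ) (α : MForm X) (z u : ℂ) : Mat :=
  Matrix.of fun i j => localForm e (α i j) z u

/-- A smooth one-form on `X`. -/
def IsSmoothForm (α : MForm X) : Prop :=
  ∀ e ∈ atlas ℂ X, ∀ i j, ContDiffOn ℝ ∞ (localForm e (α i j)) e.target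

/-- `α` is of type `(1,0)` on the set `s`. -/
def IsType10On (α : MForm X) (s : Set X) : Prop :=
  ∀ e ∈ atlas ℂ X, ∀ z ∈ e.target, e.symm z ∈ s → ∀ i j, ∀ u : ℂ,
    localForm e (α i j) z (Complex.I * u) = Complex.I * localForm e (α i j) z u

/-- `α` is a meromorphic one-form on `X` whose poles lie in the finite set `P`: it is of the form
`a(z) dz` in every chart, with `a` holomorphic off `P` and meromorphic at the points of `P`.
(The values of `α` at the points of `P` themselves carry no meaning.) -/
def IsMeromorphicForm (P : Finset X) (α : MForm X) : Prop :=
  IsType10On α {x | x ∉ P} ∧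
  ∀ e ∈ atlas ℂ X, ∀ i j,
    DifferentiableOn ℂ (fun z => localForm e (α i j) z 1) {z | z ∈ e.target ∧ e.symm z ∉ P} ∧
    ∀ z ∈ e.target, MeromorphicAt (fun w => localForm e (α i j) w 1) z

/-- `α` takes values in `sl(2,ℂ)` off `P`. -/
def IsTraceless (P : Finset X) (α : MForm X) : Prop :=
  ∀ x ∉ P, ∀ v, Matrix.trace (α.at x v) = 0

/-- `α` takes off-diagonal values off `P`. -/
def IsOffDiagonalForm (P : Finset X) (α : MForm X) : Prop :=
  ∀ x ∉ P, ∀ v, α.at x v 0 0 = 0 ∧ α.at x v 1 1 = 0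

/-- For a one-form `a` on an open subset of `ℂ`, the coefficient of `dx ∧ dy` in `da`. -/
def curl (a : ℂ → ℂ →L[ℝ] ℂ) (z : ℂ) : ℂ :=
  fderiv ℝ a z 1 Complex.I - fderiv ℝ a z Complex.I 1

/-- The Hodge star of a one-form on an open subset of `ℂ`: `(*a)(v) = - a(i v)`, so that
`*dx = dy` and `*dy = -dx`. -/
def starLocal (a : ℂ → ℂ →L[ℝ] ℂ) (z : ℂ) : ℂ →L[ℝ] ℂ :=
  -((a z).comp (ContinuousLinearMap.mul ℝ ℂ Complex.I))

/-- A harmonic one-form: smooth, `dα = 0` and `d * α = 0`. -/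
def IsHarmonicForm (α : MForm X) : Prop :=
  IsSmoothForm α ∧ ∀ e ∈ atlas ℂ X, ∀ z ∈ e.target, ∀ i j,
    curl (localForm e (α i j)) z = 0 ∧ curl (starLocal (localForm e (α i j))) z = 0

/-- The differential of a matrix-valued function. -/
def dMat (g : X → Mat) (x : X) (v : TangentSpace 𝓘(ℝ, ℂ) x) : Mat :=
  Matrix.of fun i j => mfderiv 𝓘(ℝ, ℂ) 𝓘(ℝ, ℂ) (fun y => g y i j) x v

/-- The connection form `g⁻¹ α g + g⁻¹ dg` of `(d + α).g`, evaluated on the tangent vector `v`. -/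
def gaugeAct (α : MForm X) (g : X → Mat) (x : X) (v : TangentSpace 𝓘(ℝ, ℂ) x) : Mat :=
  (g x)⁻¹ * α.at x v * g x + (g x)⁻¹ * dMat g x v

/-- The matrix product `F α` of a matrix-valued function and a matrix-valued one-form. -/
def mulForm (F : X → Mat) (α : MForm X) : MForm X :=
  fun i j x => ∑ k, F x i k • α k j x

/-- The residue of a function at an isolated singularity, as a contour integral over
arbitrarily small circles (these integrals are eventually constant). -/
def residue (f : ℂ → ℂ) (z₀ : ℂ) : ℂ :=
  limUnder (𝓝[>] (0 : ℝ)) fun ρ => (2 * Real.pi * Complex.I : ℂ)⁻¹ * ∮ z in C(z₀, ρ), f z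

/-- The residue at `p` of a meromorphic matrix-valued one-form. -/
def formResidue (p : X) (α : MForm X) : Mat :=
  Matrix.of fun i j =>
    residue (fun z => localForm (chartAt ℂ p) (α i j) z 1) (chartAt ℂ p p)

/-- `F` is, near `p`, an off-diagonal meromorphic primitive of the meromorphic form `α`. -/
def IsOffDiagonalPrimitiveAt (α : MForm X) (p : X) (F : X → Mat) : Prop :=
  (∀ i j, MeromorphicAt (fun z => F ((chartAt ℂ p).symm z) i j) (chartAt ℂ p p)) ∧
  ∀ᶠ z in 𝓝[≠] (chartAt ℂ p p),
    (∀ i j, HasDerivAt (fun w => F ((chartAt ℂ p).symm w) i j)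
      (localForm (chartAt ℂ p) (α i j) z 1) z) ∧
    F ((chartAt ℂ p).symm z) 0 0 = 0 ∧ F ((chartAt ℂ p).symm z) 1 1 = 0

/-- The derivative at `τ = 0` of a family of connection forms. -/
def firstDeriv (D : ℝ → MForm X) : MForm X :=
  fun i j x => deriv (F := ℂ →L[ℝ] ℂ) (fun τ => D τ i j x) 0

/-- The second derivative at `τ = 0` of a family of connection forms. -/
def secondDeriv (D : ℝ → MForm X) : MForm X :=
  fun i j x => iteratedDeriv (F := ℂ →L[ℝ] ℂ) 2 (fun τ => D τ i j x) 0

end Forms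

section Integration

variable {X : Type*} [TopologicalSpace X] [ChartedSpace ℂ X] [T2Space X] [CompactSpace X]

theorem exists_chartPartition : ∃ ρ : PartitionOfUnity X X univ,
    ρ.IsSubordinate fun x => (chartAt ℂ x).source :=
  PartitionOfUnity.exists_isSubordinate isClosed_univ _ (fun x => (chartAt ℂ x).open_source)
    fun x _ => mem_iUnion.2 ⟨x, mem_chart_source ℂ x⟩

/-- A partition of unity subordinate to the charts. -/
def chartPartition (X : Type*) [TopologicalSpace X] [ChartedSpace ℂ X] [T2Space X]
    [CompactSpace X] : PartitionOfUnity X X univ :=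
  (exists_chartPartition (X := X)).choose

/-- The coefficient of `dx ∧ dy` in the expression of `tr (α ∧ β)` in the chart `e`. -/
def traceWedgeLocal (e : OpenPartialHomeomorph X ℂ) (α β : MForm X) (z : ℂ) : ℂ :=
  Matrix.trace (localMat e α z 1 * localMat e β z Complex.I
    - localMat e α z Complex.I * localMat e β z 1)

/-- The integral `∫_X tr (α ∧ β)` over the compact Riemann surface `X` with its complex
orientation, computed with a partition of unity subordinate to the charts. -/
def integralTraceWedge (α β : MForm X) : ℂ :=
  ∑ᶠ i : X, ∫ z in (chartAt ℂ i).target,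
    (chartPartition X i ((chartAt ℂ i).symm z) : ℂ) * traceWedgeLocal (chartAt ℂ i) α β z

/-- The curvature `K = (i / 2π) ∫_X tr (D' ∧ D'')` of a family `d + D τ` of flat connections in
harmonic gauge. -/
def curvatureK (D : ℝ → MForm X) : ℂ :=
  Complex.I / (2 * Real.pi) * integralTraceWedge (firstDeriv D) (secondDeriv D)

end Integration

section DPW

/-- A DPW potential on `X`: a family `η_λ = ∑_{k ≥ -1} η_k λ^k`, `0 < |λ| < r` with `r > 1`, of
meromorphic `sl(2,ℂ)`-valued one-forms with poles in a finite set, with `η_{-1}` nilpotent. -/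
structure DPWPotential (X : Type*) [TopologicalSpace X] [ChartedSpace ℂ X] where
  /-- the finite set containing the poles -/
  poles : Finset X
  /-- the radius `r` -/
  radius : ℝ
  one_lt_radius : 1 < radius
  /-- `coeff n` is `η_{n-1}` -/
  coeff : ℕ → MForm X
  /-- `form l` is `η` at `λ = l` -/
  form : ℂ → MForm X
  coeff_meromorphic : ∀ n, IsMeromorphicForm poles (coeff n)
  coeff_traceless : ∀ n, IsTraceless poles (coeff n)
  coeff_zero_nilpotent : ∀ x ∉ poles, ∀ v, IsNilpotent ((coeff 0).at x v)
  hasSum : ∀ l : ℂ, l ≠ 0 → ‖l‖ < radius → ∀ x ∉ poles, ∀ v,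
    HasSum (fun n : ℕ => l ^ ((n : ℤ) - 1) • (coeff n).at x v) ((form l).at x v)
  meromorphic : ∀ l : ℂ, l ≠ 0 → ‖l‖ < radius → IsMeromorphicForm poles (form l)
  holomorphic : ∀ e ∈ atlas ℂ X, ∀ i j, DifferentiableOn ℂ
    (fun q : ℂ × ℂ => localForm e (form q.1 i j) q.2 1)
    {q | q.1 ≠ 0 ∧ ‖q.1‖ < radius ∧ q.2 ∈ e.target ∧ e.symm q.2 ∉ poles}

variable {X : Type*} [TopologicalSpace X] [ChartedSpace ℂ X]

/-- A solution of the intrinsic and extrinsic closing conditions for a DPW potential. -/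
structure DPWPotential.ClosingData (η : DPWPotential X) where
  /-- the holomorphic family of gauge transformations `B = b₀ + b₁ λ + …`, singular at the poles -/
  B : ℂ → X → Mat
  /-- the connection form of the unitary connection `∇ = d + A` -/
  A : MForm X
  /-- the Higgs field -/
  Φ : MForm X
  /-- a global frame, parallel for the connection at `λ = 1` -/
  U : X → Mat
  B_smooth : ∀ i j, ContMDiffOn (𝓘(ℝ, ℂ).prod 𝓘(ℝ, ℂ)) 𝓘(ℝ, ℂ) ∞
    (fun q : ℂ × X => B q.1 q.2 i j) {q | ‖q.1‖ < η.radius ∧ q.2 ∉ η.poles}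
  B_holomorphic : ∀ x ∉ η.poles, ∀ i j,
    DifferentiableOn ℂ (fun l => B l x i j) (Metric.ball 0 η.radius)
  B_det : ∀ l : ℂ, ‖l‖ < η.radius → ∀ x ∉ η.poles, (B l x).det = 1
  A_smooth : IsSmoothForm A
  A_unitary : ∀ x v, (A.at x v)ᴴ = -A.at x v ∧ Matrix.trace (A.at x v) = 0
  Φ_smooth : IsSmoothForm Φ
  Φ_type : IsType10On Φ univ
  Φ_traceless : ∀ x v, Matrix.trace (Φ.at x v) = 0
  /-- intrinsic closing condition: `(d + η).B = ∇ + λ⁻¹ Φ - λ Φ^*` -/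
  intrinsic : ∀ l : ℂ, l ≠ 0 → ‖l‖ < η.radius → ∀ x ∉ η.poles, ∀ v,
    gaugeAct (η.form l) (B l) x v = A.at x v + l⁻¹ • Φ.at x v - l • (Φ.at x v)ᴴ
  U_smooth : ∀ i j, ContMDiff 𝓘(ℝ, ℂ) 𝓘(ℝ, ℂ) ∞ fun x => U x i j
  U_unitary : ∀ x, U x ∈ Matrix.specialUnitaryGroup (Fin 2) ℂ
  /-- trivial monodromy at `λ = 1`: the frame `U` is parallel for `∇ + Φ - Φ^*` -/
  extrinsic : ∀ x v, dMat U x v + (A.at x v + Φ.at x v - (Φ.at x v)ᴴ) * U x = 0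

/-- The differential `df = -2i (Φ + Φ^*)` of the CMC surface, in the frame that is parallel for the
connection at `λ = 1`. -/
def DPWPotential.ClosingData.df {η : DPWPotential X} (c : η.ClosingData) (x : X)
    (v : TangentSpace 𝓘(ℝ, ℂ) x) : Mat :=
  (-2 * Complex.I) • ((c.U x)⁻¹ * (c.Φ.at x v + (c.Φ.at x v)ᴴ) * c.U x)

/-- The group of translational periods of the CMC surface, generated by the integrals of `df` over
smooth loops. -/
def DPWPotential.ClosingData.periodGroup {η : DPWPotential X} (c : η.ClosingData) :
    AddSubgroup Mat :=
  AddSubgroup.closure {T | ∃ γ : ℝ → X, ContMDiff 𝓘(ℝ, ℝ) 𝓘(ℝ, ℂ) ∞ γ ∧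
    (∀ t, γ (t + 1) = γ t) ∧
    ∀ i j, T i j = ∫ t in (0 : ℝ)..1, c.df (γ t) (mfderiv 𝓘(ℝ, ℝ) 𝓘(ℝ, ℂ) γ t (1 : ℝ)) i j}

/-- The periods form a lattice of rank two: a discrete group spanning a real plane. -/
def DPWPotential.ClosingData.HasRankTwoPeriods {η : DPWPotential X} (c : η.ClosingData) : Prop :=
  DiscreteTopology c.periodGroup ∧
    Module.finrank ℝ (Submodule.span ℝ (c.periodGroup : Set Mat)) = 2

/-- The expansion `η = τ ϑ₁ + (τ² / 2) ϑ₂ + O(τ³)` at `λ = e^{iτ}`, `τ → 0`, with meromorphic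
`sl(2,ℂ)`-valued forms `ϑ₁`, `ϑ₂`. In particular `η = 0` at `λ = 1`. -/
structure DPWPotential.HasExpansion (η : DPWPotential X) (ϑ₁ ϑ₂ : MForm X) : Prop where
  meromorphic₁ : IsMeromorphicForm η.poles ϑ₁
  meromorphic₂ : IsMeromorphicForm η.poles ϑ₂
  traceless₁ : IsTraceless η.poles ϑ₁
  traceless₂ : IsTraceless η.poles ϑ₂
  expansion : ∀ x ∉ η.poles, ∀ v i j,
    (fun τ : ℝ => η.form (Complex.exp (Complex.I * τ)) i j x v
        - (τ * ϑ₁ i j x v + τ ^ 2 / 2 * ϑ₂ i j x v))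
      =O[𝓝 0] fun τ : ℝ => τ ^ 3

/-- A harmonic gauge `g` for `d + η` near `λ = 1`, normalized by `g = 1` at `λ = 1`: a smooth family
of gauge transformations off the poles such that `(d + η).g` extends to a smooth family `d + D τ` of
connections on the whole surface with harmonic derivative at `τ = 0`. -/
structure DPWPotential.HarmonicGauge (η : DPWPotential X) where
  ε : ℝ
  ε_pos : 0 < ε
  /-- the gauge -/
  g : ℝ → X → Mat
  /-- the connection forms of the gauged family -/
  D : ℝ → MForm X
  g_smooth : ∀ i j, ContMDiffOn (𝓘(ℝ, ℝ).prod 𝓘(ℝ, ℂ)) 𝓘(ℝ, ℂ) ∞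
    (fun q : ℝ × X => g q.1 q.2 i j) {q | q.1 ∈ Ioo (-ε) ε ∧ q.2 ∉ η.poles}
  g_det : ∀ τ ∈ Ioo (-ε) ε, ∀ x ∉ η.poles, (g τ x).det = 1
  g_zero : ∀ x ∉ η.poles, g 0 x = 1
  D_smooth : ∀ e ∈ atlas ℂ X, ∀ i j, ContDiffOn ℝ ∞
    (fun q : ℝ × ℂ => localForm e (D q.1 i j) q.2) (Ioo (-ε) ε ×ˢ e.target)
  D_eq : ∀ τ ∈ Ioo (-ε) ε, ∀ x ∉ η.poles, ∀ v,
    (D τ).at x v = gaugeAct (η.form (Complex.exp (Complex.I * τ))) (g τ) x v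
  harmonic : IsHarmonicForm (firstDeriv D)

end DPW

end

/-! Write `γ = g'(0)` and `δ = g''(0)`, both smooth off the poles. Comparing the terms of order 0,
1, 2 in `τ` of `g D = η g + dg` gives `D(0) = 0`, `D' = ϑ₁ + dγ` and `D'' + 2 γ D' = ϑ₂ + 2 ϑ₁ γ +
dδ` off the poles.

Since `ϑ₁` is off-diagonal, `D'ᵢᵢ = dγᵢᵢ`. As `D'ᵢᵢ` is smooth and harmonic on the closed surface,
`γᵢᵢ` extends to a harmonic function, hence is a constant `aᵢ`, and `D'ᵢᵢ = 0`
(`exists_gDeriv_diag_eq`). For `i ≠ j` the second order equation then says that `κᵢⱼ = D''ᵢⱼ - 2 (aⱼ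
- aᵢ) D'ᵢⱼ` differs from `(ϑ₂)ᵢⱼ` by an exact form (`secondDeriv_offDiag`). Replacing `D''` by `κ`
in `tr (D' ∧ D'')` costs a multiple of `D'₀₁ ∧ D'₁₀`, which is exact because `dD''₀₀ = -2 D'₀₁ ∧
D'₁₀` (`curl_secondDeriv`).

The integrals of `D'ᵢⱼ ∧ κⱼᵢ` are evaluated by a reciprocity law
(`densityIntegral_wedge_eq_sum_residue`). Suppose `α = θ₁ + dγ` and `κ = θ₂ + dδ` off the poles,
with `α` smooth and closed, `κ` smooth, and `θ₁`, `θ₂` holomorphic off the poles. Cut off a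
primitive `F_p` of `θ₁` near `p` to a function `T_p`. Then `γ + ∑ T_p` extends to a smooth `Γ`, the
form `β = α - dΓ` vanishes near the poles, and `θ₁ ∧ θ₂ = 0` for type reasons, so `α ∧ κ = d(Γ κ) -
d(δ β) - ∑ dT_p ∧ θ₂`. Stokes removes the first two terms, and `∫ dT_p ∧ θ₂ = -2πi Res_p (F_p θ₂)`.
With the prefactor `i / 2π` this gives minus the sum of the residues.

Primitives of `ϑ₁` exist near every point because the closed smooth form `D'` has a local primitive
`h`, and `h - γ` is then a primitive of `ϑ₁`; it is meromorphic by `meromorphicAt_of_deriv`. -/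

noncomputable section

/-! ### One-forms and functions in charts -/

section Charts

theorem isOpen_chart_preimage {X : Type*} [TopologicalSpace X]
    (e : OpenPartialHomeomorph X ℂ) {s : Set X} (hs : IsOpen s) :
    IsOpen {z | z ∈ e.target ∧ e.symm z ∈ s} :=
  e.symm.isOpen_inter_preimage hs

variable {X : Type*} [TopologicalSpace X] [ChartedSpace ℂ X] [IsManifold 𝓘(ℂ, ℂ) ω X]

theorem contDiffOn_transition {e e' : OpenPartialHomeomorph X ℂ} (he : e ∈ atlas ℂ X)
    (he' : e' ∈ atlas ℂ X) : ContDiffOn ℂ ω (e' ∘ e.symm) (e.symm ≫ₕ e').source := by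
  have := (contDiffGroupoid ω 𝓘(ℂ, ℂ)).compatible he he'
  rw [contDiffGroupoid, mem_groupoid_of_pregroupoid] at this
  simpa [contDiffPregroupoid] using this.1

instance realManifold : IsManifold 𝓘(ℝ, ℂ) ∞ X := by
  apply isManifold_of_contDiffOn
  intro e e' he he'
  have := ((contDiffOn_transition he he').restrict_scalars ℝ).of_le (m := ∞) le_top
  simpa using this

theorem atlas_mdifferentiable {e : OpenPartialHomeomorph X ℂ} (he : e ∈ atlas ℂ X) :
    e.MDifferentiable 𝓘(ℝ, ℂ) 𝓘(ℝ, ℂ) :=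
  haveI : IsManifold 𝓘(ℝ, ℂ) 1 X := IsManifold.of_le (n := ∞) (by simp)
  mdifferentiable_of_mem_atlas he

theorem hasDerivAt_transition {e e' : OpenPartialHomeomorph X ℂ} (he : e ∈ atlas ℂ X)
    (he' : e' ∈ atlas ℂ X) {z : ℂ} (hz : z ∈ e.target) (hz' : e.symm z ∈ e'.source) :
    HasDerivAt (e' ∘ e.symm) (deriv (e' ∘ e.symm) z) z := by
  have hmem : z ∈ (e.symm ≫ₕ e').source := by simp [hz, hz']
  exact (((contDiffOn_transition he he').differentiableOn (by simp)).differentiableAt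
    ((e.symm ≫ₕ e').open_source.mem_nhds hmem)).hasDerivAt

/-- Change of charts for one-forms. -/
theorem localForm_transition {e e' : OpenPartialHomeomorph X ℂ} (he : e ∈ atlas ℂ X)
    (he' : e' ∈ atlas ℂ X) {z : ℂ} (hz : z ∈ e.target) (hz' : e.symm z ∈ e'.source)
    (α : SForm X) (u : ℂ) :
    localForm e α z u = localForm e' α (e' (e.symm z)) (deriv (e' ∘ e.symm) z * u) := by
  have h1 : mfderiv 𝓘(ℝ, ℂ) 𝓘(ℝ, ℂ) e.symm z =
      (mfderiv 𝓘(ℝ, ℂ) 𝓘(ℝ, ℂ) e'.symm ((e' ∘ e.symm) z)).comp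
        (mfderiv 𝓘(ℝ, ℂ) 𝓘(ℝ, ℂ) (e' ∘ e.symm) z) := by
    rw [← mfderiv_comp z ((atlas_mdifferentiable he').mdifferentiableAt_symm
      (e'.map_source hz')) ((hasDerivAt_transition he he' hz hz').differentiableAt.restrictScalars
        ℝ).mdifferentiableAt]
    apply Filter.EventuallyEq.mfderiv_eq
    filter_upwards [(isOpen_chart_preimage e e'.open_source).mem_nhds ⟨hz, hz'⟩] with w hw
    simp [e'.left_inv hw.2]
  have h2 : mfderiv 𝓘(ℝ, ℂ) 𝓘(ℝ, ℂ) (e' ∘ e.symm) z u = deriv (e' ∘ e.symm) z * u := by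
    rw [mfderiv_eq_fderiv,
      ((hasDerivAt_transition he he' hz hz').hasFDerivAt.restrictScalars ℝ).fderiv]
    exact mul_comm u (deriv (e' ∘ e.symm) z)
  -- The base points `e.symm z` and `e'.symm (e' (e.symm z))` are equal only propositionally, and
  -- the covector types depend on them; generalizing the point lets the equality be eliminated.
  have key : ∀ x : X, x = e.symm z → ∀ L : ℂ →L[ℝ] ℂ, ∀ M : ℂ →L[ℝ] ℂ, ∀ v w : ℂ, L v = M w →
      (show ℂ →L[ℝ] ℂ from α (e.symm z)) (L v) = (show ℂ →L[ℝ] ℂ from α x) (M w) := by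
    rintro x rfl L M v w h
    rw [h]
  refine key _ (e'.left_inv hz') _ _ _ _ ?_
  rw [h1]
  exact congrArg _ h2

/-- The differential of a function, as a one-form. -/
def dForm (f : X → ℂ) : SForm X := fun x => mfderiv 𝓘(ℝ, ℂ) 𝓘(ℝ, ℂ) f x

theorem localForm_dForm {e : OpenPartialHomeomorph X ℂ} (he : e ∈ atlas ℂ X) {z : ℂ}
    (hz : z ∈ e.target) {f : X → ℂ} (hf : MDifferentiableAt 𝓘(ℝ, ℂ) 𝓘(ℝ, ℂ) f (e.symm z)) :
    localForm e (dForm f) z = fderiv ℝ (f ∘ e.symm) z := by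
  rw [← mfderiv_eq_fderiv, mfderiv_comp z hf ((atlas_mdifferentiable he).mdifferentiableAt_symm hz)]
  rfl

/-- The expression of a form in a chart determines the form. -/
theorem exists_localForm_apply {e : OpenPartialHomeomorph X ℂ} (he : e ∈ atlas ℂ X) {z : ℂ}
    (hz : z ∈ e.target) : ∃ L : ℂ ≃L[ℝ] ℂ, ∀ α : SForm X,
      localForm e α z = (show ℂ →L[ℝ] ℂ from α (e.symm z)).comp (L : ℂ →L[ℝ] ℂ) := by
  exact ⟨(atlas_mdifferentiable he).symm.mfderiv (x := z) hz, fun α => rfl⟩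

theorem contDiffOn_comp_symm {e : OpenPartialHomeomorph X ℂ} (he : e ∈ atlas ℂ X) {f : X → ℂ}
    {s : Set X} (hf : ContMDiffOn 𝓘(ℝ, ℂ) 𝓘(ℝ, ℂ) ∞ f s) :
    ContDiffOn ℝ ∞ (f ∘ e.symm) {z | z ∈ e.target ∧ e.symm z ∈ s} := by
  rw [← contMDiffOn_iff_contDiffOn]
  exact hf.comp ((contMDiffOn_symm_of_mem_maximalAtlas
    (IsManifold.subset_maximalAtlas he)).mono fun z hz => hz.1) fun z hz => hz.2

theorem contMDiffAt_of_comp_symm {e : OpenPartialHomeomorph X ℂ} (he : e ∈ atlas ℂ X) {f : X → ℂ}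
    {x : X} (hx : x ∈ e.source) (hf : ContDiffAt ℝ ∞ (f ∘ e.symm) (e x)) :
    ContMDiffAt 𝓘(ℝ, ℂ) 𝓘(ℝ, ℂ) ∞ f x := by
  have h := (contMDiffAt_iff_contDiffAt.2 hf).comp x
    (contMDiffAt_of_mem_maximalAtlas (IsManifold.subset_maximalAtlas (I := 𝓘(ℝ, ℂ)) (n := ∞) he) hx)
  refine h.congr_of_eventuallyEq ?_
  filter_upwards [e.open_source.mem_nhds hx] with y hy
  simp [e.left_inv hy]

theorem contDiffOn_localForm_dForm {e : OpenPartialHomeomorph X ℂ} (he : e ∈ atlas ℂ X) {f : X → ℂ}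
    {s : Set X} (hs : IsOpen s) (hf : ContMDiffOn 𝓘(ℝ, ℂ) 𝓘(ℝ, ℂ) ∞ f s) :
    ContDiffOn ℝ ∞ (localForm e (dForm f)) {z | z ∈ e.target ∧ e.symm z ∈ s} := by
  have h := (contDiffOn_comp_symm he hf).fderiv_of_isOpen (m := ∞) (isOpen_chart_preimage e hs)
    (by simp)
  refine h.congr fun z hz => ?_
  exact localForm_dForm he hz.1 ((hf.contMDiffAt (hs.mem_nhds hz.2)).mdifferentiableAt (by simp))

end Charts

/-! ### Integration of two-forms on a compact Riemann surface -/

section Density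

open MeasureTheory

variable {X : Type*} [TopologicalSpace X] [ChartedSpace ℂ X]

/-- A continuous two-form on `X`, given by its coefficient with respect to `dx ∧ dy` in every
chart. -/
structure IsDensity (W : OpenPartialHomeomorph X ℂ → ℂ → ℂ) : Prop where
  continuousOn : ∀ e ∈ atlas ℂ X, ContinuousOn (W e) e.target
  transition : ∀ e ∈ atlas ℂ X, ∀ e' ∈ atlas ℂ X, ∀ z ∈ e.target, e.symm z ∈ e'.source →
    W e z = ((‖deriv (e' ∘ e.symm) z‖ ^ 2 : ℝ) : ℂ) * W e' (e' (e.symm z))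

theorem IsDensity.add {W V : OpenPartialHomeomorph X ℂ → ℂ → ℂ} (hW : IsDensity W)
    (hV : IsDensity V) : IsDensity fun e z => W e z + V e z where
  continuousOn e he := (hW.continuousOn e he).add (hV.continuousOn e he)
  transition e he e' he' z hz hz' := by
    rw [hW.transition e he e' he' z hz hz', hV.transition e he e' he' z hz hz']; ring

theorem IsDensity.const_mul {W : OpenPartialHomeomorph X ℂ → ℂ → ℂ} (hW : IsDensity W) (c : ℂ) :
    IsDensity fun e z => c * W e z where
  continuousOn e he := continuousOn_const.mul (hW.continuousOn e he)
  transition e he e' he' z hz hz' := by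
    rw [hW.transition e he e' he' z hz hz']; ring

theorem IsDensity.sum {ι : Type*} (s : Finset ι) {W : ι → OpenPartialHomeomorph X ℂ → ℂ → ℂ}
    (hW : ∀ i ∈ s, IsDensity (W i)) : IsDensity fun e z => ∑ i ∈ s, W i e z where
  continuousOn e he := continuousOn_finsetSum s fun i hi => (hW i hi).continuousOn e he
  transition e he e' he' z hz hz' := by
    rw [Finset.mul_sum]
    exact Finset.sum_congr rfl fun i hi => (hW i hi).transition e he e' he' z hz hz'

/-- Continuity on the open set `e.target` gives no control near its boundary; integrability comes
from the compact set `e '' K`, off which `w` vanishes. -/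
theorem integrableOn_target {X : Type*} [TopologicalSpace X] {e : OpenPartialHomeomorph X ℂ}
    {w : ℂ → ℂ} {K : Set X}
    (hK : IsCompact K) (hKe : K ⊆ e.source) (hw : ContinuousOn w e.target)
    (h0 : ∀ z ∈ e.target, e.symm z ∉ K → w z = 0) : IntegrableOn w e.target := by
  have hc : IsCompact (e '' K) := hK.image_of_continuousOn (e.continuousOn.mono hKe)
  have hsub : e '' K ⊆ e.target := by
    rintro _ ⟨x, hx, rfl⟩
    exact e.map_source (hKe hx)
  refine IntegrableOn.of_forall_sdiff_eq_zero ((hw.mono hsub).integrableOn_compact hc)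
    e.open_target.measurableSet fun z hz => h0 z hz.1 fun hzK => hz.2 ⟨_, hzK, e.right_inv hz.1⟩

/-- The real determinant of multiplication by `c` is the norm of `c` for `ℂ` over `ℝ`. It is the
Jacobian of a holomorphic change of charts, whence the factor in `IsDensity.transition`. -/
theorem abs_det_restrictScalars_toSpanSingleton (c : ℂ) :
    |((ContinuousLinearMap.toSpanSingleton ℂ c).restrictScalars ℝ : ℂ →L[ℝ] ℂ).det|
      = ‖c‖ ^ 2 := by
  have : (((ContinuousLinearMap.toSpanSingleton ℂ c).restrictScalars ℝ : ℂ →L[ℝ] ℂ) : ℂ →ₗ[ℝ] ℂ)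
      = Algebra.lmul ℝ ℂ c := by
    ext; simp [mul_comm]
  rw [ContinuousLinearMap.det, this, ← Algebra.norm_apply, Algebra.norm_complex_eq]
  simp [Complex.normSq_eq_norm_sq]

/-- Change of variables between two charts for a two-form supported in their overlap. -/
theorem setIntegral_transition [IsManifold 𝓘(ℂ, ℂ) ω X]
    {W : OpenPartialHomeomorph X ℂ → ℂ → ℂ}
    (hW : IsDensity W) {e e' : OpenPartialHomeomorph X ℂ} (he : e ∈ atlas ℂ X)
    (he' : e' ∈ atlas ℂ X) (r : X → ℂ)
    (h1 : ∀ z ∈ e.target, e.symm z ∉ e'.source → r (e.symm z) * W e z = 0)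
    (h2 : ∀ z ∈ e'.target, e'.symm z ∉ e.source → r (e'.symm z) * W e' z = 0) :
    ∫ z in e'.target, r (e'.symm z) * W e' z = ∫ z in e.target, r (e.symm z) * W e z := by
  set S : Set ℂ := (e.symm ≫ₕ e').source with hS
  have hSmem : ∀ z, z ∈ S ↔ z ∈ e.target ∧ e.symm z ∈ e'.source := fun z => by simp [hS]
  have himg : (e' ∘ e.symm) '' S = {z | z ∈ e'.target ∧ e'.symm z ∈ e.source} := by
    ext z
    constructor
    · rintro ⟨w, hw, rfl⟩
      rw [hSmem] at hw
      simp [e'.map_source hw.2, e'.left_inv hw.2, e.map_target hw.1]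
    · rintro ⟨hz, hz'⟩
      refine ⟨e (e'.symm z), (hSmem _).2 ⟨e.map_source hz', ?_⟩, ?_⟩
      · rw [e.left_inv hz']; exact e'.map_target hz
      · simp [e.left_inv hz', e'.right_inv hz]
  have hSo : IsOpen S := (e.symm ≫ₕ e').open_source
  -- By `h1` and `h2` both integrands vanish off the overlap of the charts, so both integrals reduce
  -- to it.
  have hL : ∫ z in (e' ∘ e.symm) '' S, r (e'.symm z) * W e' z
      = ∫ z in e'.target, r (e'.symm z) * W e' z := by
    rw [himg]
    refine (setIntegral_eq_of_subset_of_forall_sdiff_eq_zero e'.open_target.measurableSet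
      (fun z hz => hz.1) fun z hz => h2 z hz.1 fun h => hz.2 (And.intro hz.1 h)).symm
  have hR : ∫ z in S, r (e.symm z) * W e z = ∫ z in e.target, r (e.symm z) * W e z := by
    refine (setIntegral_eq_of_subset_of_forall_sdiff_eq_zero e.open_target.measurableSet
      (fun z hz => ((hSmem z).1 hz).1) fun z hz => h1 z hz.1 fun h =>
        hz.2 ((hSmem z).2 ⟨hz.1, h⟩)).symm
  rw [← hL, ← hR, integral_image_eq_integral_abs_det_fderiv_smul volume hSo.measurableSet
    (f' := fun z => (ContinuousLinearMap.toSpanSingleton ℂ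
      (deriv (e' ∘ e.symm) z)).restrictScalars ℝ)]
  · refine setIntegral_congr_fun hSo.measurableSet fun z hz => ?_
    rw [hSmem] at hz
    simp only [abs_det_restrictScalars_toSpanSingleton, Function.comp_apply, e'.left_inv hz.2]
    rw [hW.transition e he e' he' z hz.1 hz.2, Complex.real_smul]
    simp only [Function.comp_def]
    ring
  · intro z hz
    rw [hSmem] at hz
    exact ((hasDerivAt_transition he he' hz.1 hz.2).hasFDerivAt.restrictScalars ℝ).hasFDerivWithinAt
  · exact (e.symm ≫ₕ e').injOn

variable [T2Space X] [CompactSpace X]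

/-- The integral of a two-form, computed with `chartPartition`. -/
def densityIntegral (W : OpenPartialHomeomorph X ℂ → ℂ → ℂ) : ℂ :=
  ∑ᶠ i : X, ∫ z in (chartAt ℂ i).target,
    (chartPartition X i ((chartAt ℂ i).symm z) : ℂ) * W (chartAt ℂ i) z

theorem chartPartition_subordinate (i : X) :
    tsupport (chartPartition X i) ⊆ (chartAt ℂ i).source :=
  (exists_chartPartition (X := X)).choose_spec i

variable (X) in
theorem finite_chartPartition : {i : X | (Function.support (chartPartition X i)).Nonempty}.Finite :=
  (chartPartition X).locallyFinite.finite_nonempty_of_compact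

theorem densityIntegral_eq_sum (W : OpenPartialHomeomorph X ℂ → ℂ → ℂ) :
    densityIntegral W = ∑ i ∈ (finite_chartPartition X).toFinset,
      ∫ z in (chartAt ℂ i).target,
        (chartPartition X i ((chartAt ℂ i).symm z) : ℂ) * W (chartAt ℂ i) z := by
  apply finsum_eq_sum_of_support_subset
  intro i hi
  simp only [Finite.coe_toFinset, mem_ofPred_eq]
  by_contra h
  rw [not_nonempty_iff_eq_empty, Function.support_eq_empty_iff] at h
  simp [h] at hi

theorem integrableOn_chartPartition_mul {W : OpenPartialHomeomorph X ℂ → ℂ → ℂ}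
    (hW : IsDensity W) (i : X) :
    IntegrableOn (fun z => (chartPartition X i ((chartAt ℂ i).symm z) : ℂ) * W (chartAt ℂ i) z)
      (chartAt ℂ i).target := by
  refine integrableOn_target (isClosed_tsupport (chartPartition X i)).isCompact
    (chartPartition_subordinate i) ?_ fun z _ hz => ?_
  · refine ContinuousOn.mul ?_ (hW.continuousOn _ (chart_mem_atlas ℂ i))
    exact (Complex.continuous_ofReal.comp (chartPartition X i).continuous).comp_continuousOn
      (chartAt ℂ i).continuousOn_symm
  · simp [image_eq_zero_of_notMem_tsupport hz]

theorem densityIntegral_congr {W V : OpenPartialHomeomorph X ℂ → ℂ → ℂ}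
    (h : ∀ e ∈ atlas ℂ X, ∀ z ∈ e.target, W e z = V e z) :
    densityIntegral W = densityIntegral V := by
  refine finsum_congr fun i => setIntegral_congr_fun (chartAt ℂ i).open_target.measurableSet ?_
  intro z hz
  simp only [h _ (chart_mem_atlas ℂ i) z hz]

theorem densityIntegral_add {W V : OpenPartialHomeomorph X ℂ → ℂ → ℂ} (hW : IsDensity W)
    (hV : IsDensity V) :
    densityIntegral (fun e z => W e z + V e z) = densityIntegral W + densityIntegral V := by
  simp only [densityIntegral_eq_sum, ← Finset.sum_add_distrib]
  refine Finset.sum_congr rfl fun i _ => ?_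
  rw [← integral_add (integrableOn_chartPartition_mul hW i) (integrableOn_chartPartition_mul hV i)]
  simp only [mul_add]

theorem densityIntegral_const_mul (c : ℂ) (W : OpenPartialHomeomorph X ℂ → ℂ → ℂ) :
    densityIntegral (fun e z => c * W e z) = c * densityIntegral W := by
  simp only [densityIntegral_eq_sum, Finset.mul_sum]
  refine Finset.sum_congr rfl fun i _ => ?_
  rw [← integral_const_mul]
  simp only [mul_left_comm]

theorem densityIntegral_sum {ι : Type*} (s : Finset ι)
    {W : ι → OpenPartialHomeomorph X ℂ → ℂ → ℂ} (hW : ∀ i ∈ s, IsDensity (W i)) :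
    densityIntegral (fun e z => ∑ i ∈ s, W i e z) = ∑ i ∈ s, densityIntegral (W i) := by
  simp only [densityIntegral_eq_sum]
  rw [Finset.sum_comm]
  refine Finset.sum_congr rfl fun i _ => ?_
  rw [← integral_finsetSum s fun j hj => integrableOn_chartPartition_mul (hW j hj) i]
  simp only [Finset.mul_sum]

variable [IsManifold 𝓘(ℂ, ℂ) ω X]

/-- The integral of a two-form supported in the domain of one chart. -/
theorem densityIntegral_eq_setIntegral {W : OpenPartialHomeomorph X ℂ → ℂ → ℂ}
    (hW : IsDensity W) {e : OpenPartialHomeomorph X ℂ} (he : e ∈ atlas ℂ X) {K : Set X}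
    (hK : IsCompact K) (hKe : K ⊆ e.source)
    (h0 : ∀ e' ∈ atlas ℂ X, ∀ z ∈ e'.target, e'.symm z ∉ K → W e' z = 0) :
    densityIntegral W = ∫ z in e.target, W e z := by
  have hρ : ∀ i x, x ∉ (chartAt ℂ i).source → chartPartition X i x = 0 := fun i x hx =>
    image_eq_zero_of_notMem_tsupport fun h => hx (chartPartition_subordinate i h)
  -- The `i`-th partition function vanishes off the chart at `i`, and `W` vanishes off `K ⊆
  -- e.source`, so each piece can be moved into the chart `e`. There the partition functions sum to
  -- one.
  have key : ∀ i : X, ∫ z in (chartAt ℂ i).target,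
      (chartPartition X i ((chartAt ℂ i).symm z) : ℂ) * W (chartAt ℂ i) z
      = ∫ z in e.target, (chartPartition X i (e.symm z) : ℂ) * W e z := by
    intro i
    refine setIntegral_transition hW he (chart_mem_atlas ℂ i)
      (fun x => (chartPartition X i x : ℂ)) ?_ ?_
    · intro z _ hz'
      simp [hρ i _ hz']
    · intro z hz hz'
      rw [h0 _ (chart_mem_atlas ℂ i) z hz fun h => hz' (hKe h), mul_zero]
  rw [densityIntegral_eq_sum, Finset.sum_congr rfl fun i _ => key i, ← integral_finsetSum]
  · refine setIntegral_congr_fun e.open_target.measurableSet fun z hz => ?_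
    simp only [← Finset.sum_mul]
    have := (chartPartition X).sum_eq_one (mem_univ (e.symm z))
    rw [finsum_eq_sum_of_support_subset (s := (finite_chartPartition X).toFinset)] at this
    · rw [← Complex.ofReal_sum, this]
      simp
    · intro i hi
      simp only [Finite.coe_toFinset, mem_ofPred_eq]
      exact ⟨_, hi⟩
  · intro i _
    refine integrableOn_target hK hKe ?_ fun z hz hzK => ?_
    · refine ContinuousOn.mul ?_ (hW.continuousOn _ he)
      exact (Complex.continuous_ofReal.comp (chartPartition X i).continuous).comp_continuousOn
        e.continuousOn_symm
    · simp [h0 e he z hz hzK]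

end Density

/-! ### Exterior derivative and Stokes' theorem -/

section Stokes

open MeasureTheory

/-- The coefficient of `dx ∧ dy` in the wedge product of two covectors on `ℂ`. -/
def wedge (a b : ℂ →L[ℝ] ℂ) : ℂ := a 1 * b Complex.I - a Complex.I * b 1

theorem clm_apply_eq (a : ℂ →L[ℝ] ℂ) (u : ℂ) : a u = u.re * a 1 + u.im * a Complex.I := by
  conv_lhs => rw [show u = u.re • (1 : ℂ) + u.im • Complex.I by simp [Complex.re_add_im]]
  rw [map_add, map_smul, map_smul]
  simp

theorem wedge_comp_mul (a b a' b' : ℂ →L[ℝ] ℂ) (c : ℂ) (ha : ∀ u, a u = a' (c * u))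
    (hb : ∀ u, b u = b' (c * u)) : wedge a b = ((‖c‖ ^ 2 : ℝ) : ℂ) * wedge a' b' := by
  rw [wedge, ha, ha, hb, hb, clm_apply_eq a' (c * 1), clm_apply_eq a' (c * Complex.I),
    clm_apply_eq b' (c * 1), clm_apply_eq b' (c * Complex.I), wedge, ← Complex.normSq_eq_norm_sq,
    Complex.normSq_apply]
  simp
  ring

variable {X : Type*} [TopologicalSpace X] [ChartedSpace ℂ X]

/-- A smooth scalar one-form. -/
def IsSmoothSForm (α : SForm X) : Prop :=
  ∀ e ∈ atlas ℂ X, ContDiffOn ℝ ∞ (localForm e α) e.target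

theorem localForm_smul (e : OpenPartialHomeomorph X ℂ) (f : X → ℂ) (α : SForm X) (z : ℂ) :
    localForm e (fun x => f x • α x) z = f (e.symm z) • localForm e α z := rfl

theorem localForm_sub (e : OpenPartialHomeomorph X ℂ) (α β : SForm X) (z : ℂ) :
    localForm e (fun x => α x - β x) z = localForm e α z - localForm e β z := rfl

theorem curl_congr {a b : ℂ → ℂ →L[ℝ] ℂ} {z : ℂ} (h : a =ᶠ[𝓝 z] b) : curl a z = curl b z := by
  rw [curl, curl, h.fderiv_eq]

theorem curl_smul {f : ℂ → ℂ} {a : ℂ → ℂ →L[ℝ] ℂ} {z : ℂ} (hf : DifferentiableAt ℝ f z)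
    (ha : DifferentiableAt ℝ a z) :
    curl (fun w => f w • a w) z = wedge (fderiv ℝ f z) (a z) + f z * curl a z := by
  have h := (hf.hasFDerivAt.smul ha.hasFDerivAt).fderiv
  rw [curl, curl, wedge, show (fun w => f w • a w) = f • a from rfl, h]
  simp
  ring

theorem curl_add {a b : ℂ → ℂ →L[ℝ] ℂ} {z : ℂ} (ha : DifferentiableAt ℝ a z)
    (hb : DifferentiableAt ℝ b z) : curl (fun w => a w + b w) z = curl a z + curl b z := by
  rw [curl, curl, curl, show (fun w => a w + b w) = a + b from rfl, fderiv_add ha hb]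
  simp
  ring

theorem curl_sub {a b : ℂ → ℂ →L[ℝ] ℂ} {z : ℂ} (ha : DifferentiableAt ℝ a z)
    (hb : DifferentiableAt ℝ b z) : curl (fun w => a w - b w) z = curl a z - curl b z := by
  rw [curl, curl, curl, show (fun w => a w - b w) = a - b from rfl, fderiv_sub ha hb]
  simp
  ring

theorem curl_sum {ι : Type*} (s : Finset ι) {a : ι → ℂ → ℂ →L[ℝ] ℂ} {z : ℂ}
    (ha : ∀ i ∈ s, DifferentiableAt ℝ (a i) z) :
    curl (fun w => ∑ i ∈ s, a i w) z = ∑ i ∈ s, curl (a i) z := by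
  simp only [curl]
  rw [fderiv_fun_sum ha, Finset.sum_sub_distrib]
  simp

theorem curl_fderiv {f : ℂ → ℂ} {z : ℂ} (hf : ContDiffAt ℝ ∞ f z) : curl (fderiv ℝ f) z = 0 := by
  have := (hf.isSymmSndFDerivAt (by
    simpa using (WithTop.coe_le_coe.2 (le_top : (2 : ℕ∞) ≤ ⊤)))).eq 1 Complex.I
  rw [curl, this, sub_self]

theorem continuousOn_curl {a : ℂ → ℂ →L[ℝ] ℂ} {s : Set ℂ} (hs : IsOpen s)
    (ha : ContDiffOn ℝ ∞ a s) : ContinuousOn (curl a) s := by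
  have h := (ha.continuousOn_fderiv_of_isOpen hs (by simp))
  exact ((h.clm_apply continuousOn_const).clm_apply continuousOn_const).sub
    ((h.clm_apply continuousOn_const).clm_apply continuousOn_const)

theorem continuousOn_wedge {a b : ℂ → ℂ →L[ℝ] ℂ} {s : Set ℂ} (ha : ContinuousOn a s)
    (hb : ContinuousOn b s) : ContinuousOn (fun z => wedge (a z) (b z)) s :=
  ((ha.clm_apply continuousOn_const).mul (hb.clm_apply continuousOn_const)).sub
    ((ha.clm_apply continuousOn_const).mul (hb.clm_apply continuousOn_const))

/-- Stokes' theorem in the plane for forms with compact support. -/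
theorem integral_curl_eq_zero {a : ℂ → ℂ →L[ℝ] ℂ} (ha : ContDiff ℝ ∞ a)
    (hc : HasCompactSupport a) : ∫ z, curl a z = 0 := by
  have key : ∀ u v : ℂ, Integrable (fun z => fderiv ℝ a z u v) ∧
      ∫ z, fderiv ℝ a z u v = 0 := by
    intro u v
    have hg : ContDiff ℝ ∞ fun z => a z v := ha.clm_apply contDiff_const
    have hgc : HasCompactSupport fun z => a z v :=
      hc.comp_left (g := fun L : ℂ →L[ℝ] ℂ => L v) (by simp)
    have hfd : ∀ z, fderiv ℝ (fun z => a z v) z u = fderiv ℝ a z u v := by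
      intro z
      rw [fderiv_clm_apply (ha.differentiable (by simp)).differentiableAt
        (differentiableAt_const _)]
      simp
    have hi : Integrable fun z => fderiv ℝ (fun z => a z v) z u := by
      refine Continuous.integrable_of_hasCompactSupport
        ((hg.continuous_fderiv (by simp)).clm_apply continuous_const) ?_
      exact (hgc.fderiv (𝕜 := ℝ)).comp_left (g := fun L : ℂ →L[ℝ] ℂ => L u) (by simp)
    refine ⟨by simpa only [hfd] using hi, ?_⟩
    -- Integration by parts against the constant function 1.
    have := integral_mul_fderiv_eq_neg_fderiv_mul_of_integrable (μ := (volume : Measure ℂ))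
      (f := fun _ : ℂ => (1 : ℂ)) (g := fun z => a z v) (v := u) (by simp) (by simpa using hi)
      (by simpa using hg.continuous.integrable_of_hasCompactSupport hgc)
      (fun _ _ => differentiableAt_const _) (fun z _ => (hg.differentiable (by simp)) z)
    simpa [hfd] using this
  simp only [curl]
  rw [integral_sub (key _ _).1 (key _ _).1, (key _ _).2, (key _ _).2, sub_zero]

theorem setIntegral_curl_eq_zero {a : ℂ → ℂ →L[ℝ] ℂ} {U K : Set ℂ} (hU : IsOpen U)
    (hK : IsCompact K) (hKU : K ⊆ U) (ha : ContDiffOn ℝ ∞ a U) (h0 : ∀ z ∈ U, z ∉ K → a z = 0) :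
    ∫ z in U, curl a z = 0 := by
  classical
  -- Extension by zero is smooth because `U` and the complement of `K` form an open cover of the
  -- plane.
  set b : ℂ → ℂ →L[ℝ] ℂ := fun z => if z ∈ U then a z else 0 with hb
  have hb0 : ∀ z ∉ K, b z = 0 := by
    intro z hz
    by_cases hzU : z ∈ U
    · simp [hb, hzU, h0 z hzU hz]
    · simp [hb, hzU]
  have hbU : ∀ z ∈ U, b =ᶠ[𝓝 z] a := fun z hz => by
    filter_upwards [hU.mem_nhds hz] with w hw
    simp [hb, hw]
  have hbK : ∀ z ∉ K, b =ᶠ[𝓝 z] fun _ => 0 := fun z hz => by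
    filter_upwards [hK.isClosed.isOpen_compl.mem_nhds hz] with w hw
    exact hb0 w hw
  have hbs : ContDiff ℝ ∞ b := by
    rw [contDiff_iff_contDiffAt]
    intro z
    by_cases hz : z ∈ K
    · exact (ha.contDiffAt (hU.mem_nhds (hKU hz))).congr_of_eventuallyEq (hbU z (hKU hz))
    · exact contDiffAt_const.congr_of_eventuallyEq (hbK z hz)
  have hintegral : ∫ z in U, curl b z = ∫ z, curl b z := by
    refine setIntegral_eq_integral_of_forall_compl_eq_zero fun z hz => ?_
    rw [curl_congr (hbK z fun h => hz (hKU h))]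
    simp [curl]
  rw [← integral_curl_eq_zero hbs (HasCompactSupport.intro hK hb0), ← hintegral]
  exact setIntegral_congr_fun hU.measurableSet fun z hz => (curl_congr (hbU z hz)).symm

variable [IsManifold 𝓘(ℂ, ℂ) ω X]

theorem isDensity_wedge {α β : SForm X}
    (hα : ∀ e ∈ atlas ℂ X, ContinuousOn (localForm e α) e.target)
    (hβ : ∀ e ∈ atlas ℂ X, ContinuousOn (localForm e β) e.target) :
    IsDensity fun e z => wedge (localForm e α z) (localForm e β z) where
  continuousOn e he := continuousOn_wedge (hα e he) (hβ e he)
  transition _ he _ he' _ hz hz' := wedge_comp_mul _ _ _ _ _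
    (localForm_transition he he' hz hz' α) (localForm_transition he he' hz hz' β)

/-- The exterior derivative commutes with pullback by the transition map `φ`. Differentiating `β(φ
w)(φ'(w) u)` in `w` produces a term with `φ''` that is symmetric in the two directions and drops out
of the curl; what remains is the curl of `β` times the Jacobian `‖φ'‖²`. -/
theorem isDensity_curl {β : SForm X} (hβ : IsSmoothSForm β) :
    IsDensity fun e z => curl (localForm e β) z where
  continuousOn e he := continuousOn_curl e.open_target (hβ e he)
  transition e he e' he' z hz hz' := by
    set φ := e' ∘ e.symm with hφ
    set S := (e.symm ≫ₕ e').source with hS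
    have hmem : z ∈ S := by simp [hS, hz, hz']
    have hSo : IsOpen S := (e.symm ≫ₕ e').open_source
    have hd2 : DifferentiableAt ℂ (deriv φ) z := by
      have h : ContDiffOn ℂ 1 (deriv φ) S :=
        (contDiffOn_transition he he').deriv_of_isOpen hSo (by simp)
      exact (h.differentiableOn (by simp)).differentiableAt (hSo.mem_nhds hmem)
    have hd1 := (hasDerivAt_transition he he' hz hz').hasFDerivAt.restrictScalars ℝ
    have hb : DifferentiableAt ℝ (localForm e' β) (φ z) :=
      ((hβ e' he').differentiableOn (by simp)).differentiableAt
        (e'.open_target.mem_nhds (e'.map_source hz'))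
    have heq : localForm e β =ᶠ[𝓝 z] fun w => (localForm e' β (φ w)).comp
        (ContinuousLinearMap.mul ℝ ℂ (deriv φ w)) := by
      filter_upwards [hSo.mem_nhds hmem] with w hw
      have hw' : w ∈ e.target ∧ e.symm w ∈ e'.source := by simpa [hS] using hw
      ext1 u
      exact localForm_transition he he' hw'.1 hw'.2 β u
    have hD : HasFDerivAt (fun w => (localForm e' β (φ w)).comp
        (ContinuousLinearMap.mul ℝ ℂ (deriv φ w))) _ z :=
      (hb.hasFDerivAt.comp z hd1).clm_comp ((ContinuousLinearMap.mul ℝ ℂ).hasFDerivAt.comp z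
        (hd2.hasDerivAt.hasFDerivAt.restrictScalars ℝ))
    rw [curl_congr heq, curl, hD.fderiv]
    set B := fderiv ℝ (localForm e' β) (φ z) with hB
    set c := deriv φ z with hc
    have hB2 : ∀ u v : ℂ, B u v = u.re * (B 1 v) + u.im * (B Complex.I v) := by
      intro u v
      exact clm_apply_eq ((ContinuousLinearMap.apply ℝ ℂ v).comp B) u
    simp only [add_apply, ContinuousLinearMap.comp_apply,
      ContinuousLinearMap.compL_apply, ContinuousLinearMap.flip_apply,
      ContinuousLinearMap.mul_apply', curl, Function.comp_apply,
      ContinuousLinearMap.coe_restrictScalars', ContinuousLinearMap.toSpanSingleton_apply,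
      smul_eq_mul, one_mul, mul_one]
    rw [mul_comm (Complex.I) (deriv (deriv φ) z)]
    change (_ + B c (c * Complex.I)) - (_ + B (Complex.I * c) c) =
      _ * (B 1 Complex.I - B Complex.I 1)
    rw [hB2 c, hB2 (Complex.I * c), clm_apply_eq (B 1) (c * _), clm_apply_eq (B Complex.I) (c * _),
      clm_apply_eq (B 1) c, clm_apply_eq (B Complex.I) c, ← Complex.normSq_eq_norm_sq,
      Complex.normSq_apply]
    simp
    ring

theorem IsSmoothSForm.smul {f : X → ℂ} {α : SForm X} (hf : ContMDiff 𝓘(ℝ, ℂ) 𝓘(ℝ, ℂ) ∞ f)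
    (hα : IsSmoothSForm α) : IsSmoothSForm fun x => f x • α x := by
  intro e he
  have h := contDiffOn_comp_symm he hf.contMDiffOn (s := univ)
  simp only [mem_univ, and_true] at h
  exact h.smul (hα e he)

variable [T2Space X] [CompactSpace X]

/-- **Stokes' theorem** on a closed Riemann surface. -/
theorem densityIntegral_curl_eq_zero {β : SForm X} (hβ : IsSmoothSForm β) :
    densityIntegral (fun e z => curl (localForm e β) z) = 0 := by
  -- The partition of unity defining the integral is only continuous. A smooth one is used here, so
  -- that each `ς i • β` is a smooth form supported in a single chart.
  obtain ⟨ς, hς⟩ := SmoothPartitionOfUnity.exists_isSubordinate_chartAt_source 𝓘(ℝ, ℂ) X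
  have hfin : {i : X | (Function.support (ς i)).Nonempty}.Finite :=
    ς.locallyFinite.finite_nonempty_of_compact
  set b : X → SForm X := fun i x => (ς i x : ℂ) • β x with hb
  have hsm : ∀ i, ContMDiff 𝓘(ℝ, ℂ) 𝓘(ℝ, ℂ) ∞ fun x => (ς i x : ℂ) := fun i =>
    (Complex.ofRealCLM.contDiff.contMDiff).comp (ς i).contMDiff
  have hbs : ∀ i, IsSmoothSForm (b i) := fun i => hβ.smul (hsm i)
  have hsum : ∀ x, ∑ i ∈ hfin.toFinset, ((ς i x : ℝ) : ℂ) = 1 := by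
    intro x
    have := ς.sum_eq_one (mem_univ x)
    rw [finsum_eq_sum_of_support_subset (s := hfin.toFinset)] at this
    · rw [← Complex.ofReal_sum, this, Complex.ofReal_one]
    · intro i hi
      simp only [Finite.coe_toFinset, mem_ofPred_eq]
      exact ⟨_, hi⟩
  have hdec : ∀ e ∈ atlas ℂ X, ∀ z ∈ e.target, curl (localForm e β) z
      = ∑ i ∈ hfin.toFinset, curl (localForm e (b i)) z := by
    intro e he z hz
    rw [← curl_sum _ fun i _ => ((hbs i e he).differentiableOn (by simp)).differentiableAt
      (e.open_target.mem_nhds hz)]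
    apply curl_congr
    refine Eventually.of_forall fun w => ?_
    simp only [hb, localForm_smul, ← Finset.sum_smul, hsum, one_smul]
  rw [densityIntegral_congr hdec, densityIntegral_sum _ fun i _ => isDensity_curl (hbs i)]
  refine Finset.sum_eq_zero fun i _ => ?_
  have hK : IsCompact (tsupport (ς i)) := (isClosed_tsupport _).isCompact
  have hsub : tsupport (ς i) ⊆ (chartAt ℂ i).source := hς i
  have hz0 : ∀ (e : OpenPartialHomeomorph X ℂ) (z : ℂ), e.symm z ∉ tsupport (ς i) →
      localForm e (b i) z = 0 := by
    intro e z hz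
    simp only [hb, localForm_smul]
    rw [image_eq_zero_of_notMem_tsupport hz, Complex.ofReal_zero]
    exact zero_smul ℂ (localForm e β z)
  rw [densityIntegral_eq_setIntegral (isDensity_curl (hbs i)) (chart_mem_atlas ℂ i) hK hsub]
  · refine setIntegral_curl_eq_zero (chartAt ℂ i).open_target
      (hK.image_of_continuousOn ((chartAt ℂ i).continuousOn.mono hsub)) ?_
      (hbs i _ (chart_mem_atlas ℂ i)) ?_
    · rintro _ ⟨x, hx, rfl⟩
      exact (chartAt ℂ i).map_source (hsub hx)
    · intro z hz hzK
      exact hz0 _ z fun h => hzK ⟨_, h, (chartAt ℂ i).right_inv hz⟩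
  · intro e he z hz hzK
    have hev : localForm e (b i) =ᶠ[𝓝 z] fun _ => 0 := by
      filter_upwards [(isOpen_chart_preimage e
        (isClosed_tsupport (ς i)).isOpen_compl).mem_nhds ⟨hz, hzK⟩] with w hw
      exact hz0 e w hw.2
    rw [curl_congr hev]
    simp [curl]

end Stokes

/-! ### Punctured discs, residues and radial cutoffs -/

section Plane

open MeasureTheory Metric

/-- Polar coordinates map a connected strip onto the punctured disc. Connectedness makes two
primitives of one form on it differ by a single constant. -/
theorem isPreconnected_ball_diff_singleton (z₀ : ℂ) (R : ℝ) :
    IsPreconnected (ball z₀ R \ {z₀}) := by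
  have himg : ball z₀ R \ {z₀} = (fun p : ℝ × ℝ => circleMap z₀ p.1 p.2) ''
      (Ioo 0 R ×ˢ (univ : Set ℝ)) := by
    ext z
    simp only [Set.mem_sdiff, mem_ball, mem_singleton_iff, mem_image, mem_prod, mem_Ioo, mem_univ,
      and_true, Prod.exists]
    constructor
    · rintro ⟨h1, h2⟩
      refine ⟨dist z z₀, Complex.arg (z - z₀), ⟨dist_pos.2 h2, h1⟩, ?_⟩
      simp [circleMap, Complex.dist_eq, Complex.norm_mul_exp_arg_mul_I]
    · rintro ⟨r, θ, ⟨h1, h2⟩, rfl⟩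
      refine ⟨?_, circleMap_ne_center h1.ne'⟩
      simpa [Complex.dist_eq, circleMap, abs_of_pos h1] using h2
  rw [himg]
  refine ((convex_Ioo 0 R).isPreconnected.prod isPreconnected_univ).image _ ?_
  apply Continuous.continuousOn
  unfold circleMap
  fun_prop

theorem isOpen_ball_diff_singleton (z₀ : ℂ) (R : ℝ) : IsOpen (ball z₀ R \ {z₀}) :=
  isOpen_ball.sdiff isClosed_singleton

theorem eventually_nhdsNE_iff_ball {z₀ : ℂ} {p : ℂ → Prop} :
    (∀ᶠ z in 𝓝[≠] z₀, p z) ↔ ∃ R > 0, ∀ z ∈ ball z₀ R \ {z₀}, p z := by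
  rw [eventually_nhdsWithin_iff, Metric.eventually_nhds_iff_ball]
  simp only [Set.mem_sdiff, and_imp]
  rfl

theorem exists_eq_add_const {f g : ℂ → ℂ} {L : ℂ → ℂ →L[ℝ] ℂ} {z₀ : ℂ} {R : ℝ}
    (hf : ∀ z ∈ ball z₀ R \ {z₀}, HasFDerivAt f (L z) z)
    (hg : ∀ z ∈ ball z₀ R \ {z₀}, HasFDerivAt g (L z) z) :
    ∃ c, ∀ z ∈ ball z₀ R \ {z₀}, f z = g z + c := by
  obtain ⟨c, hc⟩ := (isOpen_ball_diff_singleton z₀ R).exists_is_const_of_fderiv_eq_zero (𝕜 := ℝ)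
    (isPreconnected_ball_diff_singleton z₀ R) (f := fun z => f z - g z)
    (fun z hz => ((hf z hz).sub (hg z hz)).differentiableAt.differentiableWithinAt)
    (fun z hz => by simpa using ((hf z hz).fun_sub (hg z hz)).fderiv)
  exact ⟨c, fun z hz => by rw [← hc z hz]; ring⟩

/-- A holomorphic function on a punctured disc with meromorphic derivative is meromorphic. -/
theorem meromorphicAt_of_deriv {G a : ℂ → ℂ} {z₀ : ℂ} (ha : MeromorphicAt a z₀)
    (hG : ∀ᶠ z in 𝓝[≠] z₀, HasDerivAt G (a z) z) : MeromorphicAt G z₀ := by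
  -- If the derivative is analytic at `z₀`, it has a primitive on a full disc, and `G` differs from
  -- that by a constant.
  have base : ∀ G g : ℂ → ℂ, AnalyticAt ℂ g z₀ → (∀ᶠ z in 𝓝[≠] z₀, HasDerivAt G (g z) z) →
      MeromorphicAt G z₀ := by
    intro G g hg hG
    obtain ⟨R, hR, hd⟩ := Metric.eventually_nhds_iff_ball.1 hg.eventually_analyticAt
    obtain ⟨S, hS, hG⟩ := eventually_nhdsNE_iff_ball.1 hG
    obtain ⟨u, hu⟩ := (DifferentiableOn.isExactOn_ball (c := z₀) (r := R)
      (f := g) fun z hz => (hd z hz).differentiableAt.differentiableWithinAt)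
    obtain ⟨c, hc⟩ := exists_eq_add_const (f := G) (g := u) (z₀ := z₀) (R := min R S)
      (fun z hz => (hG z ⟨ball_subset_ball (min_le_right _ _) hz.1,
        hz.2⟩).hasFDerivAt.restrictScalars ℝ)
      (fun z hz => (hu z (ball_subset_ball (min_le_left _ _) hz.1)).hasFDerivAt.restrictScalars ℝ)
    have hua : AnalyticAt ℂ u z₀ := by
      have : DifferentiableOn ℂ u (ball z₀ R) := fun z hz =>
        (hu z hz).differentiableAt.differentiableWithinAt
      exact this.analyticAt (ball_mem_nhds z₀ hR)
    refine (hua.meromorphicAt.fun_add (MeromorphicAt.const c z₀)).congr ?_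
    exact eventually_nhdsNE_iff_ball.2 ⟨min R S, lt_min hR hS, fun z hz => (hc z hz).symm⟩
  have hfac : ∀ g : ℂ → ℂ, AnalyticAt ℂ g z₀ → ∃ g₁ : ℂ → ℂ, AnalyticAt ℂ g₁ z₀ ∧
      ∀ z, g z = g z₀ + (z - z₀) * g₁ z := by
    rintro g ⟨p, hp⟩
    refine ⟨dslope g z₀, ⟨_, hp.has_fpower_series_dslope_fslope⟩, fun z => ?_⟩
    have := sub_smul_dslope g z₀ z
    rw [smul_eq_mul] at this
    rw [this]; ring
  -- Induction on a bound `n` for the pole order of the derivative, splitting off the leading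
  -- coefficient `g z₀`.
  have main : ∀ (n : ℕ) (G g : ℂ → ℂ), AnalyticAt ℂ g z₀ →
      (∀ᶠ z in 𝓝[≠] z₀, HasDerivAt G (((z - z₀) ^ n)⁻¹ * g z) z) → MeromorphicAt G z₀ := by
    intro n
    induction n with
    | zero =>
      intro G g hg hG
      exact base G g hg (by simpa using hG)
    | succ n ih =>
      intro G g hg hG
      obtain ⟨g₁, hg₁, hgg⟩ := hfac g hg
      have hne : ∀ᶠ z in 𝓝[≠] z₀, z ≠ z₀ := eventually_mem_nhdsWithin
      rcases Nat.eq_zero_or_pos n with rfl | hn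
      · obtain ⟨R, hR, hd⟩ := Metric.eventually_nhds_iff_ball.1 hg₁.eventually_analyticAt
        obtain ⟨u, hu⟩ := (DifferentiableOn.isExactOn_ball (c := z₀) (r := R)
          (f := g₁) fun z hz => (hd z hz).differentiableAt.differentiableWithinAt)
        obtain ⟨S, hS, hG'⟩ := eventually_nhdsNE_iff_ball.1 hG
        set T := min R S / 2 with hT
        have hTpos : 0 < T := half_pos (lt_min hR hS)
        have hTR : T < R := by have := min_le_left R S; linarith [lt_min hR hS]
        have hTS : T < S := by have := min_le_right R S; linarith [lt_min hR hS]
        -- On the circle `G - u` is a single-valued primitive of `g z₀ / (z - z₀)`, so the integral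
        -- vanishes. Hence the residue `g z₀` is zero and there was no pole.
        have h0 : (∮ z in C(z₀, T), g z₀ * (z - z₀)⁻¹) = 0 := by
          refine circleIntegral.integral_eq_zero_of_hasDerivWithinAt (f := fun z => G z - u z)
            hTpos.le fun z hz => HasDerivAt.hasDerivWithinAt ?_
          rw [mem_sphere] at hz
          have hz0 : z ≠ z₀ := fun h => by simp [h] at hz; exact hTpos.ne hz
          have := (hG' z ⟨mem_ball.2 (by rw [hz]; exact hTS), hz0⟩).sub
            (hu z (mem_ball.2 (by rw [hz]; exact hTR)))
          convert! this using 1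
          rw [hgg z]
          have := sub_ne_zero.2 hz0
          field_simp
          ring
        rw [circleIntegral.integral_const_mul,
          circleIntegral.integral_sub_center_inv z₀ hTpos.ne'] at h0
        have hg0 : g z₀ = 0 := by
          rcases mul_eq_zero.1 h0 with h | h
          · exact h
          · exact absurd h Complex.two_pi_I_ne_zero
        refine base G g₁ hg₁ ?_
        filter_upwards [hG, hne] with z hz hz0
        have := sub_ne_zero.2 hz0
        convert! hz using 1
        rw [hgg z, hg0]
        field_simp
        ring
      -- The derivative of the added power is `-g z₀ / (z - z₀) ^ (n + 1)`, which cancels the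
      -- leading term.
      · have hGm : MeromorphicAt (fun z => G z + g z₀ / n * ((z - z₀) ^ n)⁻¹) z₀ := by
          refine ih _ g₁ hg₁ ?_
          filter_upwards [hG, hne] with z hz hz0
          have hz1 := sub_ne_zero.2 hz0
          have hp : HasDerivAt (fun z => (z - z₀) ^ n) (n * (z - z₀) ^ (n - 1)) z := by
            simpa using ((hasDerivAt_id z).sub_const z₀).fun_pow n
          have := hz.add ((hp.fun_inv (pow_ne_zero n hz1)).const_mul (g z₀ / n))
          convert! this using 1
          obtain ⟨m, rfl⟩ := Nat.exists_eq_succ_of_ne_zero hn.ne'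
          have hm : ((m : ℂ) + 1) ≠ 0 := by exact_mod_cast Nat.succ_ne_zero m
          rw [hgg z]
          simp only [Nat.succ_eq_add_one, Nat.add_sub_cancel, Nat.cast_add, Nat.cast_one]
          field_simp
          ring
        have hpm : MeromorphicAt (fun z => g z₀ / n * ((z - z₀) ^ n)⁻¹) z₀ := by fun_prop
        refine (hGm.fun_sub hpm).congr (Eventually.of_forall fun z => ?_)
        ring
  obtain ⟨n, hn⟩ := ha
  refine main n G _ hn ?_
  filter_upwards [hG, eventually_mem_nhdsWithin] with z hz hz0
  have := sub_ne_zero.2 (show z ≠ z₀ from hz0)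
  convert! hz using 1
  rw [smul_eq_mul]
  field_simp

theorem residue_congr {f g : ℂ → ℂ} {z₀ : ℂ} (h : f =ᶠ[𝓝[≠] z₀] g) :
    residue f z₀ = residue g z₀ := by
  obtain ⟨R, hR, hfg⟩ := eventually_nhdsNE_iff_ball.1 h
  unfold residue limUnder
  congr 1
  apply Filter.map_congr
  filter_upwards [Ioo_mem_nhdsGT hR] with r hr
  congr 1
  refine circleIntegral.integral_congr hr.1.le fun z hz => hfg z ⟨?_, ?_⟩
  · rw [mem_ball, mem_sphere.1 hz]; exact hr.2
  · rintro rfl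
    simp at hz
    exact hr.1.ne hz

/-- By Cauchy's theorem on annuli the integral does not depend on the radius, so the limit defining
`residue` is that of an eventually constant function. -/
theorem circleIntegral_eq_residue {f : ℂ → ℂ} {z₀ : ℂ} {R : ℝ}
    (hf : DifferentiableOn ℂ f (ball z₀ R \ {z₀})) {r : ℝ} (hr : 0 < r) (hrR : r < R) :
    (∮ z in C(z₀, r), f z) = 2 * Real.pi * Complex.I * residue f z₀ := by
  have key : ∀ s, 0 < s → s ≤ r → (∮ z in C(z₀, r), f z) = ∮ z in C(z₀, s), f z := by
    intro s hs hsr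
    refine Complex.circleIntegral_eq_of_differentiable_on_annulus_off_countable hs hsr
      countable_empty ?_ ?_
    · refine hf.continuousOn.mono fun z hz => ⟨?_, ?_⟩
      · exact closedBall_subset_ball hrR hz.1
      · rintro rfl
        exact hz.2 (mem_ball_self hs)
    · intro z hz
      refine hf.differentiableAt ((isOpen_ball_diff_singleton z₀ R).mem_nhds ⟨?_, ?_⟩)
      · exact ball_subset_ball hrR.le hz.1.1
      · rintro rfl
        exact hz.1.2 (mem_closedBall_self hs.le)
  have hlim : Tendsto (fun ρ : ℝ => (2 * Real.pi * Complex.I : ℂ)⁻¹ * ∮ z in C(z₀, ρ), f z)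
      (𝓝[>] 0) (𝓝 ((2 * Real.pi * Complex.I : ℂ)⁻¹ * ∮ z in C(z₀, r), f z)) := by
    refine tendsto_const_nhds.congr' ?_
    filter_upwards [Ioc_mem_nhdsGT hr] with s hs
    rw [key s hs.1 hs.2]
  rw [residue, hlim.limUnder_eq, mul_inv_cancel_left₀ Complex.two_pi_I_ne_zero]

/-- The profile of a radial cutoff function, as a function of the squared distance. -/
def cutoffProfile (R s : ℝ) : ℝ := Real.smoothTransition (2 - 4 * s / R ^ 2)

theorem cutoffProfile_contDiff (R : ℝ) : ContDiff ℝ ∞ (cutoffProfile R) :=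
  Real.smoothTransition.contDiff.comp (by fun_prop)

theorem cutoffProfile_eq_one {R s : ℝ} (hR : 0 < R) (hs : s ≤ R ^ 2 / 4) :
    cutoffProfile R s = 1 := by
  apply Real.smoothTransition.one_of_one_le
  have : 4 * s / R ^ 2 ≤ 1 := by rw [div_le_one (by positivity)]; linarith
  linarith

theorem cutoffProfile_eq_zero {R s : ℝ} (hR : 0 < R) (hs : R ^ 2 / 2 ≤ s) :
    cutoffProfile R s = 0 := by
  apply Real.smoothTransition.zero_of_nonpos
  have : 2 ≤ 4 * s / R ^ 2 := by rw [le_div_iff₀ (by positivity)]; linarith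
  linarith

theorem deriv_cutoffProfile_of_lt {R s : ℝ} (hR : 0 < R) (hs : s < R ^ 2 / 4) :
    deriv (cutoffProfile R) s = 0 := by
  have : cutoffProfile R =ᶠ[𝓝 s] fun _ => 1 := by
    filter_upwards [Iio_mem_nhds hs] with t ht
    exact cutoffProfile_eq_one hR (le_of_lt ht)
  rw [this.deriv_eq, deriv_const]

theorem deriv_cutoffProfile_of_gt {R s : ℝ} (hR : 0 < R) (hs : R ^ 2 / 2 < s) :
    deriv (cutoffProfile R) s = 0 := by
  have : cutoffProfile R =ᶠ[𝓝 s] fun _ => 0 := by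
    filter_upwards [Ioi_mem_nhds hs] with t ht
    exact cutoffProfile_eq_zero hR (le_of_lt ht)
  rw [this.deriv_eq, deriv_const]

/-- The integrand is the derivative of half of `cutoffProfile R (r ^ 2)`, which drops from `1 / 2`
at `0` to zero for large `r`. -/
theorem integral_mul_deriv_cutoffProfile {R : ℝ} (hR : 0 < R) :
    ∫ r in Ioi (0 : ℝ), r * deriv (cutoffProfile R) (r ^ 2) = -(1 / 2) := by
  have hc : Continuous fun r : ℝ => r * deriv (cutoffProfile R) (r ^ 2) :=
    continuous_id.mul (((cutoffProfile_contDiff R).continuous_deriv (by simp)).comp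
      (continuous_pow 2))
  have h := integral_Ioi_of_hasDerivAt_of_tendsto' (a := 0) (m := 0)
    (f := fun r : ℝ => 1 / 2 * cutoffProfile R (r ^ 2))
    (f' := fun r : ℝ => r * deriv (cutoffProfile R) (r ^ 2)) ?_ ?_ ?_
  · rw [h, cutoffProfile_eq_one hR (by simp; positivity)]; norm_num
  · intro r _
    have h1 : HasDerivAt (cutoffProfile R) (deriv (cutoffProfile R) (r ^ 2)) (r ^ 2) :=
      (((cutoffProfile_contDiff R).differentiable (by simp)) _).hasDerivAt
    have h2 := (HasDerivAt.comp (h := fun r : ℝ => r ^ 2) r h1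
      (hasDerivAt_pow 2 r)).const_mul (1 / 2)
    convert! h2 using 1
    norm_num
    ring
  · refine IntegrableOn.of_forall_sdiff_eq_zero
      (hc.continuousOn.integrableOn_compact (isCompact_Icc (a := 0) (b := R)))
      measurableSet_Ioi fun r hr => ?_
    have hr0 : 0 < r := hr.1
    have hrR : R < r := by
      by_contra h
      exact hr.2 ⟨hr0.le, not_lt.1 h⟩
    rw [deriv_cutoffProfile_of_gt hR (by nlinarith), mul_zero]
  · refine tendsto_const_nhds.congr' ?_
    filter_upwards [eventually_ge_atTop R] with r hr
    rw [cutoffProfile_eq_zero hR (by nlinarith), mul_zero]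

/-- The residue as an area integral against the derivative of a radial cutoff function. -/
theorem integral_radial_eq_residue {f : ℂ → ℂ} {z₀ : ℂ} {R : ℝ} (hR : 0 < R)
    (hf : DifferentiableOn ℂ f (ball z₀ R \ {z₀})) :
    ∫ z, f z * (deriv (cutoffProfile R) (‖z - z₀‖ ^ 2) * (z - z₀)) = -Real.pi * residue f z₀ := by
  set q : ℝ → ℝ := deriv (cutoffProfile R) with hq
  have hqc : Continuous q := (cutoffProfile_contDiff R).continuous_deriv (by simp)
  rw [← integral_add_left_eq_self _ z₀, ← Complex.integral_comp_polarCoord_symm,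
    polarCoord_target]
  simp only [add_sub_cancel_left, Complex.norm_polarCoord_symm, sq_abs]
  have hpol : ∀ p : ℝ × ℝ, Complex.polarCoord.symm p = circleMap 0 p.1 p.2 := by
    intro p
    rw [Complex.polarCoord_symm_apply, circleMap, Complex.exp_mul_I]
    simp
  have hadd : ∀ r θ : ℝ, z₀ + circleMap 0 r θ = circleMap z₀ r θ := by simp [circleMap]
  simp only [hpol, hadd]
  have hcm : Continuous fun p : ℝ × ℝ => circleMap z₀ p.1 p.2 := by
    unfold circleMap; fun_prop
  have hcm0 : Continuous fun p : ℝ × ℝ => circleMap 0 p.1 p.2 := by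
    unfold circleMap; fun_prop
  -- The factor `q (r ^ 2)` vanishes unless `R / 2 ≤ r ≤ R / √2`. Since `R / √2 < 3 * R / 4 < R`,
  -- only a compact annulus on which `f` is continuous matters.
  have hintegral : IntegrableOn (fun p : ℝ × ℝ => p.1 • (f (circleMap z₀ p.1 p.2)
      * (q (p.1 ^ 2) * circleMap 0 p.1 p.2))) (Ioi 0 ×ˢ Ioo (-Real.pi) Real.pi) := by
    refine IntegrableOn.of_forall_sdiff_eq_zero (ContinuousOn.integrableOn_compact
      ((isCompact_Icc (a := R / 2) (b := 3 * R / 4)).prod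
        (isCompact_Icc (a := -Real.pi) (b := Real.pi))) ?_)
      (measurableSet_Ioi.prod measurableSet_Ioo) ?_
    · refine continuous_fst.continuousOn.smul (ContinuousOn.mul ?_ ?_)
      · refine hf.continuousOn.comp hcm.continuousOn fun p hp => ⟨?_, ?_⟩
        · have h1 := hp.1.1; have h2 := hp.1.2
          rw [mem_ball, Complex.dist_eq]
          simp only [circleMap, add_sub_cancel_left, norm_mul, Complex.norm_real,
            Complex.norm_exp_ofReal_mul_I, mul_one, Real.norm_eq_abs]
          rw [abs_of_pos (by linarith)]
          linarith
        · have h1 := hp.1.1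
          exact circleMap_ne_center (by linarith)
      · exact ((Complex.continuous_ofReal.comp (hqc.comp (continuous_fst.pow 2))).mul
          hcm0).continuousOn
    · rintro ⟨r, θ⟩ ⟨hp, hp'⟩
      have hr0 : 0 < r := hp.1
      have hθ := hp.2
      have : q (r ^ 2) = 0 := by
        by_contra hne
        refine hp' ⟨⟨?_, ?_⟩, ⟨hθ.1.le, hθ.2.le⟩⟩
        · by_contra h
          exact hne (deriv_cutoffProfile_of_lt hR (by simp at h; nlinarith))
        · by_contra h
          exact hne (deriv_cutoffProfile_of_gt hR (by simp at h; nlinarith))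
      simp [this]
  rw [Measure.volume_eq_prod, setIntegral_prod _ (by rwa [← Measure.volume_eq_prod])]
  -- On the circle of radius `r` one has `dz = i (z - z₀) dθ`, so the angular integral of `f(z) (z -
  -- z₀)` is `2π` times the residue.
  have hinner : ∀ r ∈ Ioi (0 : ℝ), (∫ θ in Ioo (-Real.pi) Real.pi, r • (f (circleMap z₀ r θ)
      * (q (r ^ 2) * circleMap 0 r θ)))
      = ((r * q (r ^ 2) : ℝ) : ℂ) * (2 * Real.pi * residue f z₀) := by
    intro r hr
    by_cases hrR : r < R
    · have h1 := circleIntegral_eq_residue hf hr hrR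
      rw [circleIntegral] at h1
      simp only [deriv_circleMap, smul_eq_mul] at h1
      have hper : Function.Periodic (fun θ => circleMap 0 r θ * Complex.I * f (circleMap z₀ r θ))
          (2 * Real.pi) := by
        intro θ
        simp only [periodic_circleMap _ _ θ]
      have h2 := hper.intervalIntegral_add_eq 0 (-Real.pi)
      rw [zero_add, h1, show -Real.pi + 2 * Real.pi = Real.pi by ring] at h2
      rw [← integral_Ioc_eq_integral_Ioo, ← intervalIntegral.integral_of_le
        (by linarith [Real.pi_pos])]
      have h3 : (fun θ => r • (f (circleMap z₀ r θ) * (q (r ^ 2) * circleMap 0 r θ)))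
          = fun θ => (-Complex.I * (r * q (r ^ 2) : ℝ)) *
            (circleMap 0 r θ * Complex.I * f (circleMap z₀ r θ)) := by
        funext θ
        rw [Complex.real_smul]
        push_cast
        linear_combination ((r : ℂ) * q (r ^ 2) * circleMap 0 r θ * f (circleMap z₀ r θ))
          * Complex.I_mul_I
      rw [h3, intervalIntegral.integral_const_mul, ← h2]
      linear_combination (-((r * q (r ^ 2) : ℝ) : ℂ) * (2 * Real.pi * residue f z₀))
          * Complex.I_mul_I
    · have : q (r ^ 2) = 0 := deriv_cutoffProfile_of_gt hR (by nlinarith)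
      simp [this]
  rw [setIntegral_congr_fun measurableSet_Ioi hinner, integral_mul_const, integral_complex_ofReal,
    integral_mul_deriv_cutoffProfile hR]
  push_cast
  ring

end Plane

/-! ### Local primitives, removable singularities and the maximum principle -/

section Extension

open Metric

/-- The Poincaré lemma near a point of the plane. -/
theorem exists_local_primitive {a : ℂ → ℂ →L[ℝ] ℂ} {U : Set ℂ} (hU : IsOpen U)
    (ha : ContDiffOn ℝ ∞ a U) (hcurl : ∀ z ∈ U, curl a z = 0) {z₀ : ℂ} (hz₀ : z₀ ∈ U) :
    ∃ R > 0, ball z₀ R ⊆ U ∧ ∃ h : ℂ → ℂ, ContDiffOn ℝ ∞ h (ball z₀ R) ∧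
      ∀ z ∈ ball z₀ R, HasFDerivAt h (a z) z := by
  obtain ⟨R, hR, hRU⟩ := Metric.isOpen_iff.1 hU z₀ hz₀
  obtain ⟨h, hh⟩ : ∃ h : ℂ → ℂ, ∀ z ∈ ball z₀ R, HasFDerivAt h (a z) z :=
    (convex_ball z₀ R).exists_forall_hasFDerivAt_of_fderiv_symmetric isOpen_ball
      ((ha.differentiableOn (by simp)).mono hRU) (by
      intro z hz x y
      -- The antisymmetric part of a real bilinear form on `ℂ` is determined by its value on `(1,
      -- I)`, so vanishing curl makes the whole derivative symmetric.
      have hc := hcurl z (hRU hz)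
      rw [curl] at hc
      have h2 : ∀ u v : ℂ, fderiv ℝ a z u v
          = u.re * (fderiv ℝ a z 1 v) + u.im * (fderiv ℝ a z Complex.I v) := fun u v =>
        clm_apply_eq ((ContinuousLinearMap.apply ℝ ℂ v).comp (fderiv ℝ a z)) u
      rw [h2 x y, h2 y x, clm_apply_eq (fderiv ℝ a z 1) x, clm_apply_eq (fderiv ℝ a z 1) y,
        clm_apply_eq (fderiv ℝ a z Complex.I) x, clm_apply_eq (fderiv ℝ a z Complex.I) y]
      linear_combination (x.re * y.im - x.im * y.re : ℂ) * hc)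
  refine ⟨R, hR, hRU, h, ?_, hh⟩
  rw [contDiffOn_infty_iff_fderiv_of_isOpen isOpen_ball]
  refine ⟨fun z hz => (hh z hz).differentiableAt.differentiableWithinAt,
    (ha.mono hRU).congr fun z hz => (hh z hz).fderiv⟩

variable {X : Type*} [TopologicalSpace X]

theorem isOpen_notMem_finset [T1Space X] (P : Finset X) : IsOpen {x : X | x ∉ P} :=
  P.finite_toSet.isClosed.isOpen_compl

theorem eventually_symm_notMem [T1Space X] (P : Finset X) (e : OpenPartialHomeomorph X ℂ) {z : ℂ}
    (hz : z ∈ e.target) : ∀ᶠ w in 𝓝[≠] z, w ∈ e.target ∧ e.symm w ∉ P := by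
  classical
  -- The centre itself may lie in `P`; it is erased to get an open condition, and excluded
  -- afterwards by the punctured neighbourhood.
  have h1 : ∀ᶠ w in 𝓝 z, w ∈ e.target ∧ e.symm w ∈ {x : X | x ∉ P.erase (e.symm z)} :=
    (isOpen_chart_preimage e (isOpen_notMem_finset _)).mem_nhds ⟨hz, by simp⟩
  filter_upwards [h1.filter_mono nhdsWithin_le_nhds, eventually_mem_nhdsWithin] with w hw hwz
  refine ⟨hw.1, fun hP => hw.2 (Finset.mem_erase.2 ⟨fun h => hwz ?_, hP⟩)⟩
  exact e.symm.injOn hw.1 hz h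

/-- Two continuous functions on the image of a chart which agree off a finite set are equal. -/
theorem eqOn_target_of_eqOn_off [T1Space X] {E : Type*} [TopologicalSpace E] [T2Space E]
    (P : Finset X) (e : OpenPartialHomeomorph X ℂ) {w v : ℂ → E}
    (hw : ContinuousOn w e.target) (hv : ContinuousOn v e.target)
    (h : ∀ z ∈ e.target, e.symm z ∉ P → w z = v z) : ∀ z ∈ e.target, w z = v z := by
  intro z hz
  have h1 := (hw.continuousAt (e.open_target.mem_nhds hz)).tendsto.mono_left
    (nhdsWithin_le_nhds (s := {z}ᶜ))
  have h2 := (hv.continuousAt (e.open_target.mem_nhds hz)).tendsto.mono_left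
    (nhdsWithin_le_nhds (s := {z}ᶜ))
  refine tendsto_nhds_unique_of_eventuallyEq h1 h2 ?_
  filter_upwards [eventually_symm_notMem P e hz] with x hx
  exact h x hx.1 hx.2

variable [ChartedSpace ℂ X] [IsManifold 𝓘(ℂ, ℂ) ω X]

/-- A function which is smooth off a finite set and whose differential agrees, near each exceptional
point, with a smooth closed form, extends smoothly. -/
theorem exists_smooth_extension [T2Space X] (P : Finset X) {f : X → ℂ}
    (hf : ContMDiffOn 𝓘(ℝ, ℂ) 𝓘(ℝ, ℂ) ∞ f {x | x ∉ P}) {α : SForm X} (hα : IsSmoothSForm α)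
    (hcl : ∀ e ∈ atlas ℂ X, ∀ z ∈ e.target, curl (localForm e α) z = 0)
    (hd : ∀ p ∈ P, ∀ᶠ z in 𝓝[≠] (chartAt ℂ p p),
      HasFDerivAt (f ∘ (chartAt ℂ p).symm) (localForm (chartAt ℂ p) α z) z) :
    ∃ F : X → ℂ, ContMDiff 𝓘(ℝ, ℂ) 𝓘(ℝ, ℂ) ∞ F ∧ ∀ x ∉ P, F x = f x := by
  classical
  have hloc : ∀ p ∈ P, ∃ y : ℂ, ∃ h : ℂ → ℂ, ContDiffAt ℝ ∞ h (chartAt ℂ p p) ∧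
      h (chartAt ℂ p p) = y ∧
      ∀ᶠ z in 𝓝[≠] (chartAt ℂ p p), f ((chartAt ℂ p).symm z) = h z := by
    intro p hp
    obtain ⟨R, hR, -, h, hs, hh⟩ := exists_local_primitive (chartAt ℂ p).open_target
      (hα _ (chart_mem_atlas ℂ p)) (hcl _ (chart_mem_atlas ℂ p)) (mem_chart_target ℂ p)
    obtain ⟨S, hS, hfS⟩ := eventually_nhdsNE_iff_ball.1 (hd p hp)
    -- On a punctured disc `f` and the primitive `h` of `α` have the same differential, so `h + c`
    -- is a smooth extension of `f`.
    obtain ⟨c, hc⟩ := exists_eq_add_const (z₀ := chartAt ℂ p p) (R := min R S)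
      (fun z hz => hfS z ⟨ball_subset_ball (min_le_right _ _) hz.1, hz.2⟩)
      (fun z hz => hh z (ball_subset_ball (min_le_left _ _) hz.1))
    refine ⟨_, fun z => h z + c, ?_, rfl, ?_⟩
    · exact (hs.contDiffAt (ball_mem_nhds _ hR)).add contDiffAt_const
    · exact eventually_nhdsNE_iff_ball.2 ⟨min R S, lt_min hR hS, hc⟩
  choose! y h hh hy hfh using hloc
  refine ⟨fun x => if x ∈ P then y x else f x, ?_, fun x hx => by simp [hx]⟩
  intro x
  by_cases hx : x ∈ P
  · refine contMDiffAt_of_comp_symm (chart_mem_atlas ℂ x) (mem_chart_source ℂ x) ?_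
    refine (hh x hx).congr_of_eventuallyEq ?_
    have h1 : ∀ᶠ z in 𝓝[≠] (chartAt ℂ x x), (if (chartAt ℂ x).symm z ∈ P then
        y ((chartAt ℂ x).symm z) else f ((chartAt ℂ x).symm z)) = h x z := by
      filter_upwards [hfh x hx, eventually_symm_notMem P _ (mem_chart_target ℂ x)] with z hz hz'
      rw [if_neg hz'.2, hz]
    rw [eventually_nhdsWithin_iff] at h1
    filter_upwards [h1] with z hz
    by_cases hzx : z = chartAt ℂ x x
    · subst hzx
      simp [hx, hy x hx]
    · exact hz hzx
  · refine (hf.contMDiffAt ((isOpen_notMem_finset P).mem_nhds hx)).congr_of_eventuallyEq ?_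
    filter_upwards [(isOpen_notMem_finset P).mem_nhds hx] with w hw
    exact if_neg hw

open InnerProductSpace in
/-- A function on a closed connected Riemann surface with coclosed differential is constant. -/
theorem exists_eq_const_of_harmonic [CompactSpace X] [ConnectedSpace X] {f : X → ℂ}
    (hf : ContMDiff 𝓘(ℝ, ℂ) 𝓘(ℝ, ℂ) ∞ f)
    (hh : ∀ e ∈ atlas ℂ X, ∀ z ∈ e.target, curl (starLocal (fderiv ℝ (f ∘ e.symm))) z = 0) :
    ∃ c, ∀ x, f x = c := by
  have hsm : ∀ e ∈ atlas ℂ X, ContDiffOn ℝ ∞ (f ∘ e.symm) e.target := by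
    intro e he
    have h := contDiffOn_comp_symm he hf.contMDiffOn (s := univ)
    simpa only [mem_univ, and_true] using! h
  have hharm : ∀ e ∈ atlas ℂ X, HarmonicOnNhd (f ∘ e.symm) e.target := by
    intro e he z hz
    refine ⟨((hsm e he).contDiffAt (e.open_target.mem_nhds hz)).of_le
      (WithTop.coe_le_coe.2 (le_top : (2 : ℕ∞) ≤ ⊤)), ?_⟩
    filter_upwards [e.open_target.mem_nhds hz] with w hw
    have h1 := hh e he w hw
    have hd : DifferentiableAt ℝ (fderiv ℝ (f ∘ e.symm)) w :=
      (((hsm e he).fderiv_of_isOpen (m := ∞) e.open_target (by simp)).differentiableOn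
        (by simp)).differentiableAt (e.open_target.mem_nhds hw)
    have hst : HasFDerivAt (starLocal (fderiv ℝ (f ∘ e.symm))) _ w :=
      (hd.hasFDerivAt.clm_comp (hasFDerivAt_const (ContinuousLinearMap.mul ℝ ℂ Complex.I) w)).neg
    rw [curl, hst.fderiv] at h1
    rw [laplacian_eq_iteratedFDeriv_complexPlane]
    simp only [iteratedFDeriv_two_apply, Matrix.cons_val_zero, Matrix.cons_val_one]
    simp at h1
    rw [Pi.zero_apply]
    linear_combination h1
  -- The maximum principle for a real-valued harmonic function, applied at the end to the real and
  -- the imaginary part: the set where the maximum is attained is closed, open and nonempty.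
  have hconst : ∀ L : ℂ →L[ℝ] ℝ, ∃ c, ∀ x, L (f x) = c := by
    intro L
    have hcont : Continuous fun x => L (f x) := L.continuous.comp hf.continuous
    obtain ⟨x₀, -, hx₀⟩ := isCompact_univ.exists_isMaxOn (univ_nonempty (α := X))
      hcont.continuousOn
    have hmax : ∀ x, L (f x) ≤ L (f x₀) := fun x => hx₀ (mem_univ x)
    have hclopen : IsClopen {x | L (f x) = L (f x₀)} := by
      refine ⟨isClosed_eq hcont continuous_const, isOpen_iff_mem_nhds.2 fun x hx => ?_⟩
      have hx : L (f x) = L (f x₀) := hx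
      set e := chartAt ℂ x with he
      obtain ⟨R, hR, hRU⟩ := Metric.isOpen_iff.1 e.open_target (e x) (mem_chart_target ℂ x)
      have hLh : HarmonicOnNhd (fun z => L (f (e.symm z))) (ball (e x) R) := fun z hz =>
        (hharm e (chart_mem_atlas ℂ x) z (hRU hz)).comp_CLM L
      -- Locally `L ∘ f` is the real part of a holomorphic `F`, so its exponential is the modulus of
      -- `exp F` and the maximum modulus principle applies.
      obtain ⟨F, hF, hFeq⟩ := hLh.exists_analyticOnNhd_ball_re_eq
      have hnorm : ∀ z ∈ ball (e x) R, ‖Complex.exp (F z)‖ = Real.exp (L (f (e.symm z))) := by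
        intro z hz
        rw [Complex.norm_exp]
        exact congrArg _ (hFeq hz)
      have hlm : ∀ᶠ z in 𝓝 (e x), ‖Complex.exp (F z)‖ = ‖Complex.exp (F (e x))‖ := by
        refine Complex.norm_eventually_eq_of_isLocalMax (f := fun z => Complex.exp (F z)) ?_ ?_
        · filter_upwards [ball_mem_nhds (e x) hR] with z hz
          exact (hF z hz).differentiableAt.cexp
        · filter_upwards [ball_mem_nhds (e x) hR] with z hz
          simp only [Function.comp_apply]
          rw [hnorm z hz, hnorm _ (mem_ball_self hR), e.left_inv (mem_chart_source ℂ x), hx]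
          exact Real.exp_le_exp.2 (hmax _)
      have hev : ∀ᶠ z in 𝓝 (e x), L (f (e.symm z)) = L (f x₀) := by
        filter_upwards [hlm, ball_mem_nhds (e x) hR] with z hz hzR
        rw [hnorm z hzR, hnorm _ (mem_ball_self hR), e.left_inv (mem_chart_source ℂ x), hx] at hz
        exact Real.exp_injective hz
      filter_upwards [(e.continuousAt (mem_chart_source ℂ x)).eventually hev,
        e.open_source.mem_nhds (mem_chart_source ℂ x)] with y hy hys
      rw [e.left_inv hys] at hy
      exact hy
    have huniv := hclopen.eq_univ ⟨x₀, rfl⟩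
    exact ⟨L (f x₀), fun x => by
      have : x ∈ {x | L (f x) = L (f x₀)} := huniv ▸ mem_univ x
      exact this⟩
  obtain ⟨a, ha⟩ := hconst Complex.reCLM
  obtain ⟨b, hb⟩ := hconst Complex.imCLM
  exact ⟨⟨a, b⟩, fun x => Complex.ext (ha x) (hb x)⟩

end Extension

/-! ### Cut-off primitives and their residues -/

section Reciprocity

open MeasureTheory Metric

theorem wedge_eq_of_complexLinear {a b : ℂ →L[ℝ] ℂ} (hb : ∀ u, b u = u * b 1) :
    wedge a b = (a 1 * Complex.I - a Complex.I) * b 1 := by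
  rw [wedge, hb Complex.I]; ring

theorem wedge_eq_zero_of_complexLinear {a b : ℂ →L[ℝ] ℂ} (ha : ∀ u, a u = u * a 1)
    (hb : ∀ u, b u = u * b 1) : wedge a b = 0 := by
  rw [wedge_eq_of_complexLinear hb, ha Complex.I]; ring

theorem wedge_sum_left {ι : Type*} (s : Finset ι) (a : ι → ℂ →L[ℝ] ℂ) (c : ℂ →L[ℝ] ℂ) :
    wedge (∑ i ∈ s, a i) c = ∑ i ∈ s, wedge (a i) c := by
  simp only [wedge, FunLike.coe_sum, Finset.sum_apply, Finset.sum_mul,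
    Finset.sum_sub_distrib]

variable {X : Type*} [TopologicalSpace X] [ChartedSpace ℂ X]

/-- A holomorphic one-form on the complement of the finite set `P`. -/
structure IsHolomorphicOff (P : Finset X) (θ : SForm X) : Prop where
  complexLinear : ∀ e ∈ atlas ℂ X, ∀ z ∈ e.target, e.symm z ∉ P → ∀ u,
    localForm e θ z u = u * localForm e θ z 1
  differentiableOn : ∀ e ∈ atlas ℂ X,
    DifferentiableOn ℂ (fun z => localForm e θ z 1) {z | z ∈ e.target ∧ e.symm z ∉ P}

theorem IsMeromorphicForm.isHolomorphicOff {P : Finset X} {α : MForm X}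
    (h : IsMeromorphicForm P α) (i j : Fin 2) : IsHolomorphicOff P (α i j) where
  complexLinear e he z hz hP u := by
    have h1 := h.1 e he z hz hP i j 1
    rw [mul_one] at h1
    rw [clm_apply_eq, h1]
    conv_rhs => rw [← Complex.re_add_im u]
    ring
  differentiableOn e he := (h.2 e he i j).1

theorem ContDiffOn.real_of_differentiableOn {f : ℂ → ℂ} {s : Set ℂ} (hs : IsOpen s)
    (hf : DifferentiableOn ℂ f s) : ContDiffOn ℝ ∞ f s :=
  (hf.contDiffOn hs).restrict_scalars ℝ

theorem IsHolomorphicOff.contDiffOn [T1Space X] {P : Finset X} {θ : SForm X}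
    (h : IsHolomorphicOff P θ) {e : OpenPartialHomeomorph X ℂ} (he : e ∈ atlas ℂ X) :
    ContDiffOn ℝ ∞ (localForm e θ) {z | z ∈ e.target ∧ e.symm z ∉ P} := by
  have h1 := ContDiffOn.real_of_differentiableOn
    (isOpen_chart_preimage e (isOpen_notMem_finset P)) (h.differentiableOn e he)
  refine (h1.smul (contDiffOn_const (c := ContinuousLinearMap.id ℝ ℂ))).congr fun z hz => ?_
  ext1 u
  rw [h.complexLinear e he z hz.1 hz.2 u]
  simp [mul_comm]

/-- The form is `a dz` with `a` holomorphic, and `da` is a multiple of `dz` by Cauchy–Riemann. -/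
theorem IsHolomorphicOff.curl_eq_zero [T1Space X] {P : Finset X} {θ : SForm X}
    (h : IsHolomorphicOff P θ) {e : OpenPartialHomeomorph X ℂ} (he : e ∈ atlas ℂ X) {z : ℂ}
    (hz : z ∈ e.target) (hP : e.symm z ∉ P) : curl (localForm e θ) z = 0 := by
  have ho := (isOpen_chart_preimage e (isOpen_notMem_finset P)).mem_nhds ⟨hz, hP⟩
  have hev : localForm e θ =ᶠ[𝓝 z] fun w =>
      localForm e θ w 1 • ContinuousLinearMap.id ℝ ℂ := by
    filter_upwards [ho] with w hw
    ext1 u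
    rw [h.complexLinear e he w hw.1 hw.2 u]
    simp [mul_comm]
  have hd := (h.differentiableOn e he).differentiableAt ho
  rw [curl_congr hev, curl_smul (hd.restrictScalars ℝ) (differentiableAt_const _),
    (hd.hasFDerivAt.restrictScalars ℝ).fderiv]
  simp [wedge, curl]
  ring

theorem hasFDerivAt_cutoff (R : ℝ) (z₀ z : ℂ) :
    HasFDerivAt (fun w : ℂ => (cutoffProfile R (‖w - z₀‖ ^ 2) : ℂ))
      (((deriv (cutoffProfile R) (‖z - z₀‖ ^ 2) : ℝ) : ℂ) •
        (2 * (z - z₀).re : ℂ) • (Complex.ofRealCLM.comp Complex.reCLM)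
        + ((deriv (cutoffProfile R) (‖z - z₀‖ ^ 2) : ℝ) : ℂ) •
        (2 * (z - z₀).im : ℂ) • (Complex.ofRealCLM.comp Complex.imCLM)) z := by
  have h1 : HasDerivAt (cutoffProfile R) (deriv (cutoffProfile R) (‖z - z₀‖ ^ 2))
      (‖z - z₀‖ ^ 2) := (((cutoffProfile_contDiff R).differentiable (by simp)) _).hasDerivAt
  have h2 : HasFDerivAt (fun w : ℂ => ‖w - z₀‖ ^ 2) _ z :=
    ((hasFDerivAt_id z).sub_const z₀).norm_sq
  have h3 := Complex.ofRealCLM.hasFDerivAt.comp z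
    (HasDerivAt.comp_hasFDerivAt (f := fun w : ℂ => ‖w - z₀‖ ^ 2) z h1 h2)
  convert! h3 using 1
  ext
  simp
  ring

/-- Only the derivative of the cutoff contributes, since `dF` and `b` are both complex linear. For a
cutoff `χ(|z - z₀|²)` one has `dχ ∧ dz = 2 i χ' (z - z₀) dx ∧ dy`. -/
theorem wedge_fderiv_cutoff_mul {R : ℝ} {z₀ z : ℂ} {F : ℂ → ℂ} {F' : ℂ} (hF : HasDerivAt F F' z)
    {b : ℂ →L[ℝ] ℂ} (hb : ∀ u, b u = u * b 1) :
    wedge (fderiv ℝ (fun w => (cutoffProfile R (‖w - z₀‖ ^ 2) : ℂ) * F w) z) b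
      = 2 * Complex.I * (F z * b 1 * (deriv (cutoffProfile R) (‖z - z₀‖ ^ 2) * (z - z₀))) := by
  have h := ((hasFDerivAt_cutoff R z₀ z).mul (hF.hasFDerivAt.restrictScalars ℝ)).fderiv
  rw [wedge_eq_of_complexLinear hb,
    show (fun w => (cutoffProfile R (‖w - z₀‖ ^ 2) : ℂ) * F w)
      = (fun w => (cutoffProfile R (‖w - z₀‖ ^ 2) : ℂ)) * F from rfl, h]
  generalize deriv (cutoffProfile R) (‖z - z₀‖ ^ 2) = q
  conv_rhs => rw [← Complex.re_add_im (z - z₀)]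
  simp
  linear_combination (-2 * F z * b 1 * q * (z.im - z₀.im)) * Complex.I_mul_I

/-- Cutting off a local primitive `F` of a meromorphic form: the cut-off function `T`, and the
integral of `dT ∧ θ`. -/
theorem exists_cutoff_primitive [IsManifold 𝓘(ℂ, ℂ) ω X] [T2Space X] [CompactSpace X]
    (P : Finset X) {p : X} (hp : p ∈ P) {θ₁ θ₂ : SForm X} (hθ₂ : IsHolomorphicOff P θ₂)
    {F : X → ℂ}
    (hF : ∀ᶠ z in 𝓝[≠] (chartAt ℂ p p),
      HasDerivAt (F ∘ (chartAt ℂ p).symm) (localForm (chartAt ℂ p) θ₁ z 1) z) :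
    ∃ T : X → ℂ, ContMDiffOn 𝓘(ℝ, ℂ) 𝓘(ℝ, ℂ) ∞ T {x | x ∉ P} ∧
      (∀ q ∈ P, q ≠ p → T =ᶠ[𝓝 q] fun _ => 0) ∧
      (∀ᶠ z in 𝓝[≠] (chartAt ℂ p p), T ((chartAt ℂ p).symm z) = F ((chartAt ℂ p).symm z)) ∧
      ∃ W : OpenPartialHomeomorph X ℂ → ℂ → ℂ, IsDensity W ∧
        (∀ e ∈ atlas ℂ X, ∀ z ∈ e.target, e.symm z ∉ P →
          W e z = wedge (fderiv ℝ (T ∘ e.symm) z) (localForm e θ₂ z)) ∧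
        densityIntegral W = -(2 * Real.pi * Complex.I * residue (fun z =>
          F ((chartAt ℂ p).symm z) * localForm (chartAt ℂ p) θ₂ z 1) (chartAt ℂ p p)) := by
  classical
  set c := chartAt ℂ p with hc
  have hcA : c ∈ atlas ℂ X := chart_mem_atlas ℂ p
  set z₀ := c p with hz₀
  have hz₀t : z₀ ∈ c.target := mem_chart_target ℂ p
  have hcz₀ : c.symm z₀ = p := c.left_inv (mem_chart_source ℂ p)
  obtain ⟨R, hR, hRF⟩ := eventually_nhdsNE_iff_ball.1
    (hF.and (eventually_symm_notMem P c hz₀t))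
  have hbt : ball z₀ R ⊆ c.target := fun z hz => by
    by_cases h : z = z₀
    · rw [h]; exact hz₀t
    · exact (hRF z ⟨hz, h⟩).2.1
  -- The cutoff vanishes beyond radius `R / √2`, which is less than `3 * R / 4`; hence `K` is a
  -- compact set carrying `T`.
  set K : Set X := c.symm '' closedBall z₀ (3 * R / 4) with hK
  have hball : closedBall z₀ (3 * R / 4) ⊆ ball z₀ R := closedBall_subset_ball (by linarith)
  have hKc : IsCompact K := (isCompact_closedBall z₀ (3 * R / 4)).image_of_continuousOn
    (c.continuousOn_symm.mono (hball.trans hbt))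
  have hKs : K ⊆ c.source := by
    rintro _ ⟨z, hz, rfl⟩
    exact c.map_target (hbt (hball hz))
  have hKmem : ∀ z ∈ c.target, c.symm z ∉ K → 3 * R / 4 < ‖z - z₀‖ := by
    intro z _ hzK
    by_contra h
    exact hzK ⟨z, by simpa [dist_eq_norm] using h, rfl⟩
  have hKP : ∀ q ∈ P, q ≠ p → q ∉ K := by
    rintro _ hq hqp ⟨z, hz, rfl⟩
    refine (hRF z ⟨hball hz, fun h => hqp ?_⟩).2.2 hq
    rw [h, hcz₀]
  set T : X → ℂ := fun x => if x ∈ c.source then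
    (cutoffProfile R (‖c x - z₀‖ ^ 2) : ℂ) * F x else 0 with hT
  have hT0 : ∀ x ∉ K, T x = 0 := by
    intro x hx
    by_cases hxs : x ∈ c.source
    · have h1 := hKmem (c x) (c.map_source hxs) (by rwa [c.left_inv hxs])
      simp only [hT, if_pos hxs]
      rw [cutoffProfile_eq_zero hR (by nlinarith)]
      simp
    · simp [hT, hxs]
  have hT0' : ∀ x ∉ K, T =ᶠ[𝓝 x] fun _ => 0 := fun x hx => by
    filter_upwards [hKc.isClosed.isOpen_compl.mem_nhds hx] with y hy
    exact hT0 y hy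
  have hTc : ∀ z ∈ c.target, (T ∘ c.symm) =ᶠ[𝓝 z] fun w =>
      (cutoffProfile R (‖w - z₀‖ ^ 2) : ℂ) * (F ∘ c.symm) w := fun z hz => by
    filter_upwards [c.open_target.mem_nhds hz] with w hw
    simp [hT, c.map_target hw, c.right_inv hw]
  have hTs : ContMDiffOn 𝓘(ℝ, ℂ) 𝓘(ℝ, ℂ) ∞ T {x | x ∉ P} := by
    intro x hx
    apply ContMDiffAt.contMDiffWithinAt
    by_cases hxK : x ∈ K
    · refine contMDiffAt_of_comp_symm hcA (hKs hxK) ?_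
      obtain ⟨z, hz, rfl⟩ := hxK
      have hzt := hbt (hball hz)
      rw [c.right_inv hzt]
      refine ContDiffAt.congr_of_eventuallyEq ?_ (hTc z hzt)
      have hzne : z ∈ ball z₀ R \ {z₀} := ⟨hball hz, fun h => hx (by
        rw [mem_singleton_iff] at h; rwa [h, hcz₀])⟩
      refine ContDiffAt.mul ?_ ?_
      · refine (Complex.ofRealCLM.contDiff.comp ((cutoffProfile_contDiff R).comp ?_)).contDiffAt
        exact (contDiff_id.sub contDiff_const).norm_sq ℝ
      · exact (ContDiffOn.real_of_differentiableOn (isOpen_ball_diff_singleton z₀ R)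
          fun w hw => (hRF w hw).1.differentiableAt.differentiableWithinAt).contDiffAt
          ((isOpen_ball_diff_singleton z₀ R).mem_nhds hzne)
    · exact contMDiffAt_const.congr_of_eventuallyEq (hT0' x hxK)
  have hTF : ∀ z ∈ ball z₀ (R / 2), T (c.symm z) = F (c.symm z) := by
    intro z hz
    have hzt : z ∈ c.target := hbt (ball_subset_ball (by linarith) hz)
    rw [mem_ball, dist_eq_norm] at hz
    simp only [hT, if_pos (c.map_target hzt), c.right_inv hzt]
    rw [cutoffProfile_eq_one hR (by nlinarith [norm_nonneg (z - z₀)])]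
    simp
  -- The values of `θ₂` on `P` are meaningless, so `W` is set to zero there. This is the continuous
  -- extension: near `p` the cutoff is constant and `dT ∧ θ₂ = 0`, and near the other points of `P`
  -- the function `T` vanishes.
  set W : OpenPartialHomeomorph X ℂ → ℂ → ℂ := fun e z => if e.symm z ∈ P then 0 else
    wedge (localForm e (dForm T) z) (localForm e θ₂ z) with hW
  have hTm : ∀ x ∉ P, MDifferentiableAt 𝓘(ℝ, ℂ) 𝓘(ℝ, ℂ) T x := fun x hx =>
    (hTs.contMDiffAt ((isOpen_notMem_finset P).mem_nhds hx)).mdifferentiableAt (by simp)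
  have hWT : ∀ e ∈ atlas ℂ X, ∀ z ∈ e.target, e.symm z ∉ P →
      W e z = wedge (fderiv ℝ (T ∘ e.symm) z) (localForm e θ₂ z) := by
    intro e he z hz hzP
    simp only [hW, if_neg hzP]
    rw [localForm_dForm he hz (hTm _ hzP)]
  have hWK : ∀ e ∈ atlas ℂ X, ∀ z ∈ e.target, e.symm z ∉ K → W e z = 0 := by
    intro e he z hz hzK
    by_cases hzP : e.symm z ∈ P
    · simp [hW, hzP]
    · rw [hWT e he z hz hzP]
      have : (T ∘ e.symm) =ᶠ[𝓝 z] fun _ => 0 :=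
        (e.continuousAt_symm hz).eventually (hT0' _ hzK)
      rw [this.fderiv_eq]
      simp [wedge]
  have hWc : ∀ z ∈ c.target, W c z = 2 * Complex.I * ((F (c.symm z) * localForm c θ₂ z 1) *
      (deriv (cutoffProfile R) (‖z - z₀‖ ^ 2) * (z - z₀))) := by
    intro z hz
    by_cases hzK : c.symm z ∈ K
    · have hzb : z ∈ ball z₀ R := by
        obtain ⟨w, hw, hwz⟩ := hzK
        rw [← c.symm.injOn (hbt (hball hw)) hz hwz]
        exact hball hw
      by_cases hzz : z = z₀
      · rw [hzz]
        simp [hW, hcz₀, hp]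
      · have h1 := hRF z ⟨hzb, hzz⟩
        rw [hWT c hcA z hz h1.2.2, (hTc z hz).fderiv_eq,
          wedge_fderiv_cutoff_mul h1.1 (hθ₂.complexLinear c hcA z hz h1.2.2)]
        rfl
    · rw [hWK c hcA z hz hzK, deriv_cutoffProfile_of_gt hR (by
        nlinarith [hKmem z hz hzK])]
      simp
  have htrans : ∀ e ∈ atlas ℂ X, ∀ e' ∈ atlas ℂ X, ∀ z ∈ e.target, e.symm z ∈ e'.source →
      W e z = ((‖deriv (e' ∘ e.symm) z‖ ^ 2 : ℝ) : ℂ) * W e' (e' (e.symm z)) := by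
    intro e he e' he' z hz hz'
    simp only [hW, e'.left_inv hz']
    by_cases hzP : e.symm z ∈ P
    · simp [hzP]
    · rw [if_neg hzP, if_neg hzP]
      exact wedge_comp_mul _ _ _ _ _ (localForm_transition he he' hz hz' _)
        (localForm_transition he he' hz hz' _)
  have hWd : IsDensity W := by
    refine ⟨fun e he z hz => ContinuousAt.continuousWithinAt ?_, htrans⟩
    by_cases hzP : e.symm z ∈ P
    · suffices h : W e =ᶠ[𝓝 z] fun _ => 0 from continuousAt_const.congr h.symm
      by_cases hzp : e.symm z = p
      · have hzs : e.symm z ∈ c.source := by rw [hzp]; exact mem_chart_source ℂ p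
        have hcont : ContinuousAt (fun w => c (e.symm w)) z :=
          (c.continuousAt hzs).comp (e.continuousAt_symm hz)
        have hnear : ∀ᶠ w in 𝓝 z, c (e.symm w) ∈ ball z₀ (R / 2) := by
          refine hcont.eventually (isOpen_ball.mem_nhds ?_)
          change c (e.symm z) ∈ _
          rw [hzp]
          exact mem_ball_self (by linarith)
        filter_upwards [hnear, (isOpen_chart_preimage e c.open_source).mem_nhds ⟨hz, hzs⟩]
          with w hw hw'
        rw [htrans e he c hcA w hw'.1 hw'.2, hWc _ (c.map_source hw'.2),
          deriv_cutoffProfile_of_lt hR (by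
            rw [mem_ball, dist_eq_norm] at hw
            nlinarith [norm_nonneg (c (e.symm w) - z₀)])]
        simp
      · filter_upwards [(isOpen_chart_preimage e hKc.isClosed.isOpen_compl).mem_nhds
          ⟨hz, hKP _ hzP hzp⟩] with w hw
        exact hWK e he w hw.1 hw.2
    · have ho := (isOpen_chart_preimage e (isOpen_notMem_finset P)).mem_nhds ⟨hz, hzP⟩
      have h1 := continuousOn_wedge
        (contDiffOn_localForm_dForm he (isOpen_notMem_finset P) hTs).continuousOn
        (hθ₂.contDiffOn he).continuousOn
      refine (h1.continuousAt ho).congr ?_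
      filter_upwards [ho] with w hw
      exact (if_neg hw.2).symm
  refine ⟨T, hTs, fun q hq hqp => hT0' q (hKP q hq hqp),
    eventually_nhdsNE_iff_ball.2 ⟨R / 2, by linarith, fun z hz => hTF z hz.1⟩, W, hWd, hWT, ?_⟩
  have hfd : DifferentiableOn ℂ (fun z => F (c.symm z) * localForm c θ₂ z 1)
      (ball z₀ R \ {z₀}) := by
    refine DifferentiableOn.mul
      (fun z hz => (hRF z hz).1.differentiableAt.differentiableWithinAt)
      ((hθ₂.differentiableOn c hcA).mono fun z hz => (hRF z hz).2)
  rw [densityIntegral_eq_setIntegral hWd hcA hKc hKs hWK,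
    setIntegral_congr_fun c.open_target.measurableSet hWc,
    setIntegral_eq_integral_of_forall_compl_eq_zero, integral_const_mul,
    integral_radial_eq_residue hR hfd]
  · ring
  · intro z hz
    have : R ≤ ‖z - z₀‖ := by
      by_contra h
      exact hz (hbt (by rw [mem_ball, dist_eq_norm]; exact not_le.1 h))
    rw [deriv_cutoffProfile_of_gt hR (by nlinarith)]
    simp

end Reciprocity

/-! ### The reciprocity law -/

section ReciprocityLaw

variable {X : Type*} [TopologicalSpace X] [ChartedSpace ℂ X] [IsManifold 𝓘(ℂ, ℂ) ω X]

theorem isSmoothSForm_dForm {f : X → ℂ} (hf : ContMDiff 𝓘(ℝ, ℂ) 𝓘(ℝ, ℂ) ∞ f) :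
    IsSmoothSForm (dForm f) := by
  intro e he
  simpa only [mem_univ, and_true, Set.ofPred_mem_eq] using
    contDiffOn_localForm_dForm he isOpen_univ hf.contMDiffOn

theorem contDiffAt_comp_symm [T1Space X] {P : Finset X} {e : OpenPartialHomeomorph X ℂ}
    (he : e ∈ atlas ℂ X)
    {f : X → ℂ} (hf : ContMDiffOn 𝓘(ℝ, ℂ) 𝓘(ℝ, ℂ) ∞ f {x | x ∉ P}) {z : ℂ} (hz : z ∈ e.target)
    (hP : e.symm z ∉ P) : ContDiffAt ℝ ∞ (f ∘ e.symm) z :=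
  (contDiffOn_comp_symm he hf).contDiffAt
    ((isOpen_chart_preimage e (isOpen_notMem_finset P)).mem_nhds ⟨hz, hP⟩)

variable [T2Space X] [CompactSpace X]

/-- The reciprocity law: if smooth forms `α` (closed) and `κ` differ from meromorphic forms `θ₁`,
`θ₂` by exact forms off the poles, then `∫ α ∧ κ` is the sum of the residues of `F θ₂`, where `F` is
a local primitive of `θ₁`. -/
theorem densityIntegral_wedge_eq_sum_residue (P : Finset X) {α κ θ₁ θ₂ : SForm X} {γ δ : X → ℂ}
    (hα : IsSmoothSForm α) (hκ : IsSmoothSForm κ)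
    (hcl : ∀ e ∈ atlas ℂ X, ∀ z ∈ e.target, curl (localForm e α) z = 0)
    (hθ₁ : IsHolomorphicOff P θ₁) (hθ₂ : IsHolomorphicOff P θ₂)
    (hγ : ContMDiffOn 𝓘(ℝ, ℂ) 𝓘(ℝ, ℂ) ∞ γ {x | x ∉ P})
    (hδ : ContMDiffOn 𝓘(ℝ, ℂ) 𝓘(ℝ, ℂ) ∞ δ {x | x ∉ P})
    (hαγ : ∀ e ∈ atlas ℂ X, ∀ z ∈ e.target, e.symm z ∉ P →
      localForm e α z = localForm e θ₁ z + fderiv ℝ (γ ∘ e.symm) z)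
    (hκδ : ∀ e ∈ atlas ℂ X, ∀ z ∈ e.target, e.symm z ∉ P →
      localForm e κ z = localForm e θ₂ z + fderiv ℝ (δ ∘ e.symm) z)
    (F : X → X → ℂ) (hF : ∀ p ∈ P, ∀ᶠ z in 𝓝[≠] (chartAt ℂ p p),
      HasDerivAt (F p ∘ (chartAt ℂ p).symm) (localForm (chartAt ℂ p) θ₁ z 1) z) :
    densityIntegral (fun e z => wedge (localForm e α z) (localForm e κ z)) =
      2 * Real.pi * Complex.I * ∑ p ∈ P, residue (fun z =>
          F p ((chartAt ℂ p).symm z) * localForm (chartAt ℂ p) θ₂ z 1) (chartAt ℂ p p) := by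
  have hex := fun p (hp : p ∈ P) => exists_cutoff_primitive P hp hθ₂ (hF p hp)
  choose! T hTs hT0 hTF W hWd hWT hWI using hex
  have hoff : ∀ (e : OpenPartialHomeomorph X ℂ) (z : ℂ), z ∈ e.target → e.symm z ∉ P →
      ∀ᶠ w in 𝓝 z, w ∈ e.target ∧ e.symm w ∉ P := fun e z hz hP =>
    (isOpen_chart_preimage e (isOpen_notMem_finset P)).mem_nhds ⟨hz, hP⟩
  have hTsum : ContMDiffOn 𝓘(ℝ, ℂ) 𝓘(ℝ, ℂ) ∞ (fun x => γ x + ∑ p ∈ P, T p x) {x | x ∉ P} :=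
    hγ.add (contMDiffOn_finsetSum fun p hp => hTs p hp)
  have hcdγ := fun e he z hz hP => (contDiffAt_comp_symm (P := P) (e := e) he hγ (z := z) hz hP)
  have hcdT := fun p hp e he z hz hP =>
    (contDiffAt_comp_symm (P := P) (e := e) he (hTs p hp) (z := z) hz hP)
  have hfsum : ∀ e ∈ atlas ℂ X, ∀ z ∈ e.target, e.symm z ∉ P →
      HasFDerivAt ((fun x => γ x + ∑ p ∈ P, T p x) ∘ e.symm)
        (fderiv ℝ (γ ∘ e.symm) z + ∑ p ∈ P, fderiv ℝ (T p ∘ e.symm) z) z := by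
    intro e he z hz hP
    exact ((hcdγ e he z hz hP).differentiableAt (by simp)).hasFDerivAt.add
      (HasFDerivAt.fun_sum fun p hp =>
        ((hcdT p hp e he z hz hP).differentiableAt (by simp)).hasFDerivAt)
  -- Near `p` only `T p = F p` survives in the sum, and `dγ + dF_p = dγ + θ₁ = α`.
  have hnear : ∀ p ∈ P, ∀ᶠ z in 𝓝[≠] (chartAt ℂ p p),
      HasFDerivAt ((fun x => γ x + ∑ q ∈ P, T q x) ∘ (chartAt ℂ p).symm)
        (localForm (chartAt ℂ p) α z) z := by
    intro p hp
    have hc := chart_mem_atlas ℂ p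
    have hz₀ := mem_chart_target ℂ p
    have hq : ∀ᶠ z in 𝓝[≠] (chartAt ℂ p p), ∀ q ∈ P, q ≠ p →
        fderiv ℝ (T q ∘ (chartAt ℂ p).symm) z = 0 := by
      apply Filter.Eventually.filter_mono nhdsWithin_le_nhds
      rw [Filter.eventually_all_finset]
      intro q hq
      by_cases hqp : q = p
      · exact Eventually.of_forall fun z h => absurd hqp h
      · have h1 := hT0 q hq p hp (Ne.symm hqp)
        have h2 : ContinuousAt (chartAt ℂ p).symm (chartAt ℂ p p) :=
          (chartAt ℂ p).continuousAt_symm hz₀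
        rw [ContinuousAt, (chartAt ℂ p).left_inv (mem_chart_source ℂ p)] at h2
        filter_upwards [(h2.eventually h1).eventually_nhds] with z hz _
        have : (T q ∘ (chartAt ℂ p).symm) =ᶠ[𝓝 z] fun _ => 0 := hz
        rw [this.fderiv_eq]
        simp
    have hTp : ∀ᶠ z in 𝓝[≠] (chartAt ℂ p p), (T p ∘ (chartAt ℂ p).symm) =ᶠ[𝓝 z]
        (F p ∘ (chartAt ℂ p).symm) := by
      obtain ⟨R, hR, h⟩ := eventually_nhdsNE_iff_ball.1 (hTF p hp)
      refine eventually_nhdsNE_iff_ball.2 ⟨R, hR, fun z hz => ?_⟩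
      filter_upwards [(isOpen_ball_diff_singleton _ R).mem_nhds hz] with w hw
      exact h w hw
    filter_upwards [hq, hTp, hF p hp, eventually_symm_notMem P _ hz₀] with z h1 h2 h3 h4
    have h := hfsum _ hc z h4.1 h4.2
    rw [Finset.sum_eq_single_of_mem p hp fun q hq hqp => h1 q hq hqp, h2.fderiv_eq,
      (h3.hasFDerivAt.restrictScalars ℝ).fderiv] at h
    convert! h using 1
    rw [hαγ _ hc z h4.1 h4.2, add_comm]
    congr 1
    ext1 u
    rw [hθ₁.complexLinear _ hc z h4.1 h4.2]
    rfl
  obtain ⟨Γ, hΓ, hΓeq⟩ := exists_smooth_extension P hTsum hα hcl hnear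
  have hΓloc : ∀ e ∈ atlas ℂ X, ∀ z ∈ e.target, e.symm z ∉ P →
      (Γ ∘ e.symm) =ᶠ[𝓝 z] ((fun x => γ x + ∑ p ∈ P, T p x) ∘ e.symm) := by
    intro e he z hz hP
    filter_upwards [hoff e z hz hP] with w hw
    exact hΓeq _ hw.2
  have hΓd : ∀ e ∈ atlas ℂ X, ∀ z ∈ e.target,
      localForm e (dForm Γ) z = fderiv ℝ (Γ ∘ e.symm) z := fun e he z hz =>
    localForm_dForm he hz ((hΓ _).mdifferentiableAt (by simp))
  have hΓoff : ∀ e ∈ atlas ℂ X, ∀ z ∈ e.target, e.symm z ∉ P → localForm e (dForm Γ) z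
      = fderiv ℝ (γ ∘ e.symm) z + ∑ p ∈ P, fderiv ℝ (T p ∘ e.symm) z := by
    intro e he z hz hP
    rw [hΓd e he z hz, (hΓloc e he z hz hP).fderiv_eq, (hfsum e he z hz hP).fderiv]
  have hdΓ := isSmoothSForm_dForm hΓ
  set β : SForm X := fun x => α x - dForm Γ x with hβ
  have hβs : IsSmoothSForm β := fun e he => (hα e he).sub (hdΓ e he)
  -- Off `p` this is `hnear`; at `p` itself it follows from continuity of `β`.
  have hβ0 : ∀ p ∈ P, ∀ᶠ z in 𝓝 (chartAt ℂ p p), localForm (chartAt ℂ p) β z = 0 := by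
    intro p hp
    have hc := chart_mem_atlas ℂ p
    have hz₀ := mem_chart_target ℂ p
    have h1 : ∀ᶠ z in 𝓝[≠] (chartAt ℂ p p), localForm (chartAt ℂ p) β z = 0 := by
      filter_upwards [hnear p hp, eventually_symm_notMem P _ hz₀] with z h1 h4
      rw [hβ, localForm_sub, hΓd _ hc z h4.1, (hΓloc _ hc z h4.1 h4.2).fderiv_eq, h1.fderiv,
        sub_self]
    have h0 : localForm (chartAt ℂ p) β (chartAt ℂ p p) = 0 := by
      have hcont := ((hβs _ hc).continuousOn.continuousAt
        ((chartAt ℂ p).open_target.mem_nhds hz₀)).tendsto.mono_left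
        (nhdsWithin_le_nhds (s := {chartAt ℂ p p}ᶜ))
      exact tendsto_nhds_unique_of_eventuallyEq hcont tendsto_const_nhds h1
    rw [eventually_nhdsWithin_iff] at h1
    filter_upwards [h1] with z hz
    by_cases h : z = chartAt ℂ p p
    · rw [h, h0]
    · exact hz h
  have hβ0' : ∀ e ∈ atlas ℂ X, ∀ z ∈ e.target, e.symm z ∈ P →
      ∀ᶠ w in 𝓝 z, localForm e β w = 0 := by
    intro e he z hz hP
    have hzs := mem_chart_source ℂ (e.symm z)
    have hcont : ContinuousAt (fun w => chartAt ℂ (e.symm z) (e.symm w)) z :=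
      ((chartAt ℂ (e.symm z)).continuousAt hzs).comp (e.continuousAt_symm hz)
    filter_upwards [hcont.eventually (hβ0 _ hP),
      (isOpen_chart_preimage e (chartAt ℂ (e.symm z)).open_source).mem_nhds ⟨hz, hzs⟩] with w h1 h2
    ext1 u
    rw [localForm_transition he (chart_mem_atlas ℂ (e.symm z)) h2.1 h2.2, h1]
    rfl
  -- The function `δ` may be singular at the poles, but `β` vanishes in a neighbourhood of each of
  -- them.
  have hδβ : IsSmoothSForm fun x => δ x • β x := by
    intro e he z hz
    apply ContDiffAt.contDiffWithinAt
    by_cases hP : e.symm z ∈ P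
    · refine (contDiffAt_const (c := (0 : ℂ →L[ℝ] ℂ))).congr_of_eventuallyEq ?_
      filter_upwards [hβ0' e he z hz hP] with w hw
      rw [localForm_smul, hw]
      exact smul_zero (A := ℂ →L[ℝ] ℂ) (δ (e.symm w))
    · exact (contDiffAt_comp_symm he hδ hz hP).smul
        ((hβs e he).contDiffAt (e.open_target.mem_nhds hz))
  have hΓκ : IsSmoothSForm fun x => Γ x • κ x := hκ.smul hΓ
  have hdens1 := isDensity_curl hΓκ
  have hdens2 := (isDensity_curl hδβ).const_mul (-1)
  have hdens3 := (IsDensity.sum P hWd).const_mul (-1)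
  -- This is `α ∧ κ = d(Γ κ) - d(δ β) - ∑ dT_p ∧ θ₂`. Both sides are continuous, so it suffices to
  -- check it off the poles, where `β = θ₁ - ∑ dT_p` and `θ₁ ∧ θ₂ = 0`.
  have hmain : ∀ e ∈ atlas ℂ X, ∀ z ∈ e.target, wedge (localForm e α z) (localForm e κ z)
      = curl (localForm e fun x => Γ x • κ x) z + -1 * curl (localForm e fun x => δ x • β x) z
        + -1 * ∑ p ∈ P, W p e z := by
    intro e he
    refine eqOn_target_of_eqOn_off P e
      (continuousOn_wedge (hα e he).continuousOn (hκ e he).continuousOn)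
      (((hdens1.add hdens2).add hdens3).continuousOn e he) ?_
    intro z hz hP
    have hdiff : ∀ {ξ : SForm X}, IsSmoothSForm ξ → DifferentiableAt ℝ (localForm e ξ) z :=
      fun hξ => ((hξ e he).differentiableOn (by simp)).differentiableAt (e.open_target.mem_nhds hz)
    have hΓdiff : DifferentiableAt ℝ (Γ ∘ e.symm) z :=
      (contDiffAt_comp_symm (P := P) he hΓ.contMDiffOn hz hP).differentiableAt (by simp)
    have hδc := contDiffAt_comp_symm he hδ hz hP
    have hκcl : curl (localForm e κ) z = 0 := by
      have hev : localForm e κ =ᶠ[𝓝 z]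
          fun w => localForm e θ₂ w + fderiv ℝ (δ ∘ e.symm) w := by
        filter_upwards [hoff e z hz hP] with w hw
        exact hκδ e he w hw.1 hw.2
      rw [curl_congr hev, curl_add, hθ₂.curl_eq_zero he hz hP, curl_fderiv hδc, add_zero]
      · exact ((hθ₂.contDiffOn he).contDiffAt (hoff e z hz hP)).differentiableAt (by simp)
      · exact (hδc.fderiv_right (m := ∞) (by simp)).differentiableAt (by simp)
    have hdΓcl : curl (localForm e (dForm Γ)) z = 0 := by
      have hev : localForm e (dForm Γ) =ᶠ[𝓝 z] fderiv ℝ (Γ ∘ e.symm) := by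
        filter_upwards [e.open_target.mem_nhds hz] with w hw
        exact hΓd e he w hw
      rw [curl_congr hev, curl_fderiv (contDiffAt_comp_symm (P := P) he hΓ.contMDiffOn hz hP)]
    have hβcl : curl (localForm e β) z = 0 := by
      have := curl_sub (hdiff hα) (hdiff hdΓ)
      rw [hcl e he z hz, hdΓcl, sub_zero] at this
      exact this
    have e1 : curl (localForm e fun x => Γ x • κ x) z
        = wedge (localForm e (dForm Γ) z) (localForm e κ z) := by
      have := curl_smul hΓdiff (hdiff hκ)
      rw [hκcl, mul_zero, add_zero, ← hΓd e he z hz] at this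
      exact this
    have e2 : curl (localForm e fun x => δ x • β x) z
        = wedge (fderiv ℝ (δ ∘ e.symm) z) (localForm e β z) := by
      have := curl_smul (hδc.differentiableAt (by simp)) (hdiff hβs)
      rw [hβcl, mul_zero, add_zero] at this
      exact this
    have e3 : ∑ p ∈ P, W p e z
        = wedge (∑ p ∈ P, fderiv ℝ (T p ∘ e.symm) z) (localForm e θ₂ z) := by
      rw [wedge_sum_left]
      exact Finset.sum_congr rfl fun p hp => hWT p hp e he z hz hP
    have e4 : localForm e β z = localForm e α z - localForm e (dForm Γ) z := rfl
    have e5 := wedge_eq_zero_of_complexLinear (hθ₁.complexLinear e he z hz hP)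
      (hθ₂.complexLinear e he z hz hP)
    rw [e1, e2, e3, e4, hΓoff e he z hz hP, hαγ e he z hz hP, hκδ e he z hz hP]
    simp only [wedge, add_apply, sub_apply] at e5 ⊢
    linear_combination e5
  rw [densityIntegral_congr hmain, densityIntegral_add (hdens1.add hdens2) hdens3,
    densityIntegral_add hdens1 hdens2, densityIntegral_const_mul, densityIntegral_const_mul,
    densityIntegral_curl_eq_zero hΓκ, densityIntegral_curl_eq_zero hδβ,
    densityIntegral_sum P hWd, Finset.sum_congr rfl fun p hp => hWI p hp, Finset.sum_neg_distrib,
    ← Finset.mul_sum]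
  ring

end ReciprocityLaw

/-! ### Second order expansions at `τ = 0` -/

section Jets

/-- `f τ = a + b τ + c τ² / 2 + o(τ²)` as `τ → 0`. -/
def HasJet (f : ℝ → ℂ) (a b c : ℂ) : Prop :=
  (fun τ : ℝ => f τ - (a + τ * b + τ ^ 2 / 2 * c)) =o[𝓝 0] fun τ : ℝ => τ ^ 2

theorem HasJet.tendsto {f : ℝ → ℂ} {a b c : ℂ} (h : HasJet f a b c) :
    Tendsto f (𝓝 0) (𝓝 a) := by
  have h1 : Tendsto (fun τ : ℝ => f τ - (a + τ * b + τ ^ 2 / 2 * c)) (𝓝 0) (𝓝 0) := by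
    refine h.trans_tendsto ?_
    have : Continuous fun τ : ℝ => τ ^ 2 := by fun_prop
    simpa using this.tendsto 0
  have h2 : Tendsto (fun τ : ℝ => (a + τ * b + τ ^ 2 / 2 * c : ℂ)) (𝓝 0) (𝓝 a) := by
    have : Continuous fun τ : ℝ => (a + τ * b + τ ^ 2 / 2 * c : ℂ) := by fun_prop
    simpa using this.tendsto 0
  simpa using h1.add h2

theorem HasJet.congr {f g : ℝ → ℂ} {a b c : ℂ} (h : HasJet f a b c) (hfg : f =ᶠ[𝓝 0] g) :
    HasJet g a b c := by
  refine IsLittleO.congr' h ?_ EventuallyEq.rfl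
  filter_upwards [hfg] with τ hτ
  rw [hτ]

theorem HasJet.add {f g : ℝ → ℂ} {a b c a' b' c' : ℂ} (hf : HasJet f a b c)
    (hg : HasJet g a' b' c') : HasJet (fun τ => f τ + g τ) (a + a') (b + b') (c + c') := by
  refine (IsLittleO.add hf hg).congr_left fun τ => ?_
  ring

/-- The error splits as (error of `f`) times the bounded `g`, plus the bounded polynomial of `f`
times (error of `g`), plus the terms of degree at least three in the product of the polynomials. -/
theorem HasJet.mul {f g : ℝ → ℂ} {a b c a' b' c' : ℂ} (hf : HasJet f a b c)
    (hg : HasJet g a' b' c') :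
    HasJet (fun τ => f τ * g τ) (a * a') (a * b' + b * a') (a * c' + 2 * b * b' + c * a') := by
  have hgO : g =O[𝓝 0] fun _ => (1 : ℝ) := hg.tendsto.isBigO_one ℝ
  have hpO : (fun τ : ℝ => (a + τ * b + τ ^ 2 / 2 * c : ℂ)) =O[𝓝 0] fun _ => (1 : ℝ) := by
    have : Continuous fun τ : ℝ => (a + τ * b + τ ^ 2 / 2 * c : ℂ) := by fun_prop
    exact (this.tendsto 0).isBigO_one ℝ
  have h1 := IsLittleO.mul_isBigO hf hgO
  have h2 := IsBigO.mul_isLittleO hpO hg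
  have h3 : (fun τ : ℝ => ((τ ^ 2 : ℝ) : ℂ) * (τ * (b * c' / 2 + c * b' / 2 + τ * (c * c' / 4))))
      =o[𝓝 0] fun τ : ℝ => τ ^ 2 * 1 := by
    refine IsBigO.mul_isLittleO (isBigO_of_le _ fun τ => by simp) ?_
    rw [isLittleO_one_iff]
    have : Continuous fun τ : ℝ => (τ * (b * c' / 2 + c * b' / 2 + τ * (c * c' / 4)) : ℂ) := by
      fun_prop
    simpa using this.tendsto 0
  simp only [mul_one, one_mul] at h1 h2 h3
  refine ((h1.add h2).add h3).congr_left fun τ => ?_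
  push_cast
  ring

/-- The expansion of `η` is only a pointwise asymptotic statement, so the equations for `D'` and
`D''` are obtained by comparing jets instead of differentiating `η`. -/
theorem HasJet.unique {f : ℝ → ℂ} {a b c a' b' c' : ℂ} (h : HasJet f a b c)
    (h' : HasJet f a' b' c') : a = a' ∧ b = b' ∧ c = c' := by
  have ha : a = a' := tendsto_nhds_unique h.tendsto h'.tendsto
  subst ha
  have h0 : (fun τ : ℝ => (τ * (b - b') + τ ^ 2 / 2 * (c - c') : ℂ)) =o[𝓝 0]
      fun τ : ℝ => τ ^ 2 := by
    refine (IsLittleO.sub h' h).congr_left fun τ => ?_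
    ring
  have hne : ∀ᶠ τ : ℝ in 𝓝[≠] 0, τ ≠ 0 := eventually_mem_nhdsWithin
  have key : ∀ u : ℝ → ℂ, (fun τ : ℝ => ((τ ^ 2 : ℝ) : ℂ) * u τ) =o[𝓝 0]
      (fun τ : ℝ => τ ^ 2) → Tendsto u (𝓝[≠] 0) (𝓝 0) := by
    intro u hu
    have h1 := (hu.mono nhdsWithin_le_nhds (l := 𝓝[≠] 0))
    rw [← isLittleO_one_iff ℝ]
    have hO : (fun τ : ℝ => (((τ ^ 2 : ℝ) : ℂ))⁻¹) =O[𝓝[≠] 0] fun τ : ℝ => (τ ^ 2)⁻¹ :=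
      isBigO_of_le _ fun τ => by simp
    have h2 := hO.mul_isLittleO h1
    refine (h2.congr' ?_ EventuallyEq.rfl).trans_isBigO ?_
    · filter_upwards [hne] with τ hτ
      have : ((τ ^ 2 : ℝ) : ℂ) ≠ 0 := by exact_mod_cast pow_ne_zero 2 hτ
      field_simp
    · refine IsBigO.of_bound 1 ?_
      filter_upwards [hne] with τ hτ
      have : |τ| ^ 2 ≠ 0 := by positivity
      simp
      rw [← sq_abs, inv_mul_cancel₀ this]
  have hb : b = b' := by
    -- Here `h0` is divided by `τ²`; multiplying the result by `τ` then isolates `b - b'` in the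
    -- limit.
    have h1 := key (fun τ => (τ : ℂ)⁻¹ * (b - b') + (c - c') / 2) (by
      refine h0.congr_left fun τ => ?_
      by_cases hτ : (τ : ℂ) = 0
      · simp [hτ]
      · push_cast; field_simp)
    have h2 : Tendsto (fun τ : ℝ => (τ : ℂ) * ((τ : ℂ)⁻¹ * (b - b') + (c - c') / 2)) (𝓝[≠] 0)
        (𝓝 (0 * 0)) := by
      refine Tendsto.mul ?_ h1
      exact (by simpa using Complex.continuous_ofReal.tendsto 0 :
        Tendsto (fun τ : ℝ => (τ : ℂ)) (𝓝 0) (𝓝 0)).mono_left nhdsWithin_le_nhds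
    have h3 : Tendsto (fun τ : ℝ => (b - b') + τ * ((c - c') / 2)) (𝓝[≠] 0) (𝓝 (b - b')) := by
      have : Continuous fun τ : ℝ => ((b - b') + τ * ((c - c') / 2) : ℂ) := by fun_prop
      have h := this.tendsto 0
      simp only [Complex.ofReal_zero, zero_mul, add_zero] at h
      exact h.mono_left nhdsWithin_le_nhds
    have h4 := tendsto_nhds_unique_of_eventuallyEq h3 h2 (by
      filter_upwards [hne] with τ hτ
      have : (τ : ℂ) ≠ 0 := by exact_mod_cast hτ
      field_simp)
    rw [zero_mul] at h4
    exact sub_eq_zero.1 h4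
  refine ⟨rfl, hb, ?_⟩
  have h1 := key (fun _ => (c - c') / 2) (by
    refine h0.congr_left fun τ => ?_
    rw [hb]; push_cast; ring)
  have h2 := tendsto_nhds_unique h1 tendsto_const_nhds
  have : c - c' = 0 := by linear_combination -2 * h2
  exact sub_eq_zero.1 this

theorem hasJet_of_contDiffOn {f : ℝ → ℂ} {ε : ℝ} (hε : 0 < ε)
    (hf : ContDiffOn ℝ ∞ f (Ioo (-ε) ε)) :
    HasJet f (f 0) (deriv f 0) (iteratedDeriv 2 f 0) := by
  have h0 : (0 : ℝ) ∈ Ioo (-ε) ε := ⟨by linarith, hε⟩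
  have h := taylor_isLittleO (convex_Ioo (-ε) ε) h0
    (hf.of_le (m := (2 : ℕ)) (WithTop.coe_le_coe.2 (le_top : ((2 : ℕ) : ℕ∞) ≤ ⊤)))
  rw [nhdsWithin_eq_nhds.2 (Ioo_mem_nhds h0.1 h0.2)] at h
  have h1 : ∀ n, iteratedDerivWithin n f (Ioo (-ε) ε) 0 = iteratedDeriv n f 0 := fun n =>
    iteratedDerivWithin_of_isOpen isOpen_Ioo h0
  refine h.congr (fun τ => ?_) fun τ => by simp
  rw [taylorWithinEval_succ, taylorWithinEval_succ, taylor_within_zero_eval, h1, h1]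
  simp [iteratedDeriv_one]
  ring_nf
  simp

end Jets

/-! ### Smooth families depending on a real parameter -/

section Families

variable {E : Type*} [NormedAddCommGroup E] [NormedSpace ℝ E]

/-- The partial derivative in the first variable. -/
def partialFst (u : ℝ × ℂ → E) (q : ℝ × ℂ) : E := fderiv ℝ u q (1, 0)

variable {u : ℝ × ℂ → E} {S : Set (ℝ × ℂ)}

theorem contDiffOn_partialFst (hS : IsOpen S) (hu : ContDiffOn ℝ ∞ u S) :
    ContDiffOn ℝ ∞ (partialFst u) S :=
  (hu.fderiv_of_isOpen hS (by simp)).clm_apply contDiffOn_const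

theorem hasFDerivAt_of_contDiffOn (hS : IsOpen S) (hu : ContDiffOn ℝ ∞ u S) {q : ℝ × ℂ}
    (hq : q ∈ S) : HasFDerivAt u (fderiv ℝ u q) q :=
  ((hu.differentiableOn (by simp)).differentiableAt (hS.mem_nhds hq)).hasFDerivAt

theorem hasDerivAt_partialFst (hS : IsOpen S) (hu : ContDiffOn ℝ ∞ u S) {τ : ℝ} {z : ℂ}
    (hq : (τ, z) ∈ S) : HasDerivAt (fun s => u (s, z)) (partialFst u (τ, z)) τ :=
  (hasFDerivAt_of_contDiffOn hS hu hq).comp_hasDerivAt τ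
    ((hasDerivAt_id τ).prodMk (hasDerivAt_const τ z))

theorem hasFDerivAt_slice (hS : IsOpen S) (hu : ContDiffOn ℝ ∞ u S) {τ : ℝ} {z : ℂ}
    (hq : (τ, z) ∈ S) : HasFDerivAt (fun w => u (τ, w))
      ((fderiv ℝ u (τ, z)).comp (ContinuousLinearMap.inr ℝ ℝ ℂ)) z :=
  (hasFDerivAt_of_contDiffOn hS hu hq).comp z
    ((hasFDerivAt_const τ z).prodMk (hasFDerivAt_id z))

/-- Symmetry of the second derivative on the product: the parameter derivative commutes with the
spatial differential. Hence the jet of `dg` consists of the differentials of the derivatives of `g`.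
-/
theorem hasDerivAt_fderiv_slice (hS : IsOpen S) (hu : ContDiffOn ℝ ∞ u S) {τ : ℝ} {z : ℂ}
    (hq : (τ, z) ∈ S) (v : ℂ) : HasDerivAt (fun s => fderiv ℝ (fun w => u (s, w)) z v)
      (fderiv ℝ (fun w => partialFst u (τ, w)) z v) τ := by
  have hf : ContDiffOn ℝ ∞ (fderiv ℝ u) S := hu.fderiv_of_isOpen hS (by simp)
  have h1 := hasFDerivAt_of_contDiffOn hS hf hq
  have h2 : HasDerivAt (fun s => fderiv ℝ u (s, z) (0, v))
      (fderiv ℝ (fderiv ℝ u) (τ, z) (1, 0) (0, v)) τ := by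
    have := (h1.clm_apply (hasFDerivAt_const ((0, v) : ℝ × ℂ) (τ, z))).comp_hasDerivAt τ
      ((hasDerivAt_id τ).prodMk (hasDerivAt_const τ z))
    simpa using! this
  have h3 : fderiv ℝ (fun w => partialFst u (τ, w)) z v
      = fderiv ℝ (fderiv ℝ u) (τ, z) (0, v) (1, 0) := by
    have := (h1.clm_apply (hasFDerivAt_const ((1, 0) : ℝ × ℂ) (τ, z))).comp z
      ((hasFDerivAt_const τ z).prodMk (hasFDerivAt_id z))
    have h4 := this.fderiv
    change fderiv ℝ (fun w => partialFst u (τ, w)) z = _ at h4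
    rw [h4]
    simp
  have hsymm := ((hu.contDiffAt (hS.mem_nhds hq)).isSymmSndFDerivAt (by
    simpa using (WithTop.coe_le_coe.2 (le_top : (2 : ℕ∞) ≤ ⊤)))).eq (1, 0) (0, v)
  rw [h3, ← hsymm]
  refine h2.congr_of_eventuallyEq ?_
  have hcont : ContinuousAt (fun s : ℝ => (s, z)) τ := by fun_prop
  filter_upwards [hcont.preimage_mem_nhds (hS.mem_nhds hq)] with s hs
  rw [(hasFDerivAt_slice hS hu hs).fderiv]
  simp

theorem iteratedDeriv_two_eq (f : ℝ → E) (x : ℝ) : iteratedDeriv 2 f x = deriv (deriv f) x := by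
  rw [iteratedDeriv_succ, iteratedDeriv_one]

variable {ε : ℝ} {V : Set ℂ}

theorem deriv_eq_partialFst (hε : 0 < ε) (hV : IsOpen V)
    (hu : ContDiffOn ℝ ∞ u (Ioo (-ε) ε ×ˢ V)) {z : ℂ} (hz : z ∈ V) :
    deriv (fun s => u (s, z)) 0 = partialFst u (0, z) :=
  (hasDerivAt_partialFst (isOpen_Ioo.prod hV) hu ⟨⟨by linarith, hε⟩, hz⟩).deriv

theorem iteratedDeriv_two_eq_partialFst (hε : 0 < ε) (hV : IsOpen V)
    (hu : ContDiffOn ℝ ∞ u (Ioo (-ε) ε ×ˢ V)) {z : ℂ} (hz : z ∈ V) :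
    iteratedDeriv 2 (fun s => u (s, z)) 0 = partialFst (partialFst u) (0, z) := by
  have ho := isOpen_Ioo.prod hV (s := Ioo (-ε) ε)
  rw [iteratedDeriv_two_eq]
  have hev : deriv (fun s => u (s, z)) =ᶠ[𝓝 0] fun s => partialFst u (s, z) := by
    filter_upwards [Ioo_mem_nhds (neg_lt_zero.2 hε) hε] with s hs
    exact (hasDerivAt_partialFst ho hu ⟨hs, hz⟩).deriv
  rw [hev.deriv_eq]
  exact deriv_eq_partialFst hε hV (contDiffOn_partialFst ho hu) hz

theorem contDiffOn_slice_fst (hu : ContDiffOn ℝ ∞ u (Ioo (-ε) ε ×ˢ V)) {z : ℂ} (hz : z ∈ V) :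
    ContDiffOn ℝ ∞ (fun s => u (s, z)) (Ioo (-ε) ε) :=
  hu.comp (contDiff_id.prodMk contDiff_const).contDiffOn fun _ hs => ⟨hs, hz⟩

theorem contDiffOn_slice_snd {τ : ℝ} (hτ : τ ∈ Ioo (-ε) ε)
    (hu : ContDiffOn ℝ ∞ u (Ioo (-ε) ε ×ˢ V)) : ContDiffOn ℝ ∞ (fun w => u (τ, w)) V :=
  hu.comp (contDiff_const.prodMk contDiff_id).contDiffOn fun _ hw => ⟨hτ, hw⟩

theorem hasJet_fderiv_slice {u : ℝ × ℂ → ℂ} (hε : 0 < ε) (hV : IsOpen V)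
    (hu : ContDiffOn ℝ ∞ u (Ioo (-ε) ε ×ˢ V)) {z : ℂ} (hz : z ∈ V) (v : ℂ) :
    HasJet (fun s => fderiv ℝ (fun w => u (s, w)) z v) (fderiv ℝ (fun w => u (0, w)) z v)
      (fderiv ℝ (fun w => partialFst u (0, w)) z v)
      (fderiv ℝ (fun w => partialFst (partialFst u) (0, w)) z v) := by
  have ho := isOpen_Ioo.prod hV (s := Ioo (-ε) ε)
  have hsm : ContDiffOn ℝ ∞ (fun s => fderiv ℝ (fun w => u (s, w)) z v) (Ioo (-ε) ε) := by
    have h1 : ContDiffOn ℝ ∞ (fun q => fderiv ℝ u q (0, v)) (Ioo (-ε) ε ×ˢ V) :=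
      (hu.fderiv_of_isOpen ho (by simp)).clm_apply contDiffOn_const
    refine (contDiffOn_slice_fst h1 hz).congr fun s hs => ?_
    rw [(hasFDerivAt_slice ho hu ⟨hs, hz⟩).fderiv]
    simp
  have hj := hasJet_of_contDiffOn hε hsm
  have h0 : (0 : ℝ) ∈ Ioo (-ε) ε := ⟨by linarith, hε⟩
  have hev : deriv (fun s => fderiv ℝ (fun w => u (s, w)) z v) =ᶠ[𝓝 0]
      fun s => fderiv ℝ (fun w => partialFst u (s, w)) z v := by
    filter_upwards [Ioo_mem_nhds h0.1 h0.2] with s hs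
    exact (hasDerivAt_fderiv_slice ho hu ⟨hs, hz⟩ v).deriv
  rw [iteratedDeriv_two_eq, hev.deriv_eq, hev.eq_of_nhds,
    (hasDerivAt_fderiv_slice ho (contDiffOn_partialFst ho hu) ⟨h0, hz⟩ v).deriv] at hj
  exact hj

end Families

/-! ### Derivatives of the harmonic gauge and of the gauged family -/

section Gauge

variable {X : Type*} [TopologicalSpace X] [ChartedSpace ℂ X] {η : DPWPotential X}

namespace DPWPotential.HarmonicGauge

/-- The entries of the derivative of the gauge at `τ = 0`. -/
def gDeriv (G : η.HarmonicGauge) (i j : Fin 2) (x : X) : ℂ := deriv (fun τ => G.g τ x i j) 0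

/-- The entries of the second derivative of the gauge at `τ = 0`. -/
def gDeriv₂ (G : η.HarmonicGauge) (i j : Fin 2) (x : X) : ℂ :=
  iteratedDeriv 2 (fun τ => G.g τ x i j) 0

theorem isOpen_off [T2Space X] (e : OpenPartialHomeomorph X ℂ) :
    IsOpen {z | z ∈ e.target ∧ e.symm z ∉ η.poles} :=
  isOpen_chart_preimage e (isOpen_notMem_finset η.poles)

variable (G : η.HarmonicGauge)

theorem zero_mem : (0 : ℝ) ∈ Ioo (-G.ε) G.ε := ⟨by linarith [G.ε_pos], G.ε_pos⟩

variable [IsManifold 𝓘(ℂ, ℂ) ω X]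

theorem contDiffOn_g {e : OpenPartialHomeomorph X ℂ} (he : e ∈ atlas ℂ X) (i j : Fin 2) :
    ContDiffOn ℝ ∞ (fun q : ℝ × ℂ => G.g q.1 (e.symm q.2) i j)
      (Ioo (-G.ε) G.ε ×ˢ {z | z ∈ e.target ∧ e.symm z ∉ η.poles}) := by
  rw [← contMDiffOn_iff_contDiffOn]
  have h1 : ContMDiffOn 𝓘(ℝ, ℝ × ℂ) 𝓘(ℝ, ℝ) ∞ (fun q : ℝ × ℂ => q.1)
      (Ioo (-G.ε) G.ε ×ˢ {z | z ∈ e.target ∧ e.symm z ∉ η.poles}) :=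
    contDiff_fst.contMDiff.contMDiffOn
  have h2 : ContMDiffOn 𝓘(ℝ, ℝ × ℂ) 𝓘(ℝ, ℂ) ∞ (fun q : ℝ × ℂ => e.symm q.2)
      (Ioo (-G.ε) G.ε ×ˢ {z | z ∈ e.target ∧ e.symm z ∉ η.poles}) :=
    (contMDiffOn_symm_of_mem_maximalAtlas (IsManifold.subset_maximalAtlas he)).comp
      contDiff_snd.contMDiff.contMDiffOn fun q hq => hq.2.1
  exact (G.g_smooth i j).comp (h1.prodMk h2) fun q hq => ⟨hq.1, hq.2.2⟩

theorem contMDiffOn_of_eq [T2Space X] {f : X → ℂ} {v : OpenPartialHomeomorph X ℂ → ℂ → ℂ}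
    (hv : ∀ e ∈ atlas ℂ X, ContDiffOn ℝ ∞ (v e) {z | z ∈ e.target ∧ e.symm z ∉ η.poles})
    (h : ∀ e ∈ atlas ℂ X, ∀ z ∈ e.target, e.symm z ∉ η.poles → f (e.symm z) = v e z) :
    ContMDiffOn 𝓘(ℝ, ℂ) 𝓘(ℝ, ℂ) ∞ f {x | x ∉ η.poles} := by
  intro x hx
  apply ContMDiffAt.contMDiffWithinAt
  have hc := chart_mem_atlas ℂ x
  have hxs := mem_chart_source ℂ x
  have hmem : chartAt ℂ x x ∈ {z | z ∈ (chartAt ℂ x).target ∧ (chartAt ℂ x).symm z ∉ η.poles} :=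
    ⟨mem_chart_target ℂ x, by rwa [(chartAt ℂ x).left_inv hxs]⟩
  have ho := (isOpen_chart_preimage (chartAt ℂ x) (isOpen_notMem_finset η.poles)).mem_nhds hmem
  refine contMDiffAt_of_comp_symm hc hxs (((hv _ hc).contDiffAt ho).congr_of_eventuallyEq ?_)
  filter_upwards [ho] with w hw
  exact h _ hc w hw.1 hw.2

/-- `firstDeriv` and `secondDeriv` are taken pointwise on covectors, while smoothness in `τ` is
known only in charts. At a fixed point the two descriptions differ by a linear isomorphism `L`
independent of `τ`, through which derivatives pass. -/
theorem localForm_derivs {e : OpenPartialHomeomorph X ℂ} (he : e ∈ atlas ℂ X) (i j : Fin 2) {z : ℂ}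
    (hz : z ∈ e.target) :
    localForm e (firstDeriv G.D i j) z = deriv (fun τ => localForm e (G.D τ i j) z) 0 ∧
    localForm e (secondDeriv G.D i j) z
      = iteratedDeriv 2 (fun τ => localForm e (G.D τ i j) z) 0 := by
  obtain ⟨L, hL⟩ := exists_localForm_apply he hz
  set h : ℝ → ℂ →L[ℝ] ℂ := fun τ => localForm e (G.D τ i j) z with hh
  have hsm : ContDiffOn ℝ ∞ h (Ioo (-G.ε) G.ε) := contDiffOn_slice_fst (G.D_smooth e he i j) hz
  set f : ℝ → ℂ →L[ℝ] ℂ := fun τ => G.D τ i j (e.symm z) with hf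
  set Ψ : (ℂ →L[ℝ] ℂ) →L[ℝ] ℂ →L[ℝ] ℂ :=
    (ContinuousLinearMap.compL ℝ ℂ ℂ ℂ).flip (L.symm : ℂ →L[ℝ] ℂ) with hΨ
  have hΨL : ∀ A : ℂ →L[ℝ] ℂ, (Ψ A).comp (L : ℂ →L[ℝ] ℂ) = A := fun A => by
    ext1 u; simp [hΨ]
  have hfh : f = fun τ => Ψ (h τ) := by
    funext τ
    have := hL (G.D τ i j)
    ext1 u
    simp only [hΨ, hh, this]
    change f τ u = f τ (L (L.symm u))
    rw [L.apply_symm_apply]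
  have hd : ∀ τ ∈ Ioo (-G.ε) G.ε, deriv f τ = Ψ (deriv h τ) := by
    intro τ hτ
    rw [hfh]
    exact (Ψ.hasFDerivAt.comp_hasDerivAt τ ((hsm.differentiableOn (by simp)).differentiableAt
      (isOpen_Ioo.mem_nhds hτ)).hasDerivAt).deriv
  have hd2 : deriv (deriv f) 0 = Ψ (deriv (deriv h) 0) := by
    have hev : deriv f =ᶠ[𝓝 0] fun τ => Ψ (deriv h τ) := by
      filter_upwards [isOpen_Ioo.mem_nhds G.zero_mem] with τ hτ
      exact hd τ hτ
    have h2 : ContDiffOn ℝ ∞ (deriv h) (Ioo (-G.ε) G.ε) := hsm.deriv_of_isOpen isOpen_Ioo (by simp)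
    rw [hev.deriv_eq]
    exact (Ψ.hasFDerivAt.comp_hasDerivAt 0 ((h2.differentiableOn (by simp)).differentiableAt
      (isOpen_Ioo.mem_nhds G.zero_mem)).hasDerivAt).deriv
  constructor
  · rw [hL]
    change (deriv f 0).comp (L : ℂ →L[ℝ] ℂ) = _
    rw [hd 0 G.zero_mem, hΨL]
  · rw [hL]
    change (iteratedDeriv 2 f 0).comp (L : ℂ →L[ℝ] ℂ) = _
    rw [iteratedDeriv_two_eq, iteratedDeriv_two_eq, hd2, hΨL]

variable [T2Space X]

theorem gDeriv_symm {e : OpenPartialHomeomorph X ℂ} (he : e ∈ atlas ℂ X) (i j : Fin 2) {z : ℂ}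
    (hz : z ∈ e.target) (hP : e.symm z ∉ η.poles) : G.gDeriv i j (e.symm z)
      = partialFst (fun q : ℝ × ℂ => G.g q.1 (e.symm q.2) i j) (0, z) :=
  deriv_eq_partialFst (z := z) G.ε_pos (isOpen_off e) (G.contDiffOn_g he i j) ⟨hz, hP⟩

theorem gDeriv₂_symm {e : OpenPartialHomeomorph X ℂ} (he : e ∈ atlas ℂ X) (i j : Fin 2) {z : ℂ}
    (hz : z ∈ e.target) (hP : e.symm z ∉ η.poles) : G.gDeriv₂ i j (e.symm z)
      = partialFst (partialFst fun q : ℝ × ℂ => G.g q.1 (e.symm q.2) i j) (0, z) :=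
  iteratedDeriv_two_eq_partialFst (z := z) G.ε_pos (isOpen_off e) (G.contDiffOn_g he i j) ⟨hz, hP⟩

theorem contMDiffOn_gDeriv (i j : Fin 2) :
    ContMDiffOn 𝓘(ℝ, ℂ) 𝓘(ℝ, ℂ) ∞ (G.gDeriv i j) {x | x ∉ η.poles} :=
  contMDiffOn_of_eq
    (v := fun e z => partialFst (fun q : ℝ × ℂ => G.g q.1 (e.symm q.2) i j) (0, z))
    (fun e he => contDiffOn_slice_snd G.zero_mem (contDiffOn_partialFst
      (isOpen_Ioo.prod (isOpen_off e)) (G.contDiffOn_g he i j)))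
    fun _ he _ hz hP => G.gDeriv_symm he i j hz hP

theorem contMDiffOn_gDeriv₂ (i j : Fin 2) :
    ContMDiffOn 𝓘(ℝ, ℂ) 𝓘(ℝ, ℂ) ∞ (G.gDeriv₂ i j) {x | x ∉ η.poles} :=
  contMDiffOn_of_eq
    (v := fun e z => partialFst (partialFst fun q : ℝ × ℂ => G.g q.1 (e.symm q.2) i j) (0, z))
    (fun e he => contDiffOn_slice_snd G.zero_mem (contDiffOn_partialFst
      (isOpen_Ioo.prod (isOpen_off e)) (contDiffOn_partialFst
      (isOpen_Ioo.prod (isOpen_off e)) (G.contDiffOn_g he i j))))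
    fun _ he _ hz hP => G.gDeriv₂_symm he i j hz hP

end DPWPotential.HarmonicGauge

end Gauge

/-! ### First and second order terms of the gauge equation -/

section GaugeEquations

variable {X : Type*} [TopologicalSpace X] [ChartedSpace ℂ X] {η : DPWPotential X}

namespace DPWPotential.HarmonicGauge

variable {ϑ₁ ϑ₂ : MForm X}

theorem hasJet_form (hη : η.HasExpansion ϑ₁ ϑ₂) {e : OpenPartialHomeomorph X ℂ} {z : ℂ}
    (hP : e.symm z ∉ η.poles) (u : ℂ) (i j : Fin 2) :
    HasJet (fun τ => localForm e (η.form (Complex.exp (Complex.I * τ)) i j) z u) 0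
      (localForm e (ϑ₁ i j) z u) (localForm e (ϑ₂ i j) z u) := by
  have h := hη.expansion _ hP (mfderiv 𝓘(ℝ, ℂ) 𝓘(ℝ, ℂ) e.symm z u) i j
  have h3 : (fun τ : ℝ => τ ^ 3) =o[𝓝 0] fun τ : ℝ => τ ^ 2 :=
    isLittleO_pow_pow (by norm_num)
  refine (h.trans_isLittleO h3).congr_left fun τ => ?_
  rw [zero_add]
  rfl

variable [IsManifold 𝓘(ℂ, ℂ) ω X] (G : η.HarmonicGauge)

theorem isSmoothSForm_firstDeriv (i j : Fin 2) : IsSmoothSForm (firstDeriv G.D i j) := by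
  intro e he
  have h := contDiffOn_slice_snd G.zero_mem (contDiffOn_partialFst
    (isOpen_Ioo.prod e.open_target) (G.D_smooth e he i j))
  refine h.congr fun z hz => ?_
  rw [(G.localForm_derivs he i j hz).1]
  exact deriv_eq_partialFst G.ε_pos e.open_target (G.D_smooth e he i j) hz

theorem isSmoothSForm_secondDeriv (i j : Fin 2) : IsSmoothSForm (secondDeriv G.D i j) := by
  intro e he
  have h := contDiffOn_slice_snd G.zero_mem (contDiffOn_partialFst
    (isOpen_Ioo.prod e.open_target) (contDiffOn_partialFst
    (isOpen_Ioo.prod e.open_target) (G.D_smooth e he i j)))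
  refine h.congr fun z hz => ?_
  rw [(G.localForm_derivs he i j hz).2]
  exact iteratedDeriv_two_eq_partialFst G.ε_pos e.open_target (G.D_smooth e he i j) hz

theorem hasJet_D {e : OpenPartialHomeomorph X ℂ} (he : e ∈ atlas ℂ X) (i j : Fin 2) {z : ℂ}
    (hz : z ∈ e.target) (u : ℂ) :
    HasJet (fun τ => localForm e (G.D τ i j) z u) (localForm e (G.D 0 i j) z u)
      (localForm e (firstDeriv G.D i j) z u) (localForm e (secondDeriv G.D i j) z u) := by
  have hsm := contDiffOn_slice_fst (G.D_smooth e he i j) hz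
  have hj := hasJet_of_contDiffOn G.ε_pos (hsm.clm_apply (contDiffOn_const (c := u)))
  have hd : ∀ h : ℝ → ℂ →L[ℝ] ℂ, ContDiffOn ℝ ∞ h (Ioo (-G.ε) G.ε) → ∀ τ ∈ Ioo (-G.ε) G.ε,
      deriv (fun s => h s u) τ = deriv h τ u := by
    intro h hh τ hτ
    have h1 := ((hh.differentiableOn (by simp)).differentiableAt
      (isOpen_Ioo.mem_nhds hτ)).hasDerivAt
    exact ((ContinuousLinearMap.apply ℝ ℂ u).hasFDerivAt.comp_hasDerivAt τ h1).deriv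
  have hev : deriv (fun τ => localForm e (G.D τ i j) z u) =ᶠ[𝓝 0]
      fun τ => deriv (fun s => localForm e (G.D s i j) z) τ u := by
    filter_upwards [isOpen_Ioo.mem_nhds G.zero_mem] with τ hτ
    exact hd _ hsm τ hτ
  rw [(G.localForm_derivs he i j hz).1, (G.localForm_derivs he i j hz).2]
  rw [iteratedDeriv_two_eq, hev.deriv_eq, hev.eq_of_nhds,
    hd _ (hsm.deriv_of_isOpen isOpen_Ioo (by simp)) 0 G.zero_mem] at hj
  rw [iteratedDeriv_two_eq]
  exact hj

theorem hasJet_g {x : X} (hx : x ∉ η.poles) (i j : Fin 2) :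
    HasJet (fun τ => G.g τ x i j) ((1 : Mat) i j) (G.gDeriv i j x) (G.gDeriv₂ i j x) := by
  have hxs := mem_chart_source ℂ x
  have h := contDiffOn_slice_fst (z := chartAt ℂ x x) (G.contDiffOn_g (chart_mem_atlas ℂ x) i j)
    ⟨mem_chart_target ℂ x, by rwa [(chartAt ℂ x).left_inv hxs]⟩
  simp only [(chartAt ℂ x).left_inv hxs] at h
  have hj := hasJet_of_contDiffOn G.ε_pos h
  rw [G.g_zero x hx] at hj
  exact hj

variable [T2Space X]

theorem hasJet_dg {e : OpenPartialHomeomorph X ℂ} (he : e ∈ atlas ℂ X) (i j : Fin 2) {z : ℂ}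
    (hz : z ∈ e.target) (hP : e.symm z ∉ η.poles) (u : ℂ) :
    HasJet (fun τ => fderiv ℝ (fun w => G.g τ (e.symm w) i j) z u) 0
      (fderiv ℝ (G.gDeriv i j ∘ e.symm) z u) (fderiv ℝ (G.gDeriv₂ i j ∘ e.symm) z u) := by
  have hj := hasJet_fderiv_slice G.ε_pos (isOpen_off e) (G.contDiffOn_g he i j)
    (z := z) ⟨hz, hP⟩ u
  have ho := (isOpen_off (η := η) e).mem_nhds ⟨hz, hP⟩
  have h0 : (fun w => G.g 0 (e.symm w) i j) =ᶠ[𝓝 z] fun _ => (1 : Mat) i j := by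
    filter_upwards [ho] with w hw
    rw [G.g_zero _ hw.2]
  have h1 : (G.gDeriv i j ∘ e.symm) =ᶠ[𝓝 z] fun w =>
      partialFst (fun q : ℝ × ℂ => G.g q.1 (e.symm q.2) i j) (0, w) := by
    filter_upwards [ho] with w hw
    exact G.gDeriv_symm he i j hw.1 hw.2
  have h2 : (G.gDeriv₂ i j ∘ e.symm) =ᶠ[𝓝 z] fun w =>
      partialFst (partialFst fun q : ℝ × ℂ => G.g q.1 (e.symm q.2) i j) (0, w) := by
    filter_upwards [ho] with w hw
    exact G.gDeriv₂_symm he i j hw.1 hw.2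
  rw [h1.fderiv_eq, h2.fderiv_eq]
  rw [h0.fderiv_eq] at hj
  simpa using hj

/-- The equation `g D = η g + dg` in a chart. -/
theorem gauge_equation {e : OpenPartialHomeomorph X ℂ} (he : e ∈ atlas ℂ X) {z : ℂ}
    (hz : z ∈ e.target) (hP : e.symm z ∉ η.poles) {τ : ℝ} (hτ : τ ∈ Ioo (-G.ε) G.ε) (u : ℂ)
    (i j : Fin 2) :
    ∑ k, G.g τ (e.symm z) i k * localForm e (G.D τ k j) z u
      = ∑ k, localForm e (η.form (Complex.exp (Complex.I * τ)) i k) z u * G.g τ (e.symm z) k j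
        + fderiv ℝ (fun w => G.g τ (e.symm w) i j) z u := by
  set v := mfderiv 𝓘(ℝ, ℂ) 𝓘(ℝ, ℂ) e.symm z u with hv
  have h := G.D_eq τ hτ _ hP v
  have hdet : IsUnit (G.g τ (e.symm z)).det := by rw [G.g_det τ hτ _ hP]; exact isUnit_one
  have hmat : G.g τ (e.symm z) * (G.D τ).at (e.symm z) v
      = (η.form (Complex.exp (Complex.I * τ))).at (e.symm z) v * G.g τ (e.symm z)
        + dMat (G.g τ) (e.symm z) v := by
    rw [h, gaugeAct, mul_add, ← mul_assoc, ← mul_assoc, ← mul_assoc,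
      Matrix.mul_nonsing_inv _ hdet, one_mul, one_mul]
  have hij := congrFun (congrFun hmat i) j
  rw [Matrix.add_apply, Matrix.mul_apply, Matrix.mul_apply] at hij
  have hd : dMat (G.g τ) (e.symm z) v i j
      = fderiv ℝ (fun w => G.g τ (e.symm w) i j) z u := by
    have hs : ContDiffOn ℝ ∞ ((fun y => G.g τ y i j) ∘ e.symm)
        {z | z ∈ e.target ∧ e.symm z ∉ η.poles} :=
      contDiffOn_slice_snd hτ (G.contDiffOn_g he i j)
    have hm : MDifferentiableAt 𝓘(ℝ, ℂ) 𝓘(ℝ, ℂ) (fun y => G.g τ y i j) (e.symm z) := by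
      refine (contMDiffAt_of_comp_symm he (e.map_target hz) ?_).mdifferentiableAt (n := ∞) (by simp)
      rw [e.right_inv hz]
      exact hs.contDiffAt ((isOpen_off e).mem_nhds ⟨hz, hP⟩)
    have := localForm_dForm he hz hm
    exact congrArg (fun A : ℂ →L[ℝ] ℂ => A u) this
  rw [hd] at hij
  exact hij

/-- First and second order terms of the gauged family off the poles. -/
theorem derivative_equations (hη : η.HasExpansion ϑ₁ ϑ₂) {e : OpenPartialHomeomorph X ℂ}
    (he : e ∈ atlas ℂ X) {z : ℂ} (hz : z ∈ e.target) (hP : e.symm z ∉ η.poles) (u : ℂ)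
    (i j : Fin 2) :
    localForm e (firstDeriv G.D i j) z u
      = localForm e (ϑ₁ i j) z u + fderiv ℝ (G.gDeriv i j ∘ e.symm) z u ∧
    localForm e (secondDeriv G.D i j) z u
      + 2 * ∑ k, G.gDeriv i k (e.symm z) * localForm e (firstDeriv G.D k j) z u
      = localForm e (ϑ₂ i j) z u
      + 2 * ∑ k, localForm e (ϑ₁ i k) z u * G.gDeriv k j (e.symm z)
      + fderiv ℝ (G.gDeriv₂ i j ∘ e.symm) z u := by
  -- Both sides of `g D = η g + dg` are expanded to second order, entry by entry.
  have key : ∀ i j : Fin 2, _ := fun i j => by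
    have hL := ((G.hasJet_g hP i 0).mul (G.hasJet_D he 0 j hz u)).add
      ((G.hasJet_g hP i 1).mul (G.hasJet_D he 1 j hz u))
    have hR := (((hasJet_form hη (e := e) (z := z) hP u i 0).mul (G.hasJet_g hP 0 j)).add
      ((hasJet_form hη (e := e) (z := z) hP u i 1).mul (G.hasJet_g hP 1 j))).add
      (G.hasJet_dg he i j hz hP u)
    refine hL.unique (hR.congr ?_)
    filter_upwards [isOpen_Ioo.mem_nhds G.zero_mem] with τ hτ
    have := G.gauge_equation he hz hP hτ u i j
    rw [Fin.sum_univ_two, Fin.sum_univ_two] at this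
    exact this.symm
  have h00 := key 0 0
  have h01 := key 0 1
  have h10 := key 1 0
  have h11 := key 1 1
  simp at h00 h01 h10 h11
  -- The order zero equations `a0`, …, `a3` say `D 0 = 0`, which removes the terms containing `D 0`
  -- from the higher orders.
  obtain ⟨a0, b0, c0⟩ := h00
  obtain ⟨a1, b1, c1⟩ := h01
  obtain ⟨a2, b2, c2⟩ := h10
  obtain ⟨a3, b3, c3⟩ := h11
  rw [Fin.sum_univ_two, Fin.sum_univ_two]
  fin_cases i <;> fin_cases j
  all_goals simp only [Fin.zero_eta, Fin.mk_one, Fin.isValue]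
  · rw [a0, a2] at b0 c0
    exact ⟨by linear_combination b0, by linear_combination c0⟩
  · rw [a1, a3] at b1 c1
    exact ⟨by linear_combination b1, by linear_combination c1⟩
  · rw [a0, a2] at b2 c2
    exact ⟨by linear_combination b2, by linear_combination c2⟩
  · rw [a1, a3] at b3 c3
    exact ⟨by linear_combination b3, by linear_combination c3⟩

end DPWPotential.HarmonicGauge

end GaugeEquations

/-! ### Primitives of `ϑ₁` and the curvature formula -/

section Curvature

/-- With the diagonal of `F` zero, each diagonal entry of the product is a single scalar product;
these are the two residues that the reciprocity law produces. -/
theorem trace_formResidue_mulForm {X : Type*} [TopologicalSpace X] [ChartedSpace ℂ X]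
    {α β : MForm X} {p : X} {F : X → Mat}
    (hF : IsOffDiagonalPrimitiveAt α p F) :
    Matrix.trace (formResidue p (mulForm F β))
      = residue (fun z => F ((chartAt ℂ p).symm z) 0 1 * localForm (chartAt ℂ p) (β 1 0) z 1)
          (chartAt ℂ p p)
        + residue (fun z => F ((chartAt ℂ p).symm z) 1 0 * localForm (chartAt ℂ p) (β 0 1) z 1)
          (chartAt ℂ p p) := by
  have hexp : ∀ (i : Fin 2) (z : ℂ), localForm (chartAt ℂ p) (mulForm F β i i) z 1
      = F ((chartAt ℂ p).symm z) i 0 * localForm (chartAt ℂ p) (β 0 i) z 1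
        + F ((chartAt ℂ p).symm z) i 1 * localForm (chartAt ℂ p) (β 1 i) z 1 := by
    intro i z
    have : mulForm F β i i ((chartAt ℂ p).symm z)
        = F ((chartAt ℂ p).symm z) i 0 • β 0 i ((chartAt ℂ p).symm z)
        + F ((chartAt ℂ p).symm z) i 1 • β 1 i ((chartAt ℂ p).symm z) := Fin.sum_univ_two _
    rw [localForm, this]
    rfl
  rw [Matrix.trace_fin_two]
  refine congrArg₂ (· + ·) (residue_congr ?_) (residue_congr ?_)
  · filter_upwards [hF.2] with z hz
    rw [hexp, hz.2.1, zero_mul, zero_add]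
  · filter_upwards [hF.2] with z hz
    rw [hexp, hz.2.2, zero_mul, add_zero]

variable {X : Type*} [TopologicalSpace X] [ChartedSpace ℂ X] [IsManifold 𝓘(ℂ, ℂ) ω X] [T2Space X]
  {η : DPWPotential X} {ϑ₁ ϑ₂ : MForm X}

namespace DPWPotential.HarmonicGauge

variable (G : η.HarmonicGauge)

theorem hasFDerivAt_gDeriv (hη : η.HasExpansion ϑ₁ ϑ₂) {e : OpenPartialHomeomorph X ℂ}
    (he : e ∈ atlas ℂ X) {z : ℂ} (hz : z ∈ e.target) (hP : e.symm z ∉ η.poles) (i j : Fin 2) :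
    HasFDerivAt (G.gDeriv i j ∘ e.symm)
      (localForm e (firstDeriv G.D i j) z - localForm e (ϑ₁ i j) z) z := by
  have h := (contDiffAt_comp_symm he (G.contMDiffOn_gDeriv i j) hz hP).differentiableAt
    (by simp) |>.hasFDerivAt
  convert! h using 1
  ext1 u
  rw [sub_apply, (G.derivative_equations hη he hz hP u i j).1]
  ring

/-- Off-diagonal meromorphic primitives of `ϑ₁` near the poles. -/
theorem exists_offDiagonalPrimitive {η : DPWPotential X} (G : η.HarmonicGauge)
    (hη : η.HasExpansion ϑ₁ ϑ₂) (hoff : IsOffDiagonalForm η.poles ϑ₁) (p : X) :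
    ∃ F : X → Mat, IsOffDiagonalPrimitiveAt ϑ₁ p F := by
  set c := chartAt ℂ p with hc
  have hcA : c ∈ atlas ℂ X := chart_mem_atlas ℂ p
  have hz₀ : c p ∈ c.target := mem_chart_target ℂ p
  have hprim : ∀ i j : Fin 2, ∃ h : ℂ → ℂ, ∀ᶠ z in 𝓝 (c p),
      HasFDerivAt h (localForm c (firstDeriv G.D i j) z) z := by
    intro i j
    obtain ⟨R, hR, -, h, -, hh⟩ := exists_local_primitive c.open_target
      (G.isSmoothSForm_firstDeriv i j c hcA) (fun z hz => (G.harmonic.2 c hcA z hz i j).1) hz₀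
    exact ⟨h, Metric.eventually_nhds_iff_ball.2 ⟨R, hR, hh⟩⟩
  choose h hh using hprim
  -- Since `dh = D'` near `p` and `dγ = D' - ϑ₁`, the off-diagonal entries of `h - γ` are primitives
  -- of those of `ϑ₁`.
  set F : X → Mat := fun x => Matrix.of fun i j =>
    if i = j then 0 else h i j (c x) - G.gDeriv i j x with hF
  have hder : ∀ᶠ z in 𝓝[≠] (c p), ∀ i j, HasDerivAt (fun w => F (c.symm w) i j)
      (localForm c (ϑ₁ i j) z 1) z := by
    have hh' : ∀ᶠ z in 𝓝[≠] (c p), ∀ i j,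
        HasFDerivAt (h i j) (localForm c (firstDeriv G.D i j) z) z := by
      apply Filter.Eventually.filter_mono nhdsWithin_le_nhds
      simp only [Filter.eventually_all]
      exact hh
    filter_upwards [hh', eventually_symm_notMem η.poles c hz₀] with z hz hzP i j
    by_cases hij : i = j
    · subst hij
      have h0 : localForm c (ϑ₁ i i) z 1 = 0 := by
        have := hoff _ hzP.2 (mfderiv 𝓘(ℝ, ℂ) 𝓘(ℝ, ℂ) c.symm z (1 : ℂ))
        fin_cases i
        · exact this.1
        · exact this.2
      rw [h0]
      simpa [hF] using hasDerivAt_const z (0 : ℂ)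
    · have h1 := (hz i j).sub (G.hasFDerivAt_gDeriv hη hcA hzP.1 hzP.2 i j)
      rw [sub_sub_cancel] at h1
      -- The real differential is complex linear because `ϑ₁` has type `(1,0)`, so the primitive is
      -- holomorphic.
      have h2 : HasFDerivAt (h i j - G.gDeriv i j ∘ c.symm)
          (ContinuousLinearMap.toSpanSingleton ℂ (localForm c (ϑ₁ i j) z 1)) z := by
        refine hasFDerivAt_of_restrictScalars ℝ h1 ?_
        ext1 u
        rw [(hη.meromorphic₁.isHolomorphicOff i j).complexLinear c hcA z hzP.1 hzP.2 u]
        rfl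
      refine (show HasDerivAt _ _ z from h2.hasDerivAt).congr_of_eventuallyEq ?_ |>.congr_deriv ?_
      · filter_upwards [c.open_target.mem_nhds hzP.1] with w hw
        simp [hF, hij, c.right_inv hw]
      · simp
  refine ⟨F, fun i j => meromorphicAt_of_deriv ((hη.meromorphic₁.2 c hcA i j).2 _ hz₀)
    (hder.mono fun z hz => hz i j), ?_⟩
  filter_upwards [hder] with z hz
  exact ⟨hz, by simp [hF], by simp [hF]⟩

/-- The diagonal of the derivative of the gauge is constant, and that of `D'` vanishes. -/
theorem exists_gDeriv_diag_eq [CompactSpace X] [ConnectedSpace X]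
    (hη : η.HasExpansion ϑ₁ ϑ₂) (hoff : IsOffDiagonalForm η.poles ϑ₁) (i : Fin 2) :
    ∃ a : ℂ, (∀ x ∉ η.poles, G.gDeriv i i x = a) ∧
      ∀ e ∈ atlas ℂ X, ∀ z ∈ e.target, localForm e (firstDeriv G.D i i) z = 0 := by
  have hder : ∀ e ∈ atlas ℂ X, ∀ z ∈ e.target, e.symm z ∉ η.poles →
      HasFDerivAt (G.gDeriv i i ∘ e.symm) (localForm e (firstDeriv G.D i i) z) z := by
    intro e he z hz hP
    have h := G.hasFDerivAt_gDeriv hη he hz hP i i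
    convert! h using 1
    ext1 u
    have h0 : localForm e (ϑ₁ i i) z u = 0 := by
      have := hoff _ hP (mfderiv 𝓘(ℝ, ℂ) 𝓘(ℝ, ℂ) e.symm z u)
      fin_cases i
      · exact this.1
      · exact this.2
    rw [sub_apply, h0, sub_zero]
  have hsm := G.isSmoothSForm_firstDeriv i i
  -- The differential of `γᵢᵢ` is the smooth closed form `D'ᵢᵢ`, so `γᵢᵢ` extends over the poles;
  -- coclosedness of `D'ᵢᵢ` makes the extension harmonic.
  obtain ⟨f, hf, hfeq⟩ := exists_smooth_extension η.poles (G.contMDiffOn_gDeriv i i) hsm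
    (fun e he z hz => (G.harmonic.2 e he z hz i i).1) (fun p hp => by
      filter_upwards [eventually_symm_notMem η.poles _ (mem_chart_target ℂ p)] with z hz
      exact hder _ (chart_mem_atlas ℂ p) z hz.1 hz.2)
  have hfd : ∀ e ∈ atlas ℂ X, ∀ z ∈ e.target,
      localForm e (firstDeriv G.D i i) z = fderiv ℝ (f ∘ e.symm) z := by
    intro e he z hz
    rw [← localForm_dForm he hz ((hf _).mdifferentiableAt (by simp))]
    refine eqOn_target_of_eqOn_off η.poles e (hsm e he).continuousOn
      (isSmoothSForm_dForm hf e he).continuousOn (fun w hw hP => ?_) z hz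
    rw [localForm_dForm he hw ((hf _).mdifferentiableAt (by simp)), ← (hder e he w hw hP).fderiv]
    apply Filter.EventuallyEq.fderiv_eq
    filter_upwards [(isOpen_off (η := η) e).mem_nhds ⟨hw, hP⟩] with y hy
    exact (hfeq _ hy.2).symm
  obtain ⟨a, ha⟩ := exists_eq_const_of_harmonic hf (fun e he z hz => by
    rw [← (G.harmonic.2 e he z hz i i).2]
    apply curl_congr
    filter_upwards [e.open_target.mem_nhds hz] with w hw
    simp only [starLocal, hfd e he w hw])
  refine ⟨a, fun x hx => by rw [← hfeq x hx, ha], fun e he z hz => ?_⟩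
  rw [hfd e he z hz, show f ∘ e.symm = fun _ => a from funext fun w => ha _]
  simp

/-- The off-diagonal entries of `D''`. -/
theorem secondDeriv_offDiag (hη : η.HasExpansion ϑ₁ ϑ₂) (hoff : IsOffDiagonalForm η.poles ϑ₁)
    {a : Fin 2 → ℂ} (ha : ∀ i, ∀ x ∉ η.poles, G.gDeriv i i x = a i)
    (hD : ∀ i, ∀ e ∈ atlas ℂ X, ∀ z ∈ e.target, localForm e (firstDeriv G.D i i) z = 0)
    {i j : Fin 2} (hij : i ≠ j) {e : OpenPartialHomeomorph X ℂ} (he : e ∈ atlas ℂ X) {z : ℂ}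
    (hz : z ∈ e.target) (hP : e.symm z ∉ η.poles) :
    localForm e (secondDeriv G.D i j) z
      - (2 * (a j - a i)) • localForm e (firstDeriv G.D i j) z
      = localForm e (ϑ₂ i j) z
        + fderiv ℝ ((fun x => G.gDeriv₂ i j x - 2 * a j * G.gDeriv i j x) ∘ e.symm) z := by
  have hd₂ := (contDiffAt_comp_symm he (G.contMDiffOn_gDeriv₂ i j) hz hP).differentiableAt
    (by simp) |>.hasFDerivAt
  have hd₁ := (contDiffAt_comp_symm he (G.contMDiffOn_gDeriv i j) hz hP).differentiableAt
    (by simp) |>.hasFDerivAt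
  have hd : HasFDerivAt ((fun x => G.gDeriv₂ i j x - 2 * a j * G.gDeriv i j x) ∘ e.symm) _ z :=
    hd₂.sub (hd₁.const_mul (2 * a j))
  rw [hd.fderiv]
  ext1 u
  obtain ⟨h1, h2⟩ := G.derivative_equations hη he hz hP u i j
  have h0 := hoff _ hP (mfderiv 𝓘(ℝ, ℂ) 𝓘(ℝ, ℂ) e.symm z u)
  have h00 : localForm e (ϑ₁ 0 0) z u = 0 := h0.1
  have h11 : localForm e (ϑ₁ 1 1) z u = 0 := h0.2
  simp only [add_apply, sub_apply, smul_apply, smul_eq_mul]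
  rw [Fin.sum_univ_two, Fin.sum_univ_two] at h2
  fin_cases i <;> fin_cases j
  · exact absurd rfl hij
  · simp only [Fin.zero_eta, Fin.mk_one, Fin.isValue] at h1 h2 ⊢
    rw [ha 0 _ hP, ha 1 _ hP, hD 1 e he z hz, h00, zero_apply] at h2
    linear_combination h2 - 2 * a 1 * h1
  · simp only [Fin.zero_eta, Fin.mk_one, Fin.isValue] at h1 h2 ⊢
    rw [ha 0 _ hP, ha 1 _ hP, hD 0 e he z hz, h11, zero_apply] at h2
    linear_combination h2 - 2 * a 0 * h1
  · exact absurd rfl hij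

/-- The upper left entry of the second order flatness equation `dD'' + 2 D' ∧ D' = 0`. -/
theorem curl_secondDeriv (hη : η.HasExpansion ϑ₁ ϑ₂) (hoff : IsOffDiagonalForm η.poles ϑ₁)
    (hD : ∀ i, ∀ e ∈ atlas ℂ X, ∀ z ∈ e.target, localForm e (firstDeriv G.D i i) z = 0)
    {e : OpenPartialHomeomorph X ℂ} (he : e ∈ atlas ℂ X) {z : ℂ} (hz : z ∈ e.target) :
    curl (localForm e (secondDeriv G.D 0 0)) z
      = -2 * wedge (localForm e (firstDeriv G.D 0 1) z) (localForm e (firstDeriv G.D 1 0) z) := by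
  have hs1 := G.isSmoothSForm_firstDeriv
  refine eqOn_target_of_eqOn_off η.poles e
    (continuousOn_curl e.open_target (G.isSmoothSForm_secondDeriv 0 0 e he))
    (v := fun z => -2 * wedge (localForm e (firstDeriv G.D 0 1) z)
      (localForm e (firstDeriv G.D 1 0) z))
    (continuousOn_const.mul (continuousOn_wedge (hs1 0 1 e he).continuousOn
      (hs1 1 0 e he).continuousOn)) (fun z hz hP => ?_) z hz
  have ho := (isOpen_off (η := η) e).mem_nhds ⟨hz, hP⟩
  -- The second order equation with `D'₀₀ = 0` and `(ϑ₁)₀₀ = 0`. Its curl is `2 dγ₁₀ ∧ (ϑ₁)₀₁ - 2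
  -- dγ₀₁ ∧ D'₁₀`; after substituting `dγ = D' - ϑ₁` the mixed terms cancel and `(ϑ₁)₁₀ ∧ (ϑ₁)₀₁ =
  -- 0`.
  have hev : localForm e (secondDeriv G.D 0 0) =ᶠ[𝓝 z] fun w =>
      localForm e (ϑ₂ 0 0) w
        + (2 * (G.gDeriv 1 0 ∘ e.symm) w) • localForm e (ϑ₁ 0 1) w
        - (2 * (G.gDeriv 0 1 ∘ e.symm) w) • localForm e (firstDeriv G.D 1 0) w
        + fderiv ℝ (G.gDeriv₂ 0 0 ∘ e.symm) w := by
    filter_upwards [ho] with w hw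
    ext1 u
    have h2 := (G.derivative_equations hη he hw.1 hw.2 u 0 0).2
    have h00 : localForm e (ϑ₁ 0 0) w u = 0 :=
      (hoff _ hw.2 (mfderiv 𝓘(ℝ, ℂ) 𝓘(ℝ, ℂ) e.symm w u)).1
    rw [Fin.sum_univ_two, Fin.sum_univ_two, hD 0 e he w hw.1, h00,
      zero_apply] at h2
    simp only [add_apply, sub_apply, smul_apply, smul_eq_mul, Function.comp_apply]
    linear_combination h2
  have hγ : ∀ i j, DifferentiableAt ℝ (fun w => 2 * (G.gDeriv i j ∘ e.symm) w) z := fun i j =>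
    ((contDiffAt_comp_symm he (G.contMDiffOn_gDeriv i j) hz hP).differentiableAt
      (by simp)).const_mul 2
  have hδ := contDiffAt_comp_symm he (G.contMDiffOn_gDeriv₂ 0 0) hz hP
  have hθ₁ : DifferentiableAt ℝ (localForm e (ϑ₁ 0 1)) z :=
    (((hη.meromorphic₁.isHolomorphicOff 0 1).contDiffOn he).contDiffAt ho).differentiableAt
      (by simp)
  have hθ₂ : DifferentiableAt ℝ (localForm e (ϑ₂ 0 0)) z :=
    (((hη.meromorphic₂.isHolomorphicOff 0 0).contDiffOn he).contDiffAt ho).differentiableAt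
      (by simp)
  have hd10 : DifferentiableAt ℝ (localForm e (firstDeriv G.D 1 0)) z :=
    ((hs1 1 0 e he).differentiableOn (by simp)).differentiableAt (e.open_target.mem_nhds hz)
  have hfd : ∀ i j, fderiv ℝ (fun w => 2 * (G.gDeriv i j ∘ e.symm) w) z
      = (2 : ℂ) • (localForm e (firstDeriv G.D i j) z - localForm e (ϑ₁ i j) z) := fun i j =>
    ((G.hasFDerivAt_gDeriv hη he hz hP i j).const_mul 2).fderiv
  rw [curl_congr hev, curl_add ((hθ₂.fun_add ((hγ 1 0).fun_smul hθ₁)).fun_sub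
      ((hγ 0 1).fun_smul hd10))
      ((hδ.fderiv_right (m := ∞) (by simp)).differentiableAt (by simp)),
    curl_sub (hθ₂.fun_add ((hγ 1 0).fun_smul hθ₁)) ((hγ 0 1).fun_smul hd10),
    curl_add hθ₂ ((hγ 1 0).fun_smul hθ₁), curl_smul (hγ 1 0) hθ₁, curl_smul (hγ 0 1) hd10,
    (hη.meromorphic₂.isHolomorphicOff 0 0).curl_eq_zero he hz hP,
    (hη.meromorphic₁.isHolomorphicOff 0 1).curl_eq_zero he hz hP,
    (G.harmonic.2 e he z hz 1 0).1, curl_fderiv hδ, hfd, hfd]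
  have e5 := wedge_eq_zero_of_complexLinear
    ((hη.meromorphic₁.isHolomorphicOff 1 0).complexLinear e he z hz hP)
    ((hη.meromorphic₁.isHolomorphicOff 0 1).complexLinear e he z hz hP)
  simp only [wedge, sub_apply, smul_apply, smul_eq_mul] at e5 ⊢
  linear_combination -2 * e5

end DPWPotential.HarmonicGauge

/-- As `D'` is off-diagonal, the trace pairs `D'₀₁` with `D''₁₀` and `D'₁₀` with `D''₀₁`; up to an
exact term each pairing is covered by the reciprocity law. -/
theorem DPWPotential.HarmonicGauge.curvatureK_eq [CompactSpace X] [ConnectedSpace X]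
    (G : η.HarmonicGauge)
    (hη : η.HasExpansion ϑ₁ ϑ₂) (hoff : IsOffDiagonalForm η.poles ϑ₁) (F : X → X → Mat)
    (hF : ∀ p ∈ η.poles, IsOffDiagonalPrimitiveAt ϑ₁ p (F p)) :
    curvatureK G.D = -∑ p ∈ η.poles, Matrix.trace (formResidue p (mulForm (F p) ϑ₂)) := by
  choose a ha hD using G.exists_gDeriv_diag_eq hη hoff
  have hs1 := G.isSmoothSForm_firstDeriv
  have hs2 := G.isSmoothSForm_secondDeriv
  -- The correction makes `κ i j` cohomologous to `ϑ₂ i j` off the poles.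
  set κ : Fin 2 → Fin 2 → SForm X := fun i j x =>
    secondDeriv G.D i j x - (2 * (a j - a i)) • firstDeriv G.D i j x with hκ
  have hκs : ∀ i j, IsSmoothSForm (κ i j) := fun i j e he =>
    (hs2 i j e he).sub ((hs1 i j e he).const_smul (2 * (a j - a i)))
  have hrec : ∀ i j : Fin 2, i ≠ j → densityIntegral (fun e z =>
      wedge (localForm e (firstDeriv G.D i j) z) (localForm e (κ j i) z))
      = 2 * Real.pi * Complex.I * ∑ p ∈ η.poles, residue (fun z =>
        F p ((chartAt ℂ p).symm z) i j * localForm (chartAt ℂ p) (ϑ₂ j i) z 1)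
          (chartAt ℂ p p) := by
    intro i j hij
    refine densityIntegral_wedge_eq_sum_residue η.poles (hs1 i j) (hκs j i)
      (fun e he z hz => (G.harmonic.2 e he z hz i j).1) (hη.meromorphic₁.isHolomorphicOff i j)
      (hη.meromorphic₂.isHolomorphicOff j i) (G.contMDiffOn_gDeriv i j)
      (δ := fun x => G.gDeriv₂ j i x - 2 * a i * G.gDeriv j i x)
      ((G.contMDiffOn_gDeriv₂ j i).sub ((ContDiff.contMDiff (f := fun w : ℂ => 2 * a i * w)
        (contDiff_const.mul contDiff_id)).comp_contMDiffOn (G.contMDiffOn_gDeriv j i)))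
      ?_ ?_ (fun p x => F p x i j) fun p hp => (hF p hp).2.mono fun z hz => hz.1 i j
    · intro e he z hz hP
      ext1 u
      exact (G.derivative_equations hη he hz hP u i j).1
    · intro e he z hz hP
      exact G.secondDeriv_offDiag hη hoff ha hD hij.symm he hz hP
  have hw : ∀ i j, IsDensity fun e z =>
      wedge (localForm e (firstDeriv G.D i j) z) (localForm e (κ j i) z) := fun i j =>
    isDensity_wedge (fun e he => (hs1 i j e he).continuousOn) fun e he =>
      (hκs j i e he).continuousOn
  -- The corrections add up to `4 (a₀ - a₁) D'₀₁ ∧ D'₁₀`, which is `-2 (a₀ - a₁) dD''₀₀` and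
  -- integrates to zero.
  have hcurl := (isDensity_curl (hs2 0 0)).const_mul (-2 * (a 0 - a 1))
  have htr : ∀ e ∈ atlas ℂ X, ∀ z ∈ e.target,
      traceWedgeLocal e (firstDeriv G.D) (secondDeriv G.D) z
      = wedge (localForm e (firstDeriv G.D 0 1) z) (localForm e (κ 1 0) z)
        + wedge (localForm e (firstDeriv G.D 1 0) z) (localForm e (κ 0 1) z)
        + -2 * (a 0 - a 1) * curl (localForm e (secondDeriv G.D 0 0)) z := by
    intro e he z hz
    rw [G.curl_secondDeriv hη hoff hD he hz]
    have hk : ∀ i j u, localForm e (κ i j) z u = localForm e (secondDeriv G.D i j) z u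
        - 2 * (a j - a i) * localForm e (firstDeriv G.D i j) z u := fun i j u => rfl
    rw [traceWedgeLocal, Matrix.trace_fin_two]
    simp only [Matrix.sub_apply, Matrix.mul_apply, Fin.sum_univ_two, localMat, Matrix.of_apply,
      hD 0 e he z hz, hD 1 e he z hz, zero_apply, wedge, hk]
    ring
  have hintegral : integralTraceWedge (firstDeriv G.D) (secondDeriv G.D)
      = densityIntegral fun e z => traceWedgeLocal e (firstDeriv G.D) (secondDeriv G.D) z := rfl
  rw [curvatureK, hintegral, densityIntegral_congr htr,
    densityIntegral_add ((hw 0 1).add (hw 1 0)) hcurl, densityIntegral_add (hw 0 1) (hw 1 0),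
    densityIntegral_const_mul, densityIntegral_curl_eq_zero (hs2 0 0), hrec 0 1 (by decide),
    hrec 1 0 (by decide), Finset.sum_congr rfl fun p hp => trace_formResidue_mulForm (hF p hp),
    Finset.sum_add_distrib]
  have hπ : (Real.pi : ℂ) ≠ 0 := by exact_mod_cast Real.pi_ne_zero
  generalize ∑ p ∈ η.poles, residue (fun z =>
    F p ((chartAt ℂ p).symm z) 0 1 * localForm (chartAt ℂ p) (ϑ₂ 1 0) z 1) (chartAt ℂ p p) = s
  generalize ∑ p ∈ η.poles, residue (fun z =>
    F p ((chartAt ℂ p).symm z) 1 0 * localForm (chartAt ℂ p) (ϑ₂ 0 1) z 1) (chartAt ℂ p p) = t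
  field_simp
  linear_combination (Real.pi : ℂ) * (s + t) * Complex.I_sq

end Curvature

end

theorem theorem4p4 {X : Type*} [TopologicalSpace X] [ChartedSpace ℂ X]
    [IsManifold 𝓘(ℂ, ℂ) ω X] [T2Space X] [CompactSpace X] [ConnectedSpace X]
    (η : DPWPotential X) (c : η.ClosingData) (hc : c.HasRankTwoPeriods)
    (ϑ₁ ϑ₂ : MForm X) (hη : η.HasExpansion ϑ₁ ϑ₂) (hoff : IsOffDiagonalForm η.poles ϑ₁)
    (G : η.HarmonicGauge) :
    (∀ p ∈ η.poles, ∃ F : X → Mat, IsOffDiagonalPrimitiveAt ϑ₁ p F) ∧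
    ∀ F : X → X → Mat, (∀ p ∈ η.poles, IsOffDiagonalPrimitiveAt ϑ₁ p (F p)) →
      curvatureK G.D = -∑ p ∈ η.poles, Matrix.trace (formResidue p (mulForm (F p) ϑ₂)) := by
  exact ⟨fun p _ => G.exists_offDiagonalPrimitive hη hoff p,
    fun F hF => G.curvatureK_eq hη hoff F hF⟩
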